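/- Let $M$ be a finitely generated group with a strictly ascending sequence of subgroups $G_0<G_1<G_2<\dots$ and elements $a_1,a_2,\dots\in M$; write $S^g=gSg^{-1}$. Suppose that for all $i\ge 1$: (P1) $a_i$ centralizes $G_{i-1}$; (P2) $M=\langle G_i,G_i^{a_i}\rangle$; (P4) for every $c\in G_i\setminus G_{i-1}$, neither $\langle G_i,G_i^{a_ica_i^{-1}}\rangle$ nor $\langle G_i,G_i^{a_i^{-1}ca_i}\rangle$ is contained in a conjugate of $G_n$ in $M$ for any $n\ge 0$. For $i\ge 1$ let $\beta_i:M\to M_i$ be an isomorphism onto a copy of $M$, let $L_i=M\ast_{G_{i-1}=\beta_i(G_{i-1})}M_i$, and let $\phi_i:L_i\to L_{i+1}$ be the homomorphism with $\phi_i(g)=g$ for $g\in M$ and $\phi_i(h)=\beta_{i+1}(a_i)\,\beta_i^{-1}(h)\,\beta_{i+1}(a_i)^{-1}$ for $h\in M_i$. Let $L$ be the direct limit of $(L_i,\phi_i)$, with natural map $\psi_1:L_1\to L$. Let $T_i$ be the geometric realization of the Bass–Serre tree of $L_i$ (vertices $gM$ and $gM_i$, edges $gG_{i-1}$ joining $gM$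 to $gM_i$, for $g\in L_i$) with the path metric $d_i$ in which every edge has length $2^{-(i-1)}$. Let $\varphi_i:T_i\to T_{i+1}$ be the map which, for every $g\in L_i$, sends the half of the edge $gG_{i-1}$ adjacent to $gM$ isometrically onto the edge $\phi_i(g)G_i$, and the half adjacent to $gM_i$ isometrically onto the edge $\phi_i(g)\beta_{i+1}(a_i)G_i$, so that the midpoint goes to the vertex $\phi_i(g)M_{i+1}$, the vertex $gM$ to $\phi_i(g)M$, and the vertex $gM_i$ to $\phi_i(g)\beta_{i+1}(a_i)M$. For $i\le j$ put $\varphi_{ij}=\varphi_{j-1}\circ\dots\circ\varphi_i$. Then: (1) For every $i$, $(T_i,d_i)$ is an $\mathbb{R}$-tree on which $L_i$ acts by isometries; $\phi_i$ and $\varphi_i$ are surjective; $\varphi_i(g\circ x)=\phi_i(g)\circ\varphi_i(x)$ for all $g\in L_i$, $x\in T_i$; and $\varphi_i$ is a morphism of $\mathbb{R}$-trees, i.e. every geodesic segment of $T_i$ can be subdivided into finitely many segments on each of which $\varphi_i$ is an isometric embedding. (2) The sequence $(T_i,d_i,\varphi_i)$ converges strongly: for all $l\ge 1$ and $x,y\in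 T_l$ there is $k\ge l$ such that $d_j(\varphi_{lj}(s),\varphi_{lj}(t))=d_k(\varphi_{lk}(s),\varphi_{lk}(t))$ for all $s,t\in[x,y]$ and all $j\ge k$. (3) Let $(T,d)$ be the limit, that is, the metric space obtained from $T_1$ with the pseudometric $\hat d(x,y)=\lim_{i\to\infty}d_i(\varphi_{1i}(x),\varphi_{1i}(y))$ by identifying points at $\hat d$-distance $0$, and let $\theta_1:T_1\to T$ be the quotient map. Then $(T,d)$ is an $\mathbb{R}$-tree. (4) There is an action of $L$ on $T$ by isometries with $\psi_1(g)\circ\theta_1(x)=\theta_1(g\circ x)$ for all $g\in L_1$, $x\in T_1$. It is non-trivial, i.e. it has no global fixed point, and for any two distinct points $\bar x,\bar y\in T$ there is $m\ge 1$ such that the pointwise stabilizer in $L$ of the geodesic segment $[\bar x,\bar y]$ is isomorphic to a subgroup of $G_{m-1}$. -/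

import Mathlib

open Filter Topology

namespace StrongLimit

noncomputable section

/-! ### Real trees -/

/-- `γ` restricted to `[0, ℓ]` is an isometric embedding. -/
def IsGeodesic {X : Type*} [MetricSpace X] (γ : ℝ → X) (ℓ : ℝ) : Prop :=
  0 ≤ ℓ ∧ ∀ s ∈ Set.Icc 0 ℓ, ∀ t ∈ Set.Icc 0 ℓ, dist (γ s) (γ t) = |s - t|

/-- `A` is a geodesic segment with endpoints `x` and `y`. -/
def IsSegment {X : Type*} [MetricSpace X] (A : Set X) (x y : X) : Prop :=
  ∃ (γ : ℝ → X) (ℓ : ℝ), IsGeodesic γ ℓ ∧ γ 0 = x ∧ γ ℓ = y ∧ A = γ '' Set.Icc 0 ℓ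

/-- A metric space is an `ℝ`-tree if it is geodesic, the intersection of two geodesic segments
with a common endpoint is a geodesic segment, and the union of two geodesic segments that share
only a single endpoint is a geodesic segment. -/
structure IsRTree (X : Type*) [MetricSpace X] : Prop where
  geodesic : ∀ x y : X, ∃ A, IsSegment A x y
  inter : ∀ (x y z : X) (A B : Set X), IsSegment A x y → IsSegment B x z →
    ∃ p q, IsSegment (A ∩ B) p q
  union : ∀ (x y z : X) (A B : Set X), IsSegment A x y → IsSegment B x z → A ∩ B = {x} →
    ∃ p q, IsSegment (A ∪ B) p q

/-- Morphisms of `ℝ`-trees: every geodesic segment can be subdivided into finitely many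
segments on each of which the map is an isometric embedding. -/
def IsTreeMorphism {X Y : Type*} [MetricSpace X] [MetricSpace Y] (f : X → Y) : Prop :=
  ∀ (γ : ℝ → X) (ℓ : ℝ), IsGeodesic γ ℓ → ∃ (n : ℕ) (t : ℕ → ℝ), Monotone t ∧ t 0 = 0 ∧ t n = ℓ ∧
    ∀ k < n, ∀ u ∈ Set.Icc (t k) (t (k + 1)), ∀ v ∈ Set.Icc (t k) (t (k + 1)),
      dist (f (γ u)) (f (γ v)) = dist (γ u) (γ v)

/-! ### Sequences of metric spaces and their strong limits -/

/-- The composition `X l → X (l + 1) → ⋯ → X j` of the maps of a sequence. -/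
def seqMap {X : ℕ → Type*} (f : ∀ n, X n → X (n + 1)) {l j : ℕ} (h : l ≤ j) (x : X l) : X j :=
  Nat.leRecOn h (fun {k} => f k) x

theorem seqMap_self {X : ℕ → Type*} (f : ∀ n, X n → X (n + 1)) {l : ℕ} (x : X l) :
    seqMap f le_rfl x = x := Nat.leRecOn_self x

theorem seqMap_succ {X : ℕ → Type*} (f : ∀ n, X n → X (n + 1)) {l j : ℕ} (h : l ≤ j) (x : X l) :
    seqMap f (Nat.le_succ_of_le h) x = f j (seqMap f h x) := Nat.leRecOn_succ h x

/-- Strong convergence of a sequence of `ℝ`-trees. -/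
def ConvergesStrongly {X : ℕ → Type*} [∀ n, MetricSpace (X n)] (f : ∀ n, X n → X (n + 1)) : Prop :=
  ∀ (l : ℕ) (x y : X l), ∃ (k : ℕ) (hk : l ≤ k), ∀ A : Set (X l), IsSegment A x y →
    ∀ s ∈ A, ∀ t ∈ A, ∀ (j : ℕ) (hj : k ≤ j),
      dist (seqMap f (hk.trans hj) s) (seqMap f (hk.trans hj) t)
        = dist (seqMap f hk s) (seqMap f hk t)

/-- The limit pseudometric on the first space of a sequence: the limit of the distances between
the images of two points. -/
def limDist {X : ℕ → Type*} [∀ n, MetricSpace (X n)] (f : ∀ n, X n → X (n + 1)) (x y : X 0) : ℝ :=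
  limUnder atTop fun n => dist (seqMap f (Nat.zero_le n) x) (seqMap f (Nat.zero_le n) y)

theorem tendsto_limDist {X : ℕ → Type*} [∀ n, MetricSpace (X n)] (f : ∀ n, X n → X (n + 1))
    (hf : ∀ n, LipschitzWith 1 (f n)) (x y : X 0) :
    Tendsto (fun n => dist (seqMap f (Nat.zero_le n) x) (seqMap f (Nat.zero_le n) y)) atTop
      (𝓝 (limDist f x y)) := by
  apply tendsto_nhds_limUnder
  refine ⟨_, tendsto_atTop_ciInf (antitone_nat_of_succ_le fun n => ?_)
    ⟨0, by rintro _ ⟨n, rfl⟩; exact dist_nonneg⟩⟩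
  have e : ∀ z : X 0, seqMap f (Nat.zero_le (n + 1)) z = f n (seqMap f (Nat.zero_le n) z) :=
    fun z => seqMap_succ f (Nat.zero_le n) z
  rw [e, e]
  simpa using (hf n).dist_le_mul (seqMap f (Nat.zero_le n) x) (seqMap f (Nat.zero_le n) y)

/-- The first space of the sequence, to be equipped with the limit pseudometric. -/
def LimitPre {X : ℕ → Type*} [∀ n, MetricSpace (X n)] (f : ∀ n, X n → X (n + 1))
    (_ : ∀ n, LipschitzWith 1 (f n)) : Type _ := X 0

instance {X : ℕ → Type*} [∀ n, MetricSpace (X n)] (f : ∀ n, X n → X (n + 1))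
    (hf : ∀ n, LipschitzWith 1 (f n)) : PseudoMetricSpace (LimitPre f hf) where
  dist x y := limDist f x y
  dist_self x := by
    refine tendsto_nhds_unique (tendsto_limDist f hf x x) ?_
    simp
  dist_comm x y := by
    refine tendsto_nhds_unique (tendsto_limDist f hf x y) ?_
    simpa only [dist_comm] using tendsto_limDist f hf y x
  dist_triangle x y z :=
    le_of_tendsto_of_tendsto' (tendsto_limDist f hf x z)
      ((tendsto_limDist f hf x y).add (tendsto_limDist f hf y z)) fun _ => dist_triangle _ _ _

/-- The limit space: the quotient of the first space by `limDist x y = 0`, with the induced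
metric. -/
abbrev LimitSpace {X : ℕ → Type*} [∀ n, MetricSpace (X n)] (f : ∀ n, X n → X (n + 1))
    (hf : ∀ n, LipschitzWith 1 (f n)) : Type _ := SeparationQuotient (LimitPre f hf)

/-- The natural map from the first space to the limit space. -/
def toLimit {X : ℕ → Type*} [∀ n, MetricSpace (X n)] (f : ∀ n, X n → X (n + 1))
    (hf : ∀ n, LipschitzWith 1 (f n)) (x : X 0) : LimitSpace f hf :=
  SeparationQuotient.mk (X := LimitPre f hf) x

/-! ### Geometric realization of a bipartite graph

The graph has edge set `E` and disjoint vertex sets `V`, `W`; the edge `e` joins `o e` to `t e`,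
and `o`, `t` are surjective in the cases used below.  The realization is obtained from
`E × [0, 1]` by gluing `(e, 0)` to `(e', 0)` when `o e = o e'`, and `(e, 1)` to `(e', 1)` when
`t e = t e'`. -/

section Realization

variable {E V W : Type*} (o : E → V) (t : E → W)

/-- The gluing relation. -/
def realizationSetoid : Setoid (E × unitInterval) where
  r p q := p.2 = q.2 ∧ (p.2 = 0 → o p.1 = o q.1) ∧ (p.2 = 1 → t p.1 = t q.1) ∧
    (p.2 ≠ 0 → p.2 ≠ 1 → p.1 = q.1)
  iseqv := by
    refine ⟨fun p => by simp, ?_, ?_⟩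
    · rintro ⟨e, s⟩ ⟨e', s'⟩ ⟨h, h0, h1, h2⟩
      dsimp only at *
      subst h
      exact ⟨rfl, fun h => (h0 h).symm, fun h => (h1 h).symm, fun h h' => (h2 h h').symm⟩
    · rintro ⟨e, s⟩ ⟨e', s'⟩ ⟨e'', s''⟩ ⟨h, h0, h1, h2⟩ ⟨h', h0', h1', h2'⟩
      dsimp only at *
      subst h h'
      exact ⟨rfl, fun h => (h0 h).trans (h0' h), fun h => (h1 h).trans (h1' h),
        fun h h' => (h2 h h').trans (h2' h h')⟩

/-- The geometric realization. -/
def Realization : Type _ := Quotient (realizationSetoid o t)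

/-- The point with coordinate `s` on the edge `e`. -/
def Realization.pt (e : E) (s : unitInterval) : Realization o t :=
  Quotient.mk (realizationSetoid o t) (e, s)

/-- `HasPath o t x y r`: there is a path of length `r` from `x` to `y` which is a concatenation of
finitely many segments, each contained in an edge, all edges having length `1`. -/
inductive HasPath : Realization o t → Realization o t → ℝ → Prop
  | nil (x : Realization o t) : HasPath x x 0
  | cons (e : E) (s u : unitInterval) (y : Realization o t) (r : ℝ) :
      HasPath (Realization.pt o t e u) y r →
        HasPath (Realization.pt o t e s) y (|(s : ℝ) - u| + r)

/-- The standard simplicial (path) metric, in which all edges have length `1`. -/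
def simplicialDist (x y : Realization o t) : ℝ := sInf {r | HasPath o t x y r}

variable {o t}

theorem HasPath.nonneg {x y : Realization o t} {r : ℝ} (h : HasPath o t x y r) : 0 ≤ r := by
  induction h with
  | nil => exact le_rfl
  | cons e s u y r _ ih => positivity

theorem HasPath.trans {x y z : Realization o t} {r r' : ℝ} (h : HasPath o t x y r)
    (h' : HasPath o t y z r') : HasPath o t x z (r + r') := by
  induction h with
  | nil => simpa using h'
  | cons e s u y r _ ih => rw [add_assoc]; exact .cons e s u z _ (ih h')

theorem HasPath.edge (e : E) (s u : unitInterval) :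
    HasPath o t (Realization.pt o t e s) (Realization.pt o t e u) |(s : ℝ) - u| := by
  simpa using HasPath.cons e s u _ 0 (.nil (Realization.pt o t e u))

theorem HasPath.symm {x y : Realization o t} {r : ℝ} (h : HasPath o t x y r) :
    HasPath o t y x r := by
  induction h with
  | nil x => exact .nil x
  | cons e s u y r _ ih =>
    rw [add_comm, abs_sub_comm]
    exact ih.trans (.edge e u s)

theorem HasPath.simplicialDist_le {x y : Realization o t} {r : ℝ} (h : HasPath o t x y r) :
    simplicialDist o t x y ≤ r :=
  csInf_le ⟨0, fun _ h => h.nonneg⟩ h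

theorem simplicialDist_nonneg (x y : Realization o t) : 0 ≤ simplicialDist o t x y :=
  Real.sInf_nonneg fun _ h => h.nonneg

theorem simplicialDist_triangle (hc : ∀ x y : Realization o t, ∃ r, HasPath o t x y r)
    (x y z : Realization o t) :
    simplicialDist o t x z ≤ simplicialDist o t x y + simplicialDist o t y z := by
  rw [← sub_le_iff_le_add]
  refine le_csInf (hc x y) fun r hr => ?_
  rw [sub_le_comm]
  refine le_csInf (hc y z) fun r' hr' => ?_
  have := (HasPath.trans hr hr').simplicialDist_le
  linarith

theorem HasPath.abs_sub_le {x y : Realization o t} {r : ℝ} (h : HasPath o t x y r)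
    (f : Realization o t → ℝ) (hf : ∀ e (s u : unitInterval),
      |f (Realization.pt o t e s) - f (Realization.pt o t e u)| ≤ |(s : ℝ) - u|) :
    |f x - f y| ≤ r := by
  induction h with
  | nil => simp
  | cons e s u y r _ ih =>
    exact (_root_.abs_sub_le _ (f (Realization.pt o t e u)) _).trans (add_le_add (hf e s u) ih)

/-- A function that is `1`-Lipschitz on edges does not separate points at distance zero. -/
theorem eq_of_simplicialDist_eq_zero' (hc : ∀ x y : Realization o t, ∃ r, HasPath o t x y r)
    {x y : Realization o t} (h : simplicialDist o t x y = 0)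
    (f : Realization o t → ℝ) (hf : ∀ e (s u : unitInterval),
      |f (Realization.pt o t e s) - f (Realization.pt o t e u)| ≤ |(s : ℝ) - u|) : f x = f y := by
  have : |f x - f y| ≤ simplicialDist o t x y :=
    le_csInf (hc x y) fun r hr => HasPath.abs_sub_le hr f hf
  rw [h] at this
  exact sub_eq_zero.1 (abs_eq_zero.1 (le_antisymm this (abs_nonneg _)))

open Classical in
theorem eq_of_simplicialDist_eq_zero (hc : ∀ x y : Realization o t, ∃ r, HasPath o t x y r)
    {x y : Realization o t} (h : simplicialDist o t x y = 0) : x = y := by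
  obtain ⟨⟨e, s⟩, rfl⟩ := Quotient.exists_rep x
  obtain ⟨⟨e', s'⟩, rfl⟩ := Quotient.exists_rep y
  have key := fun f hf => eq_of_simplicialDist_eq_zero' hc h f hf
  have hs : s = s' := by
    have := key (Quotient.lift (fun p => (p.2 : ℝ)) fun p q hpq => by
      exact congrArg Subtype.val hpq.1) fun _ _ _ => le_rfl
    exact Subtype.ext this
  subst hs
  refine Quotient.sound ⟨rfl, ?_, ?_, ?_⟩
  · rintro (rfl : s = 0)
    have := key (Quotient.lift (fun p => if o e = o p.1 then (p.2 : ℝ) else 1) ?_) ?_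
    · by_contra hne
      have h' : (if o e = o e then ((0 : unitInterval) : ℝ) else 1)
        = if o e = o e' then ((0 : unitInterval) : ℝ) else 1 := this
      rw [if_pos rfl, if_neg hne] at h'
      simp at h'
    · rintro ⟨f, s⟩ ⟨f', s'⟩ ⟨h, h0, h1, h2⟩
      dsimp only at *
      subst h
      by_cases hs0 : s = 0
      · rw [h0 hs0]
      · by_cases hs1 : s = 1
        · simp [hs1]
        · rw [h2 hs0 hs1]
    · intro f s u
      change |(if o e = o f then (s : ℝ) else 1) - if o e = o f then (u : ℝ) else 1| ≤ _
      split_ifs <;> simp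
  · rintro (rfl : s = 1)
    have := key (Quotient.lift (fun p => if t e = t p.1 then (p.2 : ℝ) else 0) ?_) ?_
    · by_contra hne
      have h' : (if t e = t e then ((1 : unitInterval) : ℝ) else 0)
        = if t e = t e' then ((1 : unitInterval) : ℝ) else 0 := this
      rw [if_pos rfl, if_neg hne] at h'
      simp at h'
    · rintro ⟨f, s⟩ ⟨f', s'⟩ ⟨h, h0, h1, h2⟩
      dsimp only at *
      subst h
      by_cases hs0 : s = 0
      · simp [hs0]
      · by_cases hs1 : s = 1
        · rw [h1 hs1]
        · rw [h2 hs0 hs1]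
    · intro f s u
      change |(if t e = t f then (s : ℝ) else 0) - if t e = t f then (u : ℝ) else 0| ≤ _
      split_ifs <;> simp
  · intro hs0 hs1
    dsimp only at *
    have := key (Quotient.lift (fun p =>
      if e = p.1 then |(p.2 : ℝ) - s| ⊓ (s ⊓ (1 - s)) else (s : ℝ) ⊓ (1 - s)) ?_) ?_
    · by_contra hne
      have h' : (if e = e then |(s : ℝ) - s| ⊓ (s ⊓ (1 - s)) else (s : ℝ) ⊓ (1 - s))
        = if e = e' then |(s : ℝ) - s| ⊓ (s ⊓ (1 - s)) else (s : ℝ) ⊓ (1 - s) := this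
      rw [if_pos rfl, if_neg hne] at h'
      have p0 : (0 : ℝ) < s := unitInterval.pos_iff_ne_zero.2 hs0
      have p1 : (s : ℝ) < 1 := unitInterval.lt_one_iff_ne_one.2 hs1
      have : (0 : ℝ) < (s : ℝ) ⊓ (1 - s) := lt_min p0 (by linarith)
      rw [sub_self, abs_zero, min_eq_left this.le] at h'
      exact this.ne h'
    · rintro ⟨f, u⟩ ⟨f', u'⟩ ⟨h, h0, h1, h2⟩
      dsimp only at *
      subst h
      have n0 := s.2.1
      have n1 := s.2.2
      by_cases hu0 : u = 0
      · subst hu0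
        have : |((0 : unitInterval) : ℝ) - s| ⊓ ((s : ℝ) ⊓ (1 - s)) = (s : ℝ) ⊓ (1 - s) := by
          refine min_eq_right ?_
          simp [abs_of_nonneg n0]
        rw [this]; simp
      · by_cases hu1 : u = 1
        · subst hu1
          have : |((1 : unitInterval) : ℝ) - s| ⊓ ((s : ℝ) ⊓ (1 - s)) = (s : ℝ) ⊓ (1 - s) := by
            refine min_eq_right ?_
            simp [abs_of_nonneg (sub_nonneg.2 n1)]
          rw [this]; simp
        · rw [h2 hu0 hu1]
    · intro f u v
      change |(if e = f then |(u : ℝ) - s| ⊓ (s ⊓ (1 - s)) else (s : ℝ) ⊓ (1 - s)) -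
        if e = f then |(v : ℝ) - s| ⊓ (s ⊓ (1 - s)) else (s : ℝ) ⊓ (1 - s)| ≤ _
      split_ifs
      · refine (abs_min_sub_min_le_max _ _ _ _).trans (max_le ?_ (by simp))
        refine (abs_abs_sub_abs_le _ _).trans (le_of_eq ?_)
        congr 1
        ring
      · simp

variable (o t) in
/-- The realization of a connected graph in which every edge has length `ℓ`. -/
abbrev Realization.metricSpace (ℓ : ℝ) (hℓ : 0 < ℓ)
    (hc : ∀ x y : Realization o t, ∃ r, HasPath o t x y r) : MetricSpace (Realization o t) where
  dist x y := ℓ * simplicialDist o t x y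
  dist_self x := by
    have := (HasPath.nil x).simplicialDist_le
    rw [le_antisymm this (simplicialDist_nonneg x x), mul_zero]
  dist_comm x y := by
    have : {r | HasPath o t x y r} = {r | HasPath o t y x r} :=
      Set.ext fun r => ⟨HasPath.symm, HasPath.symm⟩
    simp only [simplicialDist, this]
  dist_triangle x y z := by
    rw [← mul_add]
    exact mul_le_mul_of_nonneg_left (simplicialDist_triangle hc x y z) hℓ.le
  eq_of_dist_eq_zero {x y} h := by
    have h' : ℓ * simplicialDist o t x y = 0 := h
    exact eq_of_simplicialDist_eq_zero hc ((mul_eq_zero.1 h').resolve_left hℓ.ne')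

end Realization

/-! ### The Bass–Serre tree of an amalgam

Given subgroups `C ≤ A`, `C ≤ B` of `L`, the graph has vertices `L ⧸ A` and `L ⧸ B` and edges
`L ⧸ C`, the edge `g C` joining `g A` to `g B`. -/

section CosetGraph

variable {L : Type*} [Group L] {A B C : Subgroup L}

/-- The geometric realization of the coset graph. -/
abbrev CosetGraph (hA : C ≤ A) (hB : C ≤ B) : Type _ :=
  Realization (Subgroup.quotientMapOfLE hA) (Subgroup.quotientMapOfLE hB)

theorem quotientMapOfLE_smul {D : Subgroup L} (h : C ≤ D) (g : L) (e : L ⧸ C) :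
    Subgroup.quotientMapOfLE h (g • e) = g • Subgroup.quotientMapOfLE h e := by
  obtain ⟨k, rfl⟩ := QuotientGroup.mk_surjective e
  rfl

/-- `L` acts by left translation of the edges. -/
instance CosetGraph.mulAction (hA : C ≤ A) (hB : C ≤ B) : MulAction L (CosetGraph hA hB) where
  smul g := Quotient.map (fun p => (g • p.1, p.2)) (by
    rintro ⟨e, s⟩ ⟨e', s'⟩ ⟨h, h0, h1, h2⟩
    refine ⟨h, fun hs => ?_, fun hs => ?_, fun hs hs' => ?_⟩
    · simp only [quotientMapOfLE_smul]; rw [h0 hs]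
    · simp only [quotientMapOfLE_smul]; rw [h1 hs]
    · exact congrArg (g • ·) (h2 hs hs'))
  one_smul x := by
    obtain ⟨⟨e, s⟩, rfl⟩ := Quotient.exists_rep x
    exact congrArg (Quotient.mk _) (Prod.ext (one_smul L e) rfl)
  mul_smul g h x := by
    obtain ⟨⟨e, s⟩, rfl⟩ := Quotient.exists_rep x
    exact congrArg (Quotient.mk _) (Prod.ext (mul_smul g h e) rfl)

theorem CosetGraph.smul_pt (hA : C ≤ A) (hB : C ≤ B) (g : L) (e : L ⧸ C) (s : unitInterval) :
    g • (Realization.pt _ _ e s : CosetGraph hA hB) = Realization.pt _ _ (g • e) s := rfl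

theorem CosetGraph.hasPath_smul (hA : C ≤ A) (hB : C ≤ B) (g : L) {x y : CosetGraph hA hB} {r : ℝ}
    (h : HasPath _ _ x y r) : HasPath _ _ (g • x) (g • y) r := by
  induction h with
  | nil x => exact .nil _
  | cons e s u y r _ ih => exact .cons (g • e) s u _ r ih

/-- If `A` and `B` generate `L` then the coset graph is connected. -/
theorem CosetGraph.connected (hA : C ≤ A) (hB : C ≤ B) (hAB : A ⊔ B = ⊤)
    (x y : CosetGraph hA hB) : ∃ r, HasPath _ _ x y r := by
  let p : L → CosetGraph hA hB := fun g => Realization.pt _ _ (g : L ⧸ C) 0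
  have hp : ∀ g h : L, g • p h = p (g * h) := fun g h => rfl
  let S : Subgroup L :=
    { carrier := {g | ∃ r, HasPath _ _ (p 1) (p g) r}
      one_mem' := ⟨0, .nil _⟩
      mul_mem' := by
        rintro g h ⟨r, hr⟩ ⟨r', hr'⟩
        refine ⟨r + r', hr.trans ?_⟩
        simpa [hp] using CosetGraph.hasPath_smul hA hB g hr'
      inv_mem' := by
        rintro g ⟨r, hr⟩
        refine ⟨r, ?_⟩
        simpa [hp] using (CosetGraph.hasPath_smul hA hB g⁻¹ hr).symm }
  have hAS : A ≤ S := by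
    intro g hg
    have : p 1 = p g := Quotient.sound ⟨rfl, fun _ => by
      simpa [QuotientGroup.eq] using hg, fun h => absurd h (by simp), fun h => absurd rfl h⟩
    exact ⟨0, by rw [← this]; exact .nil _⟩
  have hBS : B ≤ S := by
    intro g hg
    have : (Realization.pt _ _ ((1 : L) : L ⧸ C) 1 : CosetGraph hA hB)
        = Realization.pt _ _ (g : L ⧸ C) 1 :=
      Quotient.sound ⟨rfl, fun h => absurd h (by simp), fun _ => by
        simpa [QuotientGroup.eq] using hg, fun _ h => absurd rfl h⟩
    have e1 : HasPath _ _ (p 1) _ _ := HasPath.edge ((1 : L) : L ⧸ C) 0 1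
    have e2 : HasPath _ _ _ (p g) _ := HasPath.edge (g : L ⧸ C) 1 0
    rw [this] at e1
    exact ⟨_, e1.trans e2⟩
  have hS : ∀ g, g ∈ S := fun g => (hAB ▸ sup_le hAS hBS : (⊤ : Subgroup L) ≤ S) trivial
  have base : ∀ z : CosetGraph hA hB, ∃ r, HasPath _ _ (p 1) z r := by
    intro z
    obtain ⟨⟨e, s⟩, rfl⟩ := Quotient.exists_rep z
    obtain ⟨g, rfl⟩ := QuotientGroup.mk_surjective e
    obtain ⟨r, hr⟩ := hS g
    exact ⟨_, hr.trans (.edge (g : L ⧸ C) 0 s)⟩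
  obtain ⟨r, hr⟩ := base x
  obtain ⟨r', hr'⟩ := base y
  exact ⟨_, hr.symm.trans hr'⟩

end CosetGraph

/-! ### The data `M`, `G₀ < G₁ < ⋯`, `a₁, a₂, …` -/

section Data

variable {M : Type*} [Group M]

/-- The conjugate `g H g⁻¹`. -/
def conjSubgroup (g : M) (H : Subgroup M) : Subgroup M := H.map (MulAut.conj g).toMonoidHom

/-- `a i` centralizes `G (i - 1)` for `i ≥ 1`. -/
def CondP1 (G : ℕ → Subgroup M) (a : ℕ → M) : Prop :=
  ∀ i : ℕ, ∀ g ∈ G i, a (i + 1) * g = g * a (i + 1)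

/-- `M` is generated by `G i` and its conjugate by `a i`, for `i ≥ 1`. -/
def CondP2 (G : ℕ → Subgroup M) (a : ℕ → M) : Prop :=
  ∀ i : ℕ, G (i + 1) ⊔ conjSubgroup (a (i + 1)) (G (i + 1)) = ⊤

/-- For `i ≥ 1` and `c ∈ G i \ G (i - 1)`, neither of the subgroups generated by `G i` and its
conjugate by `a i * c * (a i)⁻¹`, respectively by `(a i)⁻¹ * c * a i`, is contained in a conjugate
of some `G n`. -/
def CondP4 (G : ℕ → Subgroup M) (a : ℕ → M) : Prop :=
  ∀ i : ℕ, ∀ c ∈ G (i + 1), c ∉ G i → ∀ (n : ℕ) (g : M),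
    ¬ G (i + 1) ⊔ conjSubgroup (a (i + 1) * c * (a (i + 1))⁻¹) (G (i + 1))
        ≤ conjSubgroup g (G n) ∧
    ¬ G (i + 1) ⊔ conjSubgroup ((a (i + 1))⁻¹ * c * a (i + 1)) (G (i + 1))
        ≤ conjSubgroup g (G n)

/-- The amalgamated free product of two copies of `M` along `G n`.
With indices starting from `1` this is the group `L_{n+1}`. -/
abbrev Amalgam (G : ℕ → Subgroup M) (n : ℕ) : Type _ :=
  Monoid.PushoutI (ι := Bool) (G := fun _ => M) (fun _ => (G n).subtype)

/-- The inclusion of the first factor `M`. -/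
def inM (G : ℕ → Subgroup M) (n : ℕ) : M →* Amalgam G n :=
  Monoid.PushoutI.of (ι := Bool) (G := fun _ => M) (φ := fun _ => (G n).subtype) false

/-- The inclusion of the second factor, the copy `M_{n+1}` of `M`; that is, the isomorphism
`β_{n+1} : M → M_{n+1}` followed by the inclusion. -/
def inM' (G : ℕ → Subgroup M) (n : ℕ) : M →* Amalgam G n :=
  Monoid.PushoutI.of (ι := Bool) (G := fun _ => M) (φ := fun _ => (G n).subtype) true

theorem inM_eq_inM' (G : ℕ → Subgroup M) (n : ℕ) {g : M} (hg : g ∈ G n) :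
    inM G n g = inM' G n g :=
  (Monoid.PushoutI.of_apply_eq_base (G := fun _ => M) (fun _ : Bool => (G n).subtype) false
    ⟨g, hg⟩).trans
    (Monoid.PushoutI.of_apply_eq_base (G := fun _ => M) (fun _ : Bool => (G n).subtype) true
      ⟨g, hg⟩).symm

theorem inM'_comm {G : ℕ → Subgroup M} {a : ℕ → M} (h : CondP1 G a) (n : ℕ) {g : M}
    (hg : g ∈ G n) :
    inM' G (n + 1) (a (n + 1)) * inM' G (n + 1) g = inM' G (n + 1) g * inM' G (n + 1) (a (n + 1)) := by
  rw [← map_mul, h n g hg, map_mul]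

/-- The restrictions of `phi` below to the two factors. -/
def phiFactor (G : ℕ → Subgroup M) (a : ℕ → M) (n : ℕ) : Bool → M →* Amalgam G (n + 1)
  | false => inM G (n + 1)
  | true => (MulAut.conj (inM' G (n + 1) (a (n + 1)))).toMonoidHom.comp (inM G (n + 1))

/-- The homomorphism `φ_n`, which is the identity on `M` and sends the element `h` of the second
copy of `M` to the conjugate of `h ∈ M` by `β(a)`, `β` being the second inclusion in the target. -/
def phi (G : ℕ → Subgroup M) (a : ℕ → M) (hG : Monotone G) (h : CondP1 G a) (n : ℕ) :
    Amalgam G n →* Amalgam G (n + 1) :=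
  Monoid.PushoutI.lift
    (phiFactor G a n)
    ((inM G (n + 1)).comp (G n).subtype)
    (by
      rintro (_ | _)
      · rfl
      · ext ⟨g, hg⟩
        have hg' : g ∈ G (n + 1) := hG n.le_succ hg
        change inM' G (n + 1) (a (n + 1)) * inM G (n + 1) g * (inM' G (n + 1) (a (n + 1)))⁻¹
          = inM G (n + 1) g
        rw [inM_eq_inM' G (n + 1) hg', inM'_comm h n hg, mul_inv_cancel_right])

theorem phi_inM (G : ℕ → Subgroup M) (a : ℕ → M) (hG : Monotone G) (h : CondP1 G a) (n : ℕ)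
    (g : M) : phi G a hG h n (inM G n g) = inM G (n + 1) g :=
  Monoid.PushoutI.lift_of (G := fun _ => M) (phiFactor G a n) _ _ (i := false) g

theorem phi_inM' (G : ℕ → Subgroup M) (a : ℕ → M) (hG : Monotone G) (h : CondP1 G a) (n : ℕ)
    (g : M) : phi G a hG h n (inM' G n g)
      = inM' G (n + 1) (a (n + 1)) * inM G (n + 1) g * (inM' G (n + 1) (a (n + 1)))⁻¹ :=
  Monoid.PushoutI.lift_of (G := fun _ => M) (phiFactor G a n) _ _ (i := true) g

/-! ### The limit group -/

/-- The composition of the homomorphisms `phi`. -/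
def phiLE (G : ℕ → Subgroup M) (a : ℕ → M) (hG : Monotone G) (h : CondP1 G a) (l j : ℕ)
    (hlj : l ≤ j) : Amalgam G l →* Amalgam G j where
  toFun := seqMap (fun n => phi G a hG h n) hlj
  map_one' := by
    induction j, hlj using Nat.le_induction with
    | base => exact seqMap_self _ _
    | succ j hlj ih => rw [seqMap_succ _ hlj, ih, map_one]
  map_mul' x y := by
    induction j, hlj using Nat.le_induction with
    | base => simp only [seqMap_self]
    | succ j hlj ih => simp only [seqMap_succ _ hlj, ih, map_mul]

instance (G : ℕ → Subgroup M) (a : ℕ → M) (hG : Monotone G) (h : CondP1 G a) :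
    DirectedSystem (Amalgam G) (fun l j hlj => phiLE G a hG h l j hlj) where
  map_self _ x := seqMap_self _ x
  map_map _ _ _ hij hjk x := (Nat.leRecOn_trans hij hjk x).symm

/-- The direct limit `L` of the groups `Amalgam G n` along the homomorphisms `phi`. -/
abbrev LimitGroup (G : ℕ → Subgroup M) (a : ℕ → M) (hG : Monotone G) (h : CondP1 G a) : Type _ :=
  DirectLimit (Amalgam G) (phiLE G a hG h)

/-- The natural map from the first group of the sequence to the direct limit. -/
def psi (G : ℕ → Subgroup M) (a : ℕ → M) (hG : Monotone G) (h : CondP1 G a) (g : Amalgam G 0) :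
    LimitGroup G a hG h := Quotient.mk _ ⟨0, g⟩

/-! ### The Bass–Serre trees and the maps between them -/

/-- The amalgamated subgroup `G n` inside the amalgam. -/
def edgeGroup (G : ℕ → Subgroup M) (n : ℕ) : Subgroup (Amalgam G n) := (G n).map (inM G n)

theorem edgeGroup_le (G : ℕ → Subgroup M) (n : ℕ) : edgeGroup G n ≤ (inM G n).range :=
  Subgroup.map_le_range _ _

theorem edgeGroup_le' (G : ℕ → Subgroup M) (n : ℕ) : edgeGroup G n ≤ (inM' G n).range := by
  rintro _ ⟨g, hg, rfl⟩
  exact ⟨g, (inM_eq_inM' G n hg).symm⟩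

theorem range_sup_range (G : ℕ → Subgroup M) (n : ℕ) :
    (inM G n).range ⊔ (inM' G n).range = ⊤ := by
  rw [eq_top_iff]
  intro x _
  induction x using Monoid.PushoutI.induction_on with
  | of i g =>
    cases i
    · exact Subgroup.mem_sup_left ⟨g, rfl⟩
    · exact Subgroup.mem_sup_right ⟨g, rfl⟩
  | base g =>
    exact Subgroup.mem_sup_left ⟨g, Monoid.PushoutI.of_apply_eq_base _ false g⟩
  | mul x y hx hy => exact mul_mem (hx trivial) (hy trivial)

/-- The (realized) Bass–Serre tree of the splitting of `Amalgam G n`. -/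
abbrev BSTree (G : ℕ → Subgroup M) (n : ℕ) : Type _ :=
  CosetGraph (edgeGroup_le G n) (edgeGroup_le' G n)

/-- The metric on the Bass–Serre tree in which every edge has length `1 / 2 ^ n`. -/
instance BSTree.instMetricSpace (G : ℕ → Subgroup M) (n : ℕ) : MetricSpace (BSTree G n) :=
  Realization.metricSpace _ _ (1 / 2 ^ n) (by positivity)
    (CosetGraph.connected _ _ (range_sup_range G n))

theorem phi_edgeGroup (G : ℕ → Subgroup M) (a : ℕ → M) (hG : Monotone G) (h : CondP1 G a) (n : ℕ)
    {c : Amalgam G n} (hc : c ∈ edgeGroup G n) :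
    phi G a hG h n c ∈ edgeGroup G (n + 1) ∧
      phi G a hG h n c * inM' G (n + 1) (a (n + 1)) =
        inM' G (n + 1) (a (n + 1)) * phi G a hG h n c := by
  obtain ⟨g, hg, rfl⟩ := hc
  have hg' : g ∈ G (n + 1) := hG n.le_succ hg
  rw [phi_inM]
  refine ⟨⟨g, hg', rfl⟩, ?_⟩
  rw [inM_eq_inM' G (n + 1) hg', inM'_comm h n hg]

/-- The image of the first half of an edge: `g C ↦ φ(g) C'`. -/
def firstHalf (G : ℕ → Subgroup M) (a : ℕ → M) (hG : Monotone G) (h : CondP1 G a) (n : ℕ) :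
    Amalgam G n ⧸ edgeGroup G n → Amalgam G (n + 1) ⧸ edgeGroup G (n + 1) :=
  Quotient.map' (phi G a hG h n) fun g g' hg => by
    rw [QuotientGroup.leftRel_apply] at hg ⊢
    simpa using (phi_edgeGroup G a hG h n hg).1

/-- The image of the second half of an edge: `g C ↦ φ(g) β(a) C'`. -/
def secondHalf (G : ℕ → Subgroup M) (a : ℕ → M) (hG : Monotone G) (h : CondP1 G a) (n : ℕ) :
    Amalgam G n ⧸ edgeGroup G n → Amalgam G (n + 1) ⧸ edgeGroup G (n + 1) :=
  Quotient.map' (fun g => phi G a hG h n g * inM' G (n + 1) (a (n + 1))) fun g g' hg => by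
    rw [QuotientGroup.leftRel_apply] at hg ⊢
    have := phi_edgeGroup G a hG h n hg
    rw [map_mul, map_inv] at this
    have e : (phi G a hG h n g * inM' G (n + 1) (a (n + 1)))⁻¹ *
        (phi G a hG h n g' * inM' G (n + 1) (a (n + 1)))
        = (phi G a hG h n g)⁻¹ * phi G a hG h n g' := by
      rw [mul_inv_rev, mul_assoc, ← mul_assoc _ (phi G a hG h n g'), this.2, inv_mul_cancel_left]
    rw [e]
    exact this.1

/-- The folding map on a single edge. The edge is subdivided at its midpoint, which is sent to a
vertex of the second type; both halves are sent linearly onto edges. -/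
def foldEdge (G : ℕ → Subgroup M) (a : ℕ → M) (hG : Monotone G) (h : CondP1 G a) (n : ℕ)
    (e : Amalgam G n ⧸ edgeGroup G n) (s : unitInterval) : BSTree G (n + 1) :=
  if (s : ℝ) ≤ 1 / 2 then
    Realization.pt _ _ (firstHalf G a hG h n e) (Set.projIcc 0 1 zero_le_one (2 * (s : ℝ)))
  else
    Realization.pt _ _ (secondHalf G a hG h n e) (Set.projIcc 0 1 zero_le_one (2 - 2 * (s : ℝ)))

/-- The map `φ_n` from the `n`-th Bass–Serre tree to the next one. -/
def foldMap (G : ℕ → Subgroup M) (a : ℕ → M) (hG : Monotone G) (h : CondP1 G a) (n : ℕ) :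
    BSTree G n → BSTree G (n + 1) :=
  Quotient.lift (fun p => foldEdge G a hG h n p.1 p.2) (by
    rintro ⟨e, s⟩ ⟨e', s'⟩ ⟨hs, h0, h1, h2⟩
    dsimp only at *
    subst hs
    by_cases hs0 : s = 0
    · subst hs0
      obtain ⟨g, rfl⟩ := QuotientGroup.mk_surjective e
      obtain ⟨g', rfl⟩ := QuotientGroup.mk_surjective e'
      obtain ⟨m, hm⟩ := QuotientGroup.eq.1 (h0 rfl)
      simp only [foldEdge, Set.Icc.coe_zero, one_div, inv_nonneg, Nat.ofNat_nonneg, if_true,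
        mul_zero, Set.projIcc_left]
      refine Quotient.sound ⟨rfl, fun _ => QuotientGroup.eq.2 ⟨m, ?_⟩,
        fun h => absurd h (by simp), fun h => absurd (by simp) h⟩
      rw [← phi_inM G a hG h, hm, map_mul, map_inv]
      rfl
    · by_cases hs1 : s = 1
      · subst hs1
        obtain ⟨g, rfl⟩ := QuotientGroup.mk_surjective e
        obtain ⟨g', rfl⟩ := QuotientGroup.mk_surjective e'
        obtain ⟨m, hm⟩ := QuotientGroup.eq.1 (h1 rfl)
        have hle : ¬ ((1 : ℝ) ≤ 1 / 2) := by norm_num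
        simp only [foldEdge, Set.Icc.coe_one, if_neg hle, mul_one, sub_self, Set.projIcc_left]
        refine Quotient.sound ⟨rfl, fun _ => QuotientGroup.eq.2 ⟨m, ?_⟩,
          fun h => absurd h (by simp), fun h => absurd (by simp) h⟩
        have := phi_inM' G a hG h n m
        rw [hm, map_mul, map_inv] at this
        change _ = (phi G a hG h n g * inM' G (n + 1) (a (n + 1)))⁻¹ *
          (phi G a hG h n g' * inM' G (n + 1) (a (n + 1)))
        have this' : (phi G a hG h n g)⁻¹ * phi G a hG h n g' = _ := this
        rw [mul_inv_rev, mul_assoc, ← mul_assoc _ (phi G a hG h n g'), this']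
        group
      · rw [h2 hs0 hs1])

theorem foldMap_pt (G : ℕ → Subgroup M) (a : ℕ → M) (hG : Monotone G) (h : CondP1 G a) (n : ℕ)
    (e : Amalgam G n ⧸ edgeGroup G n) (s : unitInterval) :
    foldMap G a hG h n (Realization.pt _ _ e s) = foldEdge G a hG h n e s := rfl

theorem foldEdge_mid (G : ℕ → Subgroup M) (a : ℕ → M) (hG : Monotone G) (h : CondP1 G a) (n : ℕ)
    (e : Amalgam G n ⧸ edgeGroup G n) :
    (Realization.pt _ _ (firstHalf G a hG h n e) 1 : BSTree G (n + 1)) =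
      Realization.pt _ _ (secondHalf G a hG h n e) 1 := by
  obtain ⟨g, rfl⟩ := QuotientGroup.mk_surjective e
  refine Quotient.sound ⟨rfl, fun h => absurd h (by simp),
    fun _ => QuotientGroup.eq.2 ⟨a (n + 1), ?_⟩, fun _ h => absurd rfl h⟩
  simp

theorem foldEdge_hasPath_aux (G : ℕ → Subgroup M) (a : ℕ → M) (hG : Monotone G) (h : CondP1 G a)
    (n : ℕ) (e : Amalgam G n ⧸ edgeGroup G n) (s u : unitInterval) (hsu : s ≤ u) :
    HasPath _ _ (foldEdge G a hG h n e s) (foldEdge G a hG h n e u) (2 * |(s : ℝ) - u|) := by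
  have s0 := s.2.1
  have u1 := u.2.2
  have hsu' : (s : ℝ) ≤ u := hsu
  unfold foldEdge
  split_ifs with hs hu hu
  · convert HasPath.edge _ _ _ using 1
    rw [Set.projIcc_of_mem _ (⟨by linarith, by linarith⟩ : 2 * (s : ℝ) ∈ Set.Icc (0 : ℝ) 1),
      Set.projIcc_of_mem _ (⟨by linarith, by linarith⟩ : 2 * (u : ℝ) ∈ Set.Icc (0 : ℝ) 1)]
    rw [← mul_sub, abs_mul, abs_two]
  · have e1 := HasPath.edge (o := Subgroup.quotientMapOfLE (edgeGroup_le G (n + 1)))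
      (t := Subgroup.quotientMapOfLE (edgeGroup_le' G (n + 1))) (firstHalf G a hG h n e)
      (Set.projIcc 0 1 zero_le_one (2 * (s : ℝ))) 1
    have e2 := HasPath.edge (o := Subgroup.quotientMapOfLE (edgeGroup_le G (n + 1)))
      (t := Subgroup.quotientMapOfLE (edgeGroup_le' G (n + 1))) (secondHalf G a hG h n e)
      1 (Set.projIcc 0 1 zero_le_one (2 - 2 * (u : ℝ)))
    rw [← foldEdge_mid] at e2
    convert e1.trans e2 using 1
    rw [Set.projIcc_of_mem _ (⟨by linarith, by linarith⟩ : 2 * (s : ℝ) ∈ Set.Icc (0 : ℝ) 1),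
      Set.projIcc_of_mem _ (⟨by linarith, by linarith⟩ : 2 - 2 * (u : ℝ) ∈ Set.Icc (0 : ℝ) 1)]
    simp only [Set.Icc.coe_one]
    rw [abs_of_nonpos (by linarith), abs_of_nonpos (by linarith), abs_of_nonneg (by linarith)]
    ring
  · exact absurd (hsu'.trans hu) hs
  · convert HasPath.edge _ _ _ using 1
    rw [Set.projIcc_of_mem _ (⟨by linarith, by linarith⟩ : 2 - 2 * (s : ℝ) ∈ Set.Icc (0 : ℝ) 1),
      Set.projIcc_of_mem _ (⟨by linarith, by linarith⟩ : 2 - 2 * (u : ℝ) ∈ Set.Icc (0 : ℝ) 1)]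
    rw [sub_sub_sub_cancel_left, ← mul_sub, abs_mul, abs_two, abs_sub_comm]

theorem foldMap_hasPath (G : ℕ → Subgroup M) (a : ℕ → M) (hG : Monotone G) (h : CondP1 G a)
    (n : ℕ) {x y : BSTree G n} {r : ℝ} (hr : HasPath _ _ x y r) :
    HasPath _ _ (foldMap G a hG h n x) (foldMap G a hG h n y) (2 * r) := by
  induction hr with
  | nil x => rw [mul_zero]; exact .nil _
  | cons e s u y r _ ih =>
    rw [mul_add]
    refine HasPath.trans ?_ ih
    rcases le_total s u with hsu | hsu
    · exact foldEdge_hasPath_aux G a hG h n e s u hsu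
    · rw [abs_sub_comm]
      exact (foldEdge_hasPath_aux G a hG h n e u s hsu).symm

theorem foldMap_lipschitz (G : ℕ → Subgroup M) (a : ℕ → M) (hG : Monotone G) (h : CondP1 G a)
    (n : ℕ) : LipschitzWith 1 (foldMap G a hG h n) := by
  refine LipschitzWith.of_dist_le_mul fun x y => ?_
  rw [NNReal.coe_one, one_mul]
  change 1 / 2 ^ (n + 1) * simplicialDist _ _ _ _ ≤ 1 / 2 ^ n * simplicialDist _ _ _ _
  have : simplicialDist _ _ (foldMap G a hG h n x) (foldMap G a hG h n y) / 2
      ≤ simplicialDist _ _ x y :=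
    le_csInf (CosetGraph.connected _ _ (range_sup_range G n) x y) fun r hr => by
      have := (foldMap_hasPath G a hG h n hr).simplicialDist_le
      linarith
  have hpos : (0 : ℝ) < 1 / 2 ^ n := by positivity
  calc (1 : ℝ) / 2 ^ (n + 1) * simplicialDist _ _ (foldMap G a hG h n x) (foldMap G a hG h n y)
      = 1 / 2 ^ n * (simplicialDist _ _ (foldMap G a hG h n x) (foldMap G a hG h n y) / 2) := by
        rw [pow_succ]; field_simp
    _ ≤ _ := mul_le_mul_of_nonneg_left this hpos.le

/-- The limit space `T` of the sequence of Bass–Serre trees. -/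
abbrev LimitTree (G : ℕ → Subgroup M) (a : ℕ → M) (hG : Monotone G) (h : CondP1 G a) : Type _ :=
  LimitSpace (foldMap G a hG h) (foldMap_lipschitz G a hG h)

/-- The natural map from the first Bass–Serre tree to the limit space. -/
def theta (G : ℕ → Subgroup M) (a : ℕ → M) (hG : Monotone G) (h : CondP1 G a) (x : BSTree G 0) :
    LimitTree G a hG h := toLimit (foldMap G a hG h) (foldMap_lipschitz G a hG h) x

end Data

/-- The pointwise stabilizer of a set, for an isometric action given as a homomorphism. -/
def pointwiseStabilizer {L X : Type*} [Group L] [MetricSpace X] (ρ : L →* (X ≃ᵢ X)) (A : Set X) :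
    Subgroup L where
  carrier := {g | ∀ z ∈ A, ρ g z = z}
  one_mem' z _ := by simp
  mul_mem' {g g'} hg hg' z hz := by
    rw [map_mul, IsometryEquiv.mul_apply, hg' z hz, hg z hz]
  inv_mem' {g} hg z hz := by
    rw [map_inv]
    exact (IsometryEquiv.symm_apply_eq (ρ g)).2 (hg z hz).symm

end

end StrongLimit

open StrongLimit

/-! All metric statements rest on the four point condition. A geodesic space satisfying it is an
`ℝ`-tree (`FourPoint.isRTree`), it survives limits of distances (`fourPoint_limit`), and it makes
the distance from a point to a point of a segment a function of the distances to the two endpoints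
(`FourPoint.dist_eq_max`). The Bass–Serre trees satisfy it because normal forms in the amalgam yield
a height function on vertices (`bsHeight`), and distance can be read off from heights of common
lower bounds.

Strong convergence is a statement about words. Call an element of `M` bad if it lies in some `G k`.
By (P2) no `a i` with `i ≥ 1` is bad, and by (P4) no conjugate of `c ∈ G i \ G (i - 1)` by `a i` or
its inverse is bad. Write an element of the amalgam as a product of factors `y β(x)`. The map `phi`
turns each factor into `y β(a) x β(a⁻¹)`: the number of factors doubles while edge lengths are
halved. A word without bad letters is reduced at every level, so the distance it encodes never
changes (`permIso_wordProd`). A bad letter `c` persists until the level at which it enters the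
amalgamated subgroup; there it fuses with its neighbours into `a c a⁻¹` or `a⁻¹ c a`, which is not
bad. Hence the number of bad letters can be brought down to zero, and every distance becomes
constant after finitely many steps (`evStable_wordProd`, `evStable`). Geodesics of the limit are
therefore images of geodesics at a finite level.

A nondegenerate arc of the limit comes from a segment at a level `m` so large that the segment
contains an edge. An element fixing the image of this edge at a later level fixes the images of both
halves; comparing the two descriptions of it obtained by induction gives `c₁ = a c₂ a⁻¹` with `c₁,
c₂ ∈ G (m + 1)`, and (P4) then forces `c₁ ∈ G m` (`mem_of_fixes_edge`). So arc stabilizers embed in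
some `G m`. A global fixed point would, by finite generation, already appear at a finite level,
where the whole amalgam would fix a point of its Bass–Serre tree; this is impossible because `G k ≠
M` (`no_global_fixed_point`). -/

namespace StrongLimit

/-! ### Metric spaces satisfying the four point condition -/

section FourPoint

/-- The four point condition of `0`-hyperbolic metric spaces. -/
def FourPoint (X : Type*) [MetricSpace X] : Prop :=
  ∀ x y z w : X, dist x y + dist z w ≤ max (dist x z + dist y w) (dist x w + dist y z)

/-- The point `z` lies metrically between `x` and `y`. -/
def Btw {X : Type*} [MetricSpace X] (x z y : X) : Prop := dist x z + dist z y = dist x y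

variable {X : Type*} [MetricSpace X]

theorem Btw.symm {x z y : X} (h : Btw x z y) : Btw y z x := by
  unfold Btw at *
  rw [dist_comm y z, dist_comm z x, dist_comm y x]; linarith

theorem btw_left (x y : X) : Btw x x y := by simp [Btw]

theorem btw_right (x y : X) : Btw x y y := by simp [Btw]

/-- Distances to the points of a segment are determined by the distances to its endpoints. -/
theorem FourPoint.dist_eq_max (hX : FourPoint X) (s : X) {v t v' : X} (h : Btw v t v') :
    dist s t = max (dist s v - dist v t) (dist s v' - dist t v') := by
  unfold Btw at h
  apply le_antisymm
  · rcases le_max_iff.1 (hX s t v v') with h1 | h1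
    · exact le_max_iff.2 (.inl (by linarith))
    · rw [dist_comm t v] at h1
      exact le_max_iff.2 (.inr (by linarith))
  · refine max_le ?_ ?_
    · have := dist_triangle s t v
      rw [dist_comm t v] at this; linarith
    · have := dist_triangle s t v'
      linarith

/-- A concatenation of two geodesics that overlap in a nondegenerate segment is geodesic. -/
theorem FourPoint.btw_trans (hX : FourPoint X) {x y z w : X} (h1 : Btw x y z) (h2 : Btw y z w)
    (hyz : y ≠ z) : Btw x z w := by
  unfold Btw at *
  have h0 := dist_pos.2 hyz
  refine le_antisymm ?_ (dist_triangle _ _ _)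
  -- The first alternative would give `dist y z ≤ 0`; the second is the required lower bound for
  -- `dist x w`.
  rcases le_max_iff.1 (hX x z y w) with h | h
  · rw [dist_comm z w] at *
    linarith [dist_comm z w]
  · rw [dist_comm z y] at h
    linarith

/-- Points of a segment are determined by their distance to an endpoint. -/
theorem FourPoint.eq_of_btw (hX : FourPoint X) {x y z w : X} (hz : Btw x z y) (hw : Btw x w y)
    (h : dist x z = dist x w) : z = w := by
  have h1 := hX.dist_eq_max w hz
  unfold Btw at *
  have e1 := dist_comm w x
  have : dist w z = 0 := by
    rw [h1, max_def]; split_ifs <;> linarith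
  exact (dist_eq_zero.1 this).symm

theorem Btw.trans_left {x z y w : X} (h : Btw x z y) (hw : Btw x w z) : Btw x w y := by
  unfold Btw at *
  have := dist_triangle x w y
  have := dist_triangle w z y
  linarith

theorem Btw.trans_right {x z y w : X} (h : Btw x z y) (hw : Btw x w z) : Btw w z y := by
  unfold Btw at *
  have := dist_triangle x w y
  have := dist_triangle w z y
  linarith

/-- Two points of a segment split it in the order of their distance to the endpoint. -/
theorem FourPoint.btw_of_le (hX : FourPoint X) {x y z w : X} (hz : Btw x z y) (hw : Btw x w y)
    (h : dist x z ≤ dist x w) : Btw x z w := by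
  have h1 := hX.dist_eq_max w hz
  unfold Btw at *
  have e1 := dist_comm w x
  have e2 := dist_comm w z
  rw [max_def] at h1
  split_ifs at h1 <;> linarith

theorem FourPoint.btw_or_btw (hX : FourPoint X) {x y z w : X} (hz : Btw x z y) (hw : Btw x w y) :
    Btw x w z ∨ Btw z w y := by
  rcases le_total (dist x w) (dist x z) with h | h
  · exact .inl (hX.btw_of_le hw hz h)
  · exact .inr (hw.trans_right (hX.btw_of_le hz hw h))

theorem IsGeodesic.dist_eq {γ : ℝ → X} {ℓ : ℝ} (h : IsGeodesic γ ℓ) : dist (γ 0) (γ ℓ) = ℓ := by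
  rw [h.2 0 ⟨le_rfl, h.1⟩ ℓ ⟨h.1, le_rfl⟩, zero_sub, abs_neg, abs_of_nonneg h.1]

theorem IsGeodesic.dist_zero {γ : ℝ → X} {ℓ : ℝ} (h : IsGeodesic γ ℓ) {t : ℝ}
    (ht : t ∈ Set.Icc 0 ℓ) : dist (γ 0) (γ t) = t := by
  rw [h.2 0 ⟨le_rfl, h.1⟩ t ht, zero_sub, abs_neg, abs_of_nonneg ht.1]

theorem IsGeodesic.btw {γ : ℝ → X} {ℓ : ℝ} (h : IsGeodesic γ ℓ) {t : ℝ}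
    (ht : t ∈ Set.Icc 0 ℓ) : Btw (γ 0) (γ t) (γ ℓ) := by
  unfold Btw
  rw [h.dist_zero ht, h.dist_eq, h.2 t ht ℓ ⟨h.1, le_rfl⟩, abs_of_nonpos (by linarith [ht.2])]
  ring

/-- In a space with the four point condition a geodesic segment consists of all points between
its endpoints. -/
theorem FourPoint.isSegment_eq (hX : FourPoint X) {A : Set X} {x y : X} (h : IsSegment A x y) :
    A = {z | Btw x z y} := by
  obtain ⟨γ, ℓ, hγ, rfl, rfl, rfl⟩ := h
  ext z
  constructor
  · rintro ⟨t, ht, rfl⟩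
    exact hγ.btw ht
  · intro hz
    have hle : dist (γ 0) z ∈ Set.Icc 0 ℓ := by
      refine ⟨dist_nonneg, ?_⟩
      have h1 := hγ.dist_eq
      have h2 : dist (γ 0) z + dist z (γ ℓ) = dist (γ 0) (γ ℓ) := hz
      have h3 := dist_nonneg (x := z) (y := γ ℓ)
      linarith
    exact ⟨_, hle, hX.eq_of_btw (hγ.btw hle) hz (hγ.dist_zero hle)⟩

theorem IsGeodesic.mono {γ : ℝ → X} {ℓ r : ℝ} (h : IsGeodesic γ ℓ) (h0 : 0 ≤ r) (hr : r ≤ ℓ) :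
    IsGeodesic γ r :=
  ⟨h0, fun s hs t ht => h.2 s ⟨hs.1, hs.2.trans hr⟩ t ⟨ht.1, ht.2.trans hr⟩⟩

/-- A geodesic space satisfying the four point condition is an `ℝ`-tree. -/
theorem FourPoint.isRTree (hX : FourPoint X) (hg : ∀ x y : X, ∃ A, IsSegment A x y) :
    IsRTree X := by
  have key : ∀ (x y z : X) (A B : Set X), IsSegment A x y → IsSegment B x z →
      ∃ p, IsSegment (A ∩ B) x p ∧ p ∈ A ∩ B ∧
        2 * dist x p = dist x y + dist x z - dist y z := by
    intro x y z A B hA hB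
    have hB' := hX.isSegment_eq hB
    obtain ⟨γ, ℓ, hγ, rfl, rfl, rfl⟩ := hA
    -- The Gromov product of the other two endpoints at `γ 0`: the two segments agree exactly up to
    -- this time.
    set r := (dist (γ 0) (γ ℓ) + dist (γ 0) z - dist (γ ℓ) z) / 2 with hr
    have t1 := dist_triangle (γ 0) z (γ ℓ)
    have t2 := dist_triangle (γ ℓ) (γ 0) z
    have t3 := dist_triangle (γ 0) (γ ℓ) z
    have c1 := dist_comm (γ ℓ) z
    have c2 := dist_comm (γ ℓ) (γ 0)
    have c3 := dist_comm (γ 0) z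
    have hℓ := hγ.dist_eq
    have r0 : 0 ≤ r := by linarith
    have rl : r ≤ ℓ := by linarith
    have hmem : ∀ t ∈ Set.Icc 0 ℓ, (Btw (γ 0) (γ t) z ↔ t ≤ r) := by
      intro t ht
      have h1 := hX.dist_eq_max z (hγ.btw ht)
      have h2 := hγ.dist_zero ht
      have h3 : dist (γ 0) (γ t) + dist (γ t) (γ ℓ) = dist (γ 0) (γ ℓ) := hγ.btw ht
      have c4 := dist_comm z (γ t)
      unfold Btw
      rw [max_def] at h1
      constructor
      · intro h
        split_ifs at h1 <;> linarith
      · intro h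
        split_ifs at h1 <;> linarith
    have hset : γ '' Set.Icc 0 ℓ ∩ B = γ '' Set.Icc 0 r := by
      rw [hB']
      ext w
      constructor
      · rintro ⟨⟨t, ht, rfl⟩, hw⟩
        exact ⟨t, ⟨ht.1, (hmem t ht).1 hw⟩, rfl⟩
      · rintro ⟨t, ht, rfl⟩
        have ht' : t ∈ Set.Icc 0 ℓ := ⟨ht.1, ht.2.trans rl⟩
        exact ⟨⟨t, ht', rfl⟩, (hmem t ht').2 ht.2⟩
    refine ⟨γ r, ⟨γ, r, hγ.mono r0 rl, rfl, rfl, hset⟩, ?_, ?_⟩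
    · rw [hset]; exact ⟨r, ⟨r0, le_rfl⟩, rfl⟩
    · rw [hγ.dist_zero ⟨r0, rl⟩, hr]; ring
  refine ⟨hg, fun x y z A B hA hB => ?_, fun x y z A B hA hB hAB => ?_⟩
  · obtain ⟨p, hp, -⟩ := key x y z A B hA hB
    exact ⟨x, p, hp⟩
  -- The overlap is a single point, so the Gromov product at `x` vanishes, which says that `x` lies
  -- between `y` and `z`.
  · obtain ⟨p, -, hp, hd⟩ := key x y z A B hA hB
    rw [hAB] at hp
    obtain rfl : p = x := hp
    rw [dist_self, mul_zero] at hd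
    have hx : Btw y p z := by
      unfold Btw; rw [dist_comm y p]; linarith
    obtain ⟨C, hC⟩ := hg y z
    refine ⟨y, z, ?_⟩
    convert hC using 1
    rw [hX.isSegment_eq hA, hX.isSegment_eq hB, hX.isSegment_eq hC]
    ext w
    constructor
    · rintro (hw | hw)
      · exact hx.trans_left hw.symm
      · exact (hx.symm.trans_left hw.symm).symm
    · intro hw
      rcases hX.btw_or_btw hx hw with h | h
      · exact .inl h.symm
      · exact .inr h

/-- A reparametrized concatenation of two geodesics with additive lengths. -/
theorem IsSegment.concat {x y z : X} (hx : ∃ A, IsSegment A x y) (hz : ∃ A, IsSegment A y z)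
    (h : Btw x y z) : ∃ A, IsSegment A x z := by
  obtain ⟨_, γ, ℓ, hγ, rfl, rfl, -⟩ := hx
  obtain ⟨_, δ, m, hδ, h0, rfl, -⟩ := hz
  have l1 := hγ.dist_eq
  have l2 := hδ.dist_eq
  have l0 := hγ.1
  have m0 := hδ.1
  let η : ℝ → X := fun t => if t ≤ ℓ then γ t else δ (t - ℓ)
  -- Only distances across the junction need an argument: a smaller value would make the endpoints
  -- closer than the sum of the two lengths.
  have cross : ∀ s ∈ Set.Icc 0 ℓ, ∀ t ∈ Set.Icc 0 m, dist (γ s) (δ t) = t + ℓ - s := by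
    intro s hs t ht
    have e1 := hγ.dist_zero hs
    have e2 : dist (γ s) (γ ℓ) = ℓ - s := by
      rw [hγ.2 s hs ℓ ⟨l0, le_rfl⟩, abs_of_nonpos (by linarith [hs.2])]; ring
    have e3 := hδ.dist_zero ht
    have e4 : dist (δ t) (δ m) = m - t := by
      rw [hδ.2 t ht m ⟨m0, le_rfl⟩, abs_of_nonpos (by linarith [ht.2])]; ring
    have hb : dist (γ 0) (γ ℓ) + dist (γ ℓ) (δ m) = dist (γ 0) (δ m) := h
    rw [← h0] at e2 hb l1
    have t1 := dist_triangle (γ 0) (γ s) (δ m)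
    have t2 := dist_triangle (γ s) (δ t) (δ m)
    have t3 := dist_triangle (γ s) (δ 0) (δ t)
    apply le_antisymm <;> linarith
  refine ⟨_, η, ℓ + m, ⟨by linarith, ?_⟩, ?_, ?_, rfl⟩
  · intro s hs t ht
    by_cases h1 : s ≤ ℓ <;> by_cases h2 : t ≤ ℓ
    · simp only [η, if_pos h1, if_pos h2]
      exact hγ.2 s ⟨hs.1, h1⟩ t ⟨ht.1, h2⟩
    · simp only [η, if_pos h1, if_neg h2]
      rw [cross s ⟨hs.1, h1⟩ (t - ℓ) ⟨by linarith, by linarith [ht.2]⟩, abs_of_nonpos (by linarith)]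
      ring
    · simp only [η, if_neg h1, if_pos h2]
      rw [dist_comm, cross t ⟨ht.1, h2⟩ (s - ℓ) ⟨by linarith, by linarith [hs.2]⟩,
        abs_of_nonneg (by linarith)]
      ring
    · simp only [η, if_neg h1, if_neg h2]
      rw [hδ.2 (s - ℓ) ⟨by linarith, by linarith [hs.2]⟩ (t - ℓ) ⟨by linarith, by linarith [ht.2]⟩]
      congr 1; ring
  · simp [η, l0]
  · by_cases hm : m = 0
    · subst hm; simp only [η, add_zero, le_refl, if_true]; exact h0.symm
    · have : ¬ ℓ + m ≤ ℓ := by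
        intro h'; exact hm (le_antisymm (by linarith) m0)
      simp [η, this]

/-- The center of a tripod one side of which is a geodesic segment. -/
theorem FourPoint.exists_center (hX : FourPoint X) {x y : X} (z : X) (h : ∃ A, IsSegment A x y) :
    ∃ c, Btw x c y ∧ Btw x c z ∧ Btw y c z := by
  obtain ⟨_, γ, ℓ, hγ, rfl, rfl, -⟩ := h
  set r := (dist (γ 0) (γ ℓ) + dist (γ 0) z - dist (γ ℓ) z) / 2 with hr
  have t1 := dist_triangle (γ 0) z (γ ℓ)
  have t2 := dist_triangle (γ ℓ) (γ 0) z
  have t3 := dist_triangle (γ 0) (γ ℓ) z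
  have c1 := dist_comm (γ ℓ) z
  have c2 := dist_comm (γ ℓ) (γ 0)
  have c3 := dist_comm (γ 0) z
  have hℓ := hγ.dist_eq
  have hrm : r ∈ Set.Icc 0 ℓ := ⟨by linarith, by linarith⟩
  have h1 := hX.dist_eq_max z (hγ.btw hrm)
  have h2 := hγ.dist_zero hrm
  have h3 : dist (γ 0) (γ r) + dist (γ r) (γ ℓ) = dist (γ 0) (γ ℓ) := hγ.btw hrm
  have c4 := dist_comm z (γ r)
  have c5 := dist_comm (γ r) (γ ℓ)
  refine ⟨γ r, hγ.btw hrm, ?_, ?_⟩ <;> unfold Btw <;> rw [max_def] at h1 <;>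
    split_ifs at h1 <;> linarith

end FourPoint

/-! ### Chains of segments in spaces satisfying the four point condition -/

section Chain

variable {X : Type*} [MetricSpace X]

theorem IsSegment.symm {A : Set X} {x y : X} (h : IsSegment A x y) : ∃ B, IsSegment B y x := by
  obtain ⟨γ, ℓ, hγ, rfl, rfl, -⟩ := h
  refine ⟨_, fun t => γ (ℓ - t), ℓ, ⟨hγ.1, fun s hs t ht => ?_⟩, by simp, by simp, rfl⟩
  rw [hγ.2 _ ⟨by linarith [hs.2], by linarith [hs.1]⟩ _ ⟨by linarith [ht.2], by linarith [ht.1]⟩,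
    abs_sub_comm]
  congr 1; ring

/-- `Chain R x z`: the point `z` can be reached from `x` along a geodesic consisting of finitely
many pieces whose endpoints are related by `R`. -/
inductive Chain (R : X → X → Prop) : X → X → Prop
  | nil (x : X) : Chain R x x
  | cons (x y z : X) : R x y → Btw x y z → Chain R y z → Chain R x z

/-- A symmetric relation that holds for subsegments, and whose related pairs are joined by
geodesic segments. -/
structure IsPiece (R : X → X → Prop) : Prop where
  symm : ∀ x y, R x y → R y x
  left : ∀ x c y, R x y → Btw x c y → R x c
  segment : ∀ x y, R x y → ∃ A, IsSegment A x y

variable {R : X → X → Prop}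

theorem IsPiece.right (hR : IsPiece R) {x c y : X} (h : R x y) (hc : Btw x c y) : R c y :=
  hR.symm _ _ (hR.left _ _ _ (hR.symm _ _ h) hc.symm)

theorem Chain.right (hX : FourPoint X) (hR : IsPiece R) {x z : X} (h : Chain R x z) :
    ∀ {c : X}, Btw x c z → Chain R c z := by
  induction h with
  | nil x =>
    intro c hc
    have : c = x := by
      unfold Btw at hc
      rw [dist_self] at hc
      have h1 := dist_nonneg (x := x) (y := c)
      have h2 := dist_nonneg (x := c) (y := x)
      exact dist_eq_zero.1 (by linarith)
    rw [this]; exact .nil x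
  | cons x y z hxy hb _ ih =>
    intro c hc
    rcases hX.btw_or_btw hb hc with h | h
    · exact .cons c y z (hR.right hxy h) (hb.trans_right h) ‹_›
    · exact ih h

/-- The new piece may backtrack along the chain. Cutting both at the center of the tripod `x, y, z`
removes the part traversed twice. -/
theorem Chain.trans_piece (hX : FourPoint X) (hR : IsPiece R) {x y z : X} (hxy : R x y)
    (h : Chain R y z) : Chain R x z := by
  obtain ⟨c, h1, h2, h3⟩ := hX.exists_center z (hR.segment _ _ hxy)
  exact .cons x c z (hR.left _ _ _ hxy h1) h2 (h.right hX hR h3)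

theorem Chain.segment (hR : IsPiece R) {x z : X} (h : Chain R x z) : ∃ A, IsSegment A x z := by
  induction h with
  | nil x =>
    refine ⟨_, fun _ => x, 0, ⟨le_rfl, fun s hs t ht => ?_⟩, rfl, rfl, rfl⟩
    have hs' : s = 0 := le_antisymm hs.2 hs.1
    have ht' : t = 0 := le_antisymm ht.2 ht.1
    simp [hs', ht']
  | cons x y z hxy hb _ ih => exact IsSegment.concat (hR.segment _ _ hxy) ih hb

theorem Chain.exists_subdivision (hX : FourPoint X) (hR : IsPiece R) {x z : X} (h : Chain R x z) :
    ∃ (n : ℕ) (t : ℕ → ℝ), Monotone t ∧ t 0 = 0 ∧ t n = dist x z ∧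
      ∀ k < n, ∀ w w' : X, Btw x w z → Btw x w' z → dist x w ∈ Set.Icc (t k) (t (k + 1)) →
        dist x w' ∈ Set.Icc (t k) (t (k + 1)) → R w w' := by
  induction h with
  | nil x => exact ⟨0, fun _ => 0, monotone_const, rfl, by simp, by simp⟩
  | cons x y z hxy hb _ ih =>
    obtain ⟨n, t, hm, h0, hn, hk⟩ := ih
    -- Breakpoints are distances from the initial point, so those of the tail are shifted by the
    -- length of the new piece.
    refine ⟨n + 1, fun k => Nat.casesOn k 0 fun k => dist x y + t k, ?_, rfl, ?_, ?_⟩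
    · refine monotone_nat_of_le_succ fun k => ?_
      cases k with
      | zero => simp [h0]
      | succ k => simpa using hm (Nat.le_succ k)
    · change dist x y + t n = _
      rw [hn]; exact hb
    · intro k hkn w w' hw hw' hd hd'
      cases k with
      | zero =>
        have e : ∀ v : X, Btw x v z → dist x v ≤ dist x y → Btw x v y := fun v hv hle =>
          hX.btw_of_le hv hb hle
        have u : dist x w ≤ dist x y := by simpa [h0] using hd.2
        have u' : dist x w' ≤ dist x y := by simpa [h0] using hd'.2
        rcases le_total (dist x w) (dist x w') with h | h
        · exact hR.right (hR.left _ _ _ hxy (e w' hw' u')) (hX.btw_of_le hw hw' h)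
        · exact hR.symm _ _ (hR.right (hR.left _ _ _ hxy (e w hw u)) (hX.btw_of_le hw' hw h))
      | succ k =>
        have e : ∀ v : X, Btw x v z → dist x v ∈ Set.Icc (dist x y + t k) (dist x y + t (k + 1)) →
            Btw y v z ∧ dist y v ∈ Set.Icc (t k) (t (k + 1)) := by
          intro v hv hd
          have h1 : 0 ≤ t k := h0 ▸ hm (Nat.zero_le k)
          have h2 : Btw x y v := hX.btw_of_le hb hv (by linarith [hd.1])
          have h3 : dist x y + dist y v = dist x v := h2
          exact ⟨hv.trans_right h2, by linarith [hd.1], by linarith [hd.2]⟩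
        have hw1 := e w hw hd
        have hw2 := e w' hw' hd'
        exact hk k (by omega) w w' hw1.1 hw2.1 hw1.2 hw2.2

/-- The alternative `w = z` is needed because an empty chain has no pieces to cover its only point.
-/
theorem Chain.exists_finite_cover (hX : FourPoint X) {x z : X} (h : Chain R x z) :
    ∃ F : List (X × X), (∀ p ∈ F, R p.1 p.2) ∧
      ∀ w, Btw x w z → w = z ∨ ∃ p ∈ F, Btw p.1 w p.2 := by
  induction h with
  | nil x =>
    refine ⟨[], by simp, fun w hw => .inl ?_⟩
    unfold Btw at hw
    rw [dist_self] at hw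
    have h1 := dist_nonneg (x := x) (y := w)
    have h2 := dist_nonneg (x := w) (y := x)
    exact dist_eq_zero.1 (by linarith)
  | cons x y z hxy hb _ ih =>
    obtain ⟨F, hF, hc⟩ := ih
    refine ⟨(x, y) :: F, ?_, fun w hw => ?_⟩
    · rintro p (_ | ⟨_, hp⟩)
      · exact hxy
      · exact hF p hp
    · rcases hX.btw_or_btw hb hw with h | h
      · exact .inr ⟨(x, y), by simp, h⟩
      · rcases hc w h with h | ⟨p, hp, h⟩
        · exact .inl h
        · exact .inr ⟨p, by simp [hp], h⟩

/-- A map that preserves the distances of points on a common piece is a morphism. -/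
theorem isTreeMorphism_of_chain {Y : Type*} [MetricSpace Y] (hX : FourPoint X) (hR : IsPiece R)
    (hc : ∀ x y : X, Chain R x y) (f : X → Y)
    (hf : ∀ x y, R x y → dist (f x) (f y) = dist x y) : IsTreeMorphism f := by
  intro γ ℓ hγ
  obtain ⟨n, t, hm, h0, hn, hk⟩ := (hc (γ 0) (γ ℓ)).exists_subdivision hX hR
  rw [hγ.dist_eq] at hn
  refine ⟨n, t, hm, h0, hn, fun k hkn u hu v hv => hf _ _ ?_⟩
  have e : ∀ u ∈ Set.Icc (t k) (t (k + 1)), u ∈ Set.Icc 0 ℓ := fun u hu =>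
    ⟨(h0 ▸ hm (Nat.zero_le k)).trans hu.1, hu.2.trans (hn ▸ hm hkn)⟩
  refine hk k hkn _ _ (hγ.btw (e u hu)) (hγ.btw (e v hv)) ?_ ?_
  · rwa [hγ.dist_zero (e u hu)]
  · rwa [hγ.dist_zero (e v hv)]

end Chain

/-! ### Realizations of trees -/

section TreeRealization

variable {E V W : Type*} {o : E → V} {t : E → W}

/-- A height function on the vertices of a bipartite graph which changes by one along every edge
and for which every vertex is the upper end of at most one edge. A connected graph with such a
function is a tree. -/
structure TreeHeight (o : E → V) (t : E → W) where
  hV : V → ℤ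
  hW : W → ℤ
  diff : ∀ e, hW (t e) = hV (o e) + 1 ∨ hV (o e) = hW (t e) + 1
  uniqV : ∀ e e', o e = o e' → hV (o e) = hW (t e) + 1 → hV (o e') = hW (t e') + 1 → e = e'
  uniqW : ∀ e e', t e = t e' → hW (t e) = hV (o e) + 1 → hW (t e') = hV (o e') + 1 → e = e'

namespace TreeHeight

/-- The height of a point of the realization. -/
noncomputable def height (H : TreeHeight o t) : Realization o t → ℝ :=
  Quotient.lift (fun p => (1 - (p.2 : ℝ)) * H.hV (o p.1) + p.2 * H.hW (t p.1)) (by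
    rintro ⟨e, s⟩ ⟨e', s'⟩ ⟨h, h0, h1, h2⟩
    dsimp only at *
    subst h
    by_cases hs0 : s = 0
    · simp [hs0, h0 hs0]
    · by_cases hs1 : s = 1
      · simp [hs1, h1 hs1]
      · rw [h2 hs0 hs1])

theorem height_pt (H : TreeHeight o t) (e : E) (s : unitInterval) :
    H.height (Realization.pt o t e s) = (1 - (s : ℝ)) * H.hV (o e) + s * H.hW (t e) := rfl

theorem height_sub (H : TreeHeight o t) (e : E) :
    (∀ s u : unitInterval, H.height (Realization.pt o t e s) - H.height (Realization.pt o t e u)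
      = s - u) ∨
    ∀ s u : unitInterval, H.height (Realization.pt o t e s) - H.height (Realization.pt o t e u)
      = u - s := by
  simp only [height_pt]
  rcases H.diff e with h | h
  · left; intro s u; rw [h]; push_cast; ring
  · right; intro s u; rw [h]; push_cast; ring

theorem abs_height_sub (H : TreeHeight o t) (e : E) (s u : unitInterval) :
    |H.height (Realization.pt o t e s) - H.height (Realization.pt o t e u)| = |(s : ℝ) - u| := by
  rcases H.height_sub e with h | h <;> rw [h s u]
  exact abs_sub_comm _ _

/-- The point `z` is reached from `x` along a path on which the height decreases. -/
inductive Below (H : TreeHeight o t) (z : Realization o t) : Realization o t → Prop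
  | refl : Below H z z
  | step (e : E) (s u : unitInterval) : Below H z (Realization.pt o t e s) →
      H.height (Realization.pt o t e s) ≤ H.height (Realization.pt o t e u) →
      Below H z (Realization.pt o t e u)

variable {H : TreeHeight o t}

theorem Below.height_le {z x : Realization o t} (h : Below H z x) : H.height z ≤ H.height x := by
  induction h with
  | refl => exact le_rfl
  | step e s u _ hle ih => exact ih.trans hle

theorem Below.hasPath {z x : Realization o t} (h : Below H z x) :
    HasPath o t z x (H.height x - H.height z) := by
  induction h with
  | refl => rw [sub_self]; exact .nil z
  | step e s u _ hle ih =>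
    convert ih.trans (HasPath.edge e s u) using 1
    rw [← H.abs_height_sub, abs_sub_comm, abs_of_nonneg (by linarith)]
    ring

theorem Below.trans {z y x : Realization o t} (h : Below H z y) (h' : Below H y x) :
    Below H z x := by
  induction h' with
  | refl => exact h
  | step e s u _ hle ih => exact .step e s u ih hle

theorem eq_of_height_eq (e : E) (s u : unitInterval)
    (h : H.height (Realization.pt o t e s) = H.height (Realization.pt o t e u)) : s = u := by
  have := H.abs_height_sub e s u
  rw [h, sub_self, abs_zero] at this
  exact Subtype.ext (sub_eq_zero.1 (abs_eq_zero.1 this.symm))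

/-- If a point lies on two edges then it is the lower end of one of them. -/
theorem eq_or_minimal {e e' : E} {u u' : unitInterval}
    (h : Realization.pt o t e u = Realization.pt o t e' u') :
    u = u' ∧ (e = e' ∨ (∀ s, H.height (Realization.pt o t e u) ≤ H.height (Realization.pt o t e s))
      ∨ ∀ s, H.height (Realization.pt o t e' u') ≤ H.height (Realization.pt o t e' s)) := by
  obtain ⟨hu, h0, h1, h2⟩ := Quotient.exact h
  dsimp only at *
  subst hu
  refine ⟨rfl, ?_⟩
  by_cases hs0 : u = 0
  · subst hs0
    have hd := H.diff e
    have hd' := H.diff e'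
    have hu := H.uniqV e e' (h0 rfl)
    by_cases hA : H.hV (o e) = H.hW (t e) + 1
    · by_cases hB : H.hV (o e') = H.hW (t e') + 1
      · exact .inl (hu hA hB)
      · right; right; intro s
        have : H.hW (t e') = H.hV (o e') + 1 := by tauto
        rw [height_pt, height_pt, this]; push_cast
        have := s.2.1
        linarith
    · right; left; intro s
      have : H.hW (t e) = H.hV (o e) + 1 := by tauto
      rw [height_pt, height_pt, this]; push_cast
      have := s.2.1
      linarith
  · by_cases hs1 : u = 1
    · subst hs1
      have hd := H.diff e
      have hd' := H.diff e'
      have hu := H.uniqW e e' (h1 rfl)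
      by_cases hA : H.hW (t e) = H.hV (o e) + 1
      · by_cases hB : H.hW (t e') = H.hV (o e') + 1
        · exact .inl (hu hA hB)
        · right; right; intro s
          have : H.hV (o e') = H.hW (t e') + 1 := by tauto
          rw [height_pt, height_pt, this]; push_cast
          have := s.2.2
          linarith
      · right; left; intro s
        have : H.hV (o e) = H.hW (t e) + 1 := by tauto
        rw [height_pt, height_pt, this]; push_cast
        have := s.2.2
        linarith
    · exact .inl (h2 hs0 hs1)

/-- Every point is left downwards along at most one edge, so two descents from `x` agree until one
of them stops. This is where the uniqueness of upper ends makes the graph a tree. -/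
theorem Below.edge_or {z x : Realization o t} (h : Below H z x) :
    ∀ (e : E) (s u : unitInterval), x = Realization.pt o t e u →
      H.height (Realization.pt o t e s) ≤ H.height (Realization.pt o t e u) →
      Below H z (Realization.pt o t e s) ∨ Below H (Realization.pt o t e s) z := by
  induction h with
  | refl =>
    rintro e s u rfl hle
    exact .inr (.step e s u .refl hle)
  | step e₁ s₁ u₁ hz hle₁ ih =>
    intro e s u hx hle
    obtain ⟨rfl, rfl | hmin | hmin⟩ := eq_or_minimal (H := H) hx
    · rcases le_total (H.height (Realization.pt o t e₁ s)) (H.height (Realization.pt o t e₁ s₁))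
        with h | h
      · exact ih e₁ s s₁ rfl h
      · exact .inl (.step e₁ s₁ s hz h)
    -- The last step of the descent to `z` was trivial, since its edge has no lower point; drop it.
    · have : s₁ = u₁ := eq_of_height_eq e₁ s₁ u₁ (le_antisymm hle₁ (hmin _))
      subst this
      exact ih e s s₁ hx hle
    -- Here the competing descent along `e` is the trivial one.
    · have : s = u₁ := eq_of_height_eq e s u₁ (le_antisymm hle (hmin _))
      subst this
      rw [← hx]
      exact .inl (.step e₁ s₁ s hz hle₁)

theorem Below.total {z x : Realization o t} (h : Below H z x) :
    ∀ {z'}, Below H z' x → Below H z z' ∨ Below H z' z := by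
  induction h with
  | refl => exact fun h => .inr h
  | step e s u hz hle ih =>
    intro z' hz'
    rcases hz'.edge_or e s u rfl hle with h | h
    · exact ih h
    · exact .inl (hz.trans h)

/-- A common lower bound is carried along a path. On a downward move the new point is comparable
with the old bound, and the lower of the two serves; on an upward move the old bound still works. -/
theorem exists_below (hc : ∀ x y : Realization o t, ∃ r, HasPath o t x y r)
    (x y : Realization o t) : ∃ z, Below H z x ∧ Below H z y := by
  obtain ⟨r, h⟩ := hc x y
  induction h with
  | nil x => exact ⟨x, .refl, .refl⟩
  | cons e s u y r _ ih =>
    obtain ⟨z, h1, h2⟩ := ih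
    rcases le_total (H.height (Realization.pt o t e s)) (H.height (Realization.pt o t e u))
      with h | h
    · rcases h1.edge_or e s u rfl h with h' | h'
      · exact ⟨z, h', h2⟩
      · exact ⟨_, .refl, h'.trans h2⟩
    · exact ⟨z, .step e u s h1 h, h2⟩

variable (H) in
/-- The height of the highest common lower bound of two points. -/
noncomputable def meet (x y : Realization o t) : ℝ :=
  sSup {r | ∃ z, Below H z x ∧ Below H z y ∧ r = H.height z}

theorem le_meet {x y z : Realization o t} (hx : Below H z x) (hy : Below H z y) :
    H.height z ≤ H.meet x y :=
  le_csSup ⟨H.height x, by rintro _ ⟨w, h, -, rfl⟩; exact h.height_le⟩ ⟨z, hx, hy, rfl⟩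

theorem meet_le (hc : ∀ x y : Realization o t, ∃ r, HasPath o t x y r) {x y : Realization o t}
    {r : ℝ} (h : ∀ z, Below H z x → Below H z y → H.height z ≤ r) : H.meet x y ≤ r := by
  refine csSup_le ?_ ?_
  · obtain ⟨z, h1, h2⟩ := exists_below (H := H) hc x y
    exact ⟨_, z, h1, h2, rfl⟩
  · rintro _ ⟨z, h1, h2, rfl⟩
    exact h z h1 h2

theorem meet_comm (x y : Realization o t) : H.meet x y = H.meet y x := by
  unfold meet
  congr 1
  ext r
  exact ⟨fun ⟨z, a, b, c⟩ => ⟨z, b, a, c⟩, fun ⟨z, a, b, c⟩ => ⟨z, b, a, c⟩⟩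

/-- A lower bound of `x, y` and one of `y, z` both lie below `y`, hence are comparable, and the
lower one is below `x` and `z`. -/
theorem meet_ultra (hc : ∀ x y : Realization o t, ∃ r, HasPath o t x y r)
    (x y z : Realization o t) : H.meet x y ≤ H.meet x z ∨ H.meet y z ≤ H.meet x z := by
  by_contra! hcon
  obtain ⟨h1, h2⟩ := hcon
  have h1' : ∃ u, Below H u x ∧ Below H u y ∧ H.meet x z < H.height u := by
    by_contra! h
    exact absurd (meet_le hc fun u a b => h u a b) (not_le.2 h1)
  have h2' : ∃ u, Below H u y ∧ Below H u z ∧ H.meet x z < H.height u := by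
    by_contra! h
    exact absurd (meet_le hc fun u a b => h u a b) (not_le.2 h2)
  obtain ⟨u, hux, huy, hu⟩ := h1'
  obtain ⟨v, hvy, hvz, hv⟩ := h2'
  rcases huy.total hvy with h | h
  · exact absurd (le_meet hux (h.trans hvz)) (not_le.2 hu)
  · exact absurd (le_meet (h.trans hux) hvz) (not_le.2 hv)

/-- Descending to a common lower bound and climbing again gives `≤`. For `≥`, the ultrametric
inequality shows that the right-hand side drops by at most the length of a segment when its starting
point moves along that segment. Thus `meet` plays the role of a Gromov product, and its ultrametric
inequality yields the four point condition. -/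
theorem simplicialDist_eq (H : TreeHeight o t)
    (hc : ∀ x y : Realization o t, ∃ r, HasPath o t x y r) (x y : Realization o t) :
    simplicialDist o t x y = H.height x + H.height y - 2 * H.meet x y := by
  apply le_antisymm
  · have : H.meet x y ≤ (H.height x + H.height y - simplicialDist o t x y) / 2 :=
      meet_le hc fun z hx hy => by
        have := (hx.hasPath.symm.trans hy.hasPath).simplicialDist_le
        linarith
    linarith
  · refine le_csInf (hc x y) fun r hr => ?_
    induction hr with
    | nil x =>
      have := le_meet (H := H) (Below.refl (z := x)) .refl
      linarith
    | cons e s u y r _ ih =>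
      have hm : H.meet (Realization.pt o t e u) y ≤ H.height (Realization.pt o t e u) :=
        meet_le hc fun z h _ => h.height_le
      have habs := H.abs_height_sub e s u
      rcases le_total (H.height (Realization.pt o t e s)) (H.height (Realization.pt o t e u))
        with h | h
      · rw [abs_of_nonpos (by linarith)] at habs
        have hse : H.height (Realization.pt o t e s) ≤
            H.meet (Realization.pt o t e s) (Realization.pt o t e u) :=
          le_meet .refl (.step e s u .refl h)
        rcases meet_ultra (H := H) hc (Realization.pt o t e s) (Realization.pt o t e u) y
          with h' | h' <;> linarith
      · rw [abs_of_nonneg (by linarith)] at habs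
        have hse : H.height (Realization.pt o t e u) ≤
            H.meet (Realization.pt o t e s) (Realization.pt o t e u) :=
          le_meet (.step e u s .refl h) .refl
        rcases meet_ultra (H := H) hc (Realization.pt o t e s) (Realization.pt o t e u) y
          with h' | h' <;> linarith

theorem simplicialDist_fourPoint (H : TreeHeight o t)
    (hc : ∀ x y : Realization o t, ∃ r, HasPath o t x y r) (x y z w : Realization o t) :
    simplicialDist o t x y + simplicialDist o t z w ≤
      max (simplicialDist o t x z + simplicialDist o t y w)
        (simplicialDist o t x w + simplicialDist o t y z) := by
  simp only [H.simplicialDist_eq hc]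
  by_contra! h
  obtain ⟨h1, h2⟩ := max_lt_iff.1 h
  have e1 := meet_comm (H := H) z y
  have e2 := meet_comm (H := H) w y
  have e3 := meet_comm (H := H) z x
  rcases meet_ultra (H := H) hc x z y with a | a <;>
  rcases meet_ultra (H := H) hc x w y with b | b <;>
  rcases meet_ultra (H := H) hc z x w with c | c <;>
  rcases meet_ultra (H := H) hc z y w with d | d <;>
  linarith

/-- The height changes at unit speed along each edge, so no path can be shorter than the height
difference. -/
theorem simplicialDist_pt (H : TreeHeight o t)
    (hc : ∀ x y : Realization o t, ∃ r, HasPath o t x y r) (e : E) (s u : unitInterval) :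
    simplicialDist o t (Realization.pt o t e s) (Realization.pt o t e u) = |(s : ℝ) - u| := by
  refine le_antisymm (HasPath.edge e s u).simplicialDist_le (le_csInf (hc _ _) fun r hr => ?_)
  rw [← H.abs_height_sub]
  exact hr.abs_sub_le _ fun e s u => (H.abs_height_sub e s u).le

end TreeHeight

open Classical in
/-- Distinct vertices of the first kind have distance at least `2`. -/
theorem two_le_simplicialDist_zero (hc : ∀ x y : Realization o t, ∃ r, HasPath o t x y r)
    {e e' : E} (h : o e ≠ o e') :
    2 ≤ simplicialDist o t (Realization.pt o t e 0) (Realization.pt o t e' 0) := by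
  refine le_csInf (hc _ _) fun r hr => ?_
  -- The test function is `0` at the vertex `o e`, `1` at all vertices of the second kind and `2` at
  -- the other vertices of the first kind.
  have := hr.abs_sub_le (Quotient.lift
    (fun p => if o e = o p.1 then (p.2 : ℝ) else 2 - p.2) ?_) ?_
  · have h' : |(if o e = o e then ((0 : unitInterval) : ℝ) else 2 - (0 : unitInterval))
      - if o e = o e' then ((0 : unitInterval) : ℝ) else 2 - (0 : unitInterval)| ≤ r := this
    rw [if_pos rfl, if_neg h] at h'
    simpa using h'
  · rintro ⟨f, s⟩ ⟨f', s'⟩ ⟨h, h0, h1, h2⟩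
    dsimp only at *
    subst h
    by_cases hs0 : s = 0
    · rw [h0 hs0]
    · by_cases hs1 : s = 1
      · simp only [hs1, Set.Icc.coe_one]; split_ifs <;> norm_num
      · rw [h2 hs0 hs1]
  · intro f s u
    change |(if o e = o f then (s : ℝ) else 2 - s) - if o e = o f then (u : ℝ) else 2 - u| ≤ _
    split_ifs
    · exact le_rfl
    · rw [sub_sub_sub_cancel_left, abs_sub_comm]

open Classical in
/-- Distinct vertices of the second kind have distance at least `2`. -/
theorem two_le_simplicialDist_one (hc : ∀ x y : Realization o t, ∃ r, HasPath o t x y r)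
    {e e' : E} (h : t e ≠ t e') :
    2 ≤ simplicialDist o t (Realization.pt o t e 1) (Realization.pt o t e' 1) := by
  refine le_csInf (hc _ _) fun r hr => ?_
  -- The test function is `1` at the vertex `t e`, `0` at all vertices of the first kind and `-1` at
  -- the other vertices of the second kind.
  have := hr.abs_sub_le (Quotient.lift
    (fun p => if t e = t p.1 then (p.2 : ℝ) else -p.2) ?_) ?_
  · have h' : |(if t e = t e then ((1 : unitInterval) : ℝ) else -(1 : unitInterval))
      - if t e = t e' then ((1 : unitInterval) : ℝ) else -(1 : unitInterval)| ≤ r := this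
    rw [if_pos rfl, if_neg h] at h'
    norm_num at h'
    exact h'
  · rintro ⟨f, s⟩ ⟨f', s'⟩ ⟨h, h0, h1, h2⟩
    dsimp only at *
    subst h
    by_cases hs0 : s = 0
    · simp [hs0]
    · by_cases hs1 : s = 1
      · rw [h1 hs1]
      · rw [h2 hs0 hs1]
  · intro f s u
    change |(if t e = t f then (s : ℝ) else -s) - if t e = t f then (u : ℝ) else -u| ≤ _
    split_ifs
    · exact le_rfl
    · rw [← abs_neg]; apply le_of_eq; congr 1; ring

end TreeRealization

/-! ### The Bass–Serre tree is a tree -/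

section BassSerre

open Monoid Monoid.PushoutI Monoid.PushoutI.NormalWord Monoid.CoprodI

variable {M : Type*} [Group M] {G : ℕ → Subgroup M} {n : ℕ}

/-- The normal form of `g⁻¹` without its leading element of the amalgamated subgroup. It depends
only on the edge `g C`. -/
noncomputable def edgeWord
    (d : Transversal (ι := Bool) (G := fun _ => M) (fun _ => (G n).subtype)) (g : Amalgam G n) :
    Word (fun _ : Bool => M) :=
  letI := Classical.decEq M
  (g⁻¹ • (NormalWord.empty : NormalWord d)).toWord

/-- The word `edgeWord d g` without its first letter if this letter is in the `i`-th factor. It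
depends only on the vertex `g Mᵢ`. -/
noncomputable def vertexWord
    (d : Transversal (ι := Bool) (G := fun _ => M) (fun _ => (G n).subtype)) (i : Bool)
    (g : Amalgam G n) : Word (fun _ : Bool => M) :=
  letI := Classical.decEq M
  (NormalWord.equivPair i (g⁻¹ • (NormalWord.empty : NormalWord d))).tail

variable (d : Transversal (ι := Bool) (G := fun _ => M) (fun _ => (G n).subtype))

/-- Passing to inverses, the factor `m` acts on the left of the normal form and changes only its
`i`-component, which `tail` discards. -/
theorem vertexWord_mul (i : Bool) (g : Amalgam G n) (m : M) :
    vertexWord d i (g * PushoutI.of (ι := Bool) (G := fun _ => M) (φ := fun _ => (G n).subtype) i m)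
      = vertexWord d i g := by
  let := Classical.decEq M
  unfold vertexWord
  rw [mul_inv_rev, mul_smul, ← map_inv, summand_smul_def, Equiv.apply_symm_apply]

theorem vertexWord_eq_tail (i : Bool) (g : Amalgam G n) : letI := Classical.decEq M
    vertexWord d i g = (Word.equivPair i (edgeWord d g)).tail := by
  let := Classical.decEq M
  have : ∀ w : NormalWord d, (NormalWord.equivPair i w).tail
      = (Word.equivPair i w.toWord).tail := by
    intro w
    change (Word.equivPair i (CoprodI.of (M := fun _ : Bool => M) (i := i) ((G n).subtype w.head) • w.toWord)).tail = _
    rw [Word.equivPair_smul_same]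
  exact this _

theorem vertexWord_eq {i : Bool} {g : Amalgam G n} (h : (edgeWord d g).fstIdx ≠ some i) :
    vertexWord d i g = edgeWord d g := by
  let := Classical.decEq M
  rw [vertexWord_eq_tail, Word.equivPair_eq_of_fstIdx_ne h]

theorem length_vertexWord {i : Bool} {g : Amalgam G n} (h : (edgeWord d g).fstIdx = some i) :
    (edgeWord d g).toList.length = (vertexWord d i g).toList.length + 1 := by
  let := Classical.decEq M
  rw [vertexWord_eq_tail]
  have e := (Word.equivPair i).symm_apply_apply (edgeWord d g)
  rw [Word.equivPair_symm] at e
  set p := Word.equivPair i (edgeWord d g) with hp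
  by_cases h1 : p.head = 1
  · rw [Word.rcons, dif_pos h1] at e
    exact absurd (e ▸ h) p.fstIdx_ne
  · rw [Word.rcons, dif_neg h1] at e
    rw [← e]
    rfl

/-- An inverse is an amalgamated element times its word; with equal words the words cancel and only
amalgamated elements remain. -/
theorem edgeWord_eq {g g' : Amalgam G n} (h : edgeWord d g = edgeWord d g') :
    g⁻¹ * g' ∈ edgeGroup G n := by
  let := Classical.decEq M
  have key : ∀ k : Amalgam G n, k⁻¹ = PushoutI.base _
      (k⁻¹ • (NormalWord.empty : NormalWord d)).head * ofCoprodI (edgeWord d k).prod := by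
    intro k
    have := prod_smul k⁻¹ (NormalWord.empty : NormalWord d)
    rw [prod_empty, mul_one] at this
    exact this.symm
  have h1 : g⁻¹ * g' = g⁻¹ * (g'⁻¹)⁻¹ := by rw [inv_inv]
  rw [h1, key g, key g', h, mul_inv_rev, mul_assoc, mul_inv_cancel_left, ← map_inv, ← map_mul]
  exact ⟨_, Subtype.property _, of_apply_eq_base (ι := Bool) (G := fun _ => M)
    (fun _ => (G n).subtype) false _⟩

theorem subtype_injective' (G : ℕ → Subgroup M) (n : ℕ) :
    ∀ i : Bool, Function.Injective ((fun _ => (G n).subtype : Bool → _) i) :=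
  fun _ => (G n).subtype_injective

/-- A height function on the Bass–Serre tree. -/
noncomputable def bsHeight :
    TreeHeight (Subgroup.quotientMapOfLE (edgeGroup_le G n))
      (Subgroup.quotientMapOfLE (edgeGroup_le' G n)) where
  -- The heights model the graph distance to the base vertex `M`, even on `L ⧸ M` and odd on `L ⧸
  -- M'`. Rounding absorbs the last letter of the word of `g⁻¹`, which does not add to this distance
  -- if it lies in the factor `M`.
  hV := Quotient.lift (fun g => 2 * (((vertexWord d false g).toList.length + 1) / 2 : ℕ)) (by
    intro g g' h
    obtain ⟨m, hm⟩ := QuotientGroup.leftRel_apply.1 h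
    rw [eq_inv_mul_iff_mul_eq] at hm
    rw [← hm]
    exact congrArg (fun w : Word (fun _ : Bool => M) => (2 * ((w.toList.length + 1) / 2 : ℕ) : ℤ))
      (vertexWord_mul d false g m).symm)
  hW := Quotient.lift (fun g => 2 * ((vertexWord d true g).toList.length / 2 : ℕ) + 1) (by
    intro g g' h
    obtain ⟨m, hm⟩ := QuotientGroup.leftRel_apply.1 h
    rw [eq_inv_mul_iff_mul_eq] at hm
    rw [← hm]
    exact congrArg (fun w : Word (fun _ : Bool => M) => (2 * (w.toList.length / 2 : ℕ) + 1 : ℤ))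
      (vertexWord_mul d true g m).symm)
  diff e := by
    obtain ⟨g, rfl⟩ := QuotientGroup.mk_surjective e
    change (2 * ((vertexWord d true g).toList.length / 2 : ℕ) + 1 : ℤ)
        = 2 * (((vertexWord d false g).toList.length + 1) / 2 : ℕ) + 1 ∨
      (2 * (((vertexWord d false g).toList.length + 1) / 2 : ℕ) : ℤ)
        = 2 * ((vertexWord d true g).toList.length / 2 : ℕ) + 1 + 1
    by_cases h : (edgeWord d g).fstIdx = some true
    · have h1 := length_vertexWord d h
      rw [vertexWord_eq d (i := false) (by rw [h]; simp)]
      omega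
    · rw [vertexWord_eq d h]
      by_cases h' : (edgeWord d g).fstIdx = some false
      · have h1 := length_vertexWord d h'
        omega
      · rw [vertexWord_eq d h']
        have : (edgeWord d g).toList.length = 0 := by
          cases hl : (edgeWord d g).toList with
          | nil => rfl
          | cons p l =>
            exfalso
            have : (edgeWord d g).fstIdx = some p.1 := by simp [Word.fstIdx, hl]
            rcases hp : p.1 with _ | _ <;> rw [hp] at this <;> contradiction
        omega
  uniqV e e' := by
    obtain ⟨g, rfl⟩ := QuotientGroup.mk_surjective e
    obtain ⟨g', rfl⟩ := QuotientGroup.mk_surjective e'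
    intro ho
    obtain ⟨m, hm⟩ := QuotientGroup.eq.1 ho
    rw [eq_inv_mul_iff_mul_eq] at hm
    have hw : vertexWord d false g' = vertexWord d false g := by
      rw [← show _ = g' from hm]; exact vertexWord_mul d false g m
    -- If the vertex is the upper end of the edge then no letter was stripped from the edge word, so
    -- the vertex determines the edge.
    have key : ∀ k : Amalgam G n, (2 * (((vertexWord d false k).toList.length + 1) / 2 : ℕ) : ℤ)
        = 2 * ((vertexWord d true k).toList.length / 2 : ℕ) + 1 + 1 →
        vertexWord d false k = edgeWord d k := by
      intro k hk
      refine vertexWord_eq d fun h => ?_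
      have h1 := length_vertexWord d h
      rw [vertexWord_eq d (i := true) (by rw [h]; simp)] at hk
      omega
    intro h1 h2
    have e1 := key g h1
    have e2 := key g' h2
    exact QuotientGroup.eq.2 (edgeWord_eq d (by rw [← e1, ← e2, hw]))
  uniqW e e' := by
    obtain ⟨g, rfl⟩ := QuotientGroup.mk_surjective e
    obtain ⟨g', rfl⟩ := QuotientGroup.mk_surjective e'
    intro ho
    obtain ⟨m, hm⟩ := QuotientGroup.eq.1 ho
    rw [eq_inv_mul_iff_mul_eq] at hm
    have hw : vertexWord d true g' = vertexWord d true g := by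
      rw [← show _ = g' from hm]; exact vertexWord_mul d true g m
    have key : ∀ k : Amalgam G n, (2 * ((vertexWord d true k).toList.length / 2 : ℕ) + 1 : ℤ)
        = 2 * (((vertexWord d false k).toList.length + 1) / 2 : ℕ) + 1 →
        vertexWord d true k = edgeWord d k := by
      intro k hk
      refine vertexWord_eq d fun h => ?_
      have h1 := length_vertexWord d h
      rw [vertexWord_eq d (i := false) (by rw [h]; simp)] at hk
      omega
    intro h1 h2
    have e1 := key g h1
    have e2 := key g' h2
    exact QuotientGroup.eq.2 (edgeWord_eq d (by rw [← e1, ← e2, hw]))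

variable (G n)

theorem nonempty_bsHeight : Nonempty (TreeHeight (Subgroup.quotientMapOfLE (edgeGroup_le G n))
    (Subgroup.quotientMapOfLE (edgeGroup_le' G n))) :=
  (transversal_nonempty _ (subtype_injective' G n)).map fun d => bsHeight d

theorem inM_injective : Function.Injective (inM G n) :=
  of_injective (subtype_injective' G n) false

theorem inM'_injective : Function.Injective (inM' G n) :=
  of_injective (subtype_injective' G n) true

theorem range_inf_range : (inM G n).range ⊓ (inM' G n).range = edgeGroup G n := by
  have := inf_of_range_eq_base_range (subtype_injective' G n) (i := false) (j := true) (by simp)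
  refine le_antisymm ?_ (le_inf (edgeGroup_le G n) (edgeGroup_le' G n))
  intro x hx
  obtain ⟨g, rfl⟩ := (this.le hx)
  exact ⟨g, g.2, of_apply_eq_base (ι := Bool) (G := fun _ => M) (fun _ => (G n).subtype) false g⟩

variable {n}

theorem inM'_mem_range_inM {x : M} : inM' G n x ∈ (inM G n).range ↔ x ∈ G n := by
  constructor
  · intro h
    obtain ⟨y, hy, e⟩ := (range_inf_range G n).le ⟨h, ⟨x, rfl⟩⟩
    rw [inM_eq_inM' G n hy] at e
    rwa [← inM'_injective G n e]
  · intro h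
    rw [← inM_eq_inM' G n h]
    exact ⟨x, rfl⟩

theorem inM_mem_range_inM' {x : M} : inM G n x ∈ (inM' G n).range ↔ x ∈ G n := by
  constructor
  · intro h
    obtain ⟨y, hy, e⟩ := (range_inf_range G n).le ⟨⟨x, rfl⟩, h⟩
    rwa [← inM_injective G n e]
  · intro h
    rw [inM_eq_inM' G n h]
    exact ⟨x, rfl⟩

end BassSerre

/-! ### Metric properties of the Bass–Serre trees -/

section BSMetric

variable {M : Type*} [Group M] (G : ℕ → Subgroup M) (n : ℕ)

theorem BSTree.dist_def (x y : BSTree G n) : dist x y = 1 / 2 ^ n * simplicialDist _ _ x y := rfl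

theorem BSTree.connected (x y : BSTree G n) : ∃ r, HasPath _ _ x y r :=
  CosetGraph.connected _ _ (range_sup_range G n) x y

theorem BSTree.fourPoint : FourPoint (BSTree G n) := by
  obtain ⟨H⟩ := nonempty_bsHeight G n
  intro x y z w
  have h := H.simplicialDist_fourPoint (BSTree.connected G n) x y z w
  simp only [BSTree.dist_def, ← mul_add]
  rw [← mul_max_of_nonneg _ _ (by positivity)]
  exact mul_le_mul_of_nonneg_left h (by positivity)

variable {G n}

theorem BSTree.dist_pt (e : Amalgam G n ⧸ edgeGroup G n) (s u : unitInterval) :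
    dist (Realization.pt _ _ e s : BSTree G n) (Realization.pt _ _ e u)
      = 1 / 2 ^ n * |(s : ℝ) - u| := by
  obtain ⟨H⟩ := nonempty_bsHeight G n
  rw [BSTree.dist_def, H.simplicialDist_pt (BSTree.connected G n)]

theorem BSTree.isometry_smul (g : Amalgam G n) : Isometry fun x : BSTree G n => g • x := by
  refine Isometry.of_dist_eq fun x y => ?_
  simp only [BSTree.dist_def]
  congr 1
  have key : ∀ (g : Amalgam G n) (x y : BSTree G n), simplicialDist _ _ (g • x) (g • y)
      ≤ simplicialDist _ _ x y := fun g x y =>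
    le_csInf (BSTree.connected G n x y) fun r hr =>
      (CosetGraph.hasPath_smul _ _ g hr).simplicialDist_le
  refine le_antisymm (key g x y) ?_
  simpa using key g⁻¹ (g • x) (g • y)

theorem BSTree.dist_smul (g : Amalgam G n) (x y : BSTree G n) : dist (g • x) (g • y) = dist x y :=
  (BSTree.isometry_smul g).dist_eq x y

/-- The points `x` and `y` lie on a common edge. -/
def OnEdge (x y : BSTree G n) : Prop :=
  ∃ e s u, x = Realization.pt _ _ e s ∧ y = Realization.pt _ _ e u

theorem isPiece_onEdge : IsPiece (OnEdge (G := G) (n := n)) := by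
  have hpos : (0 : ℝ) < 1 / 2 ^ n := by positivity
  have hseg : ∀ (e : Amalgam G n ⧸ edgeGroup G n) (s u : unitInterval), s ≤ u →
      ∃ A, IsSegment A (Realization.pt _ _ e s : BSTree G n) (Realization.pt _ _ e u) := by
    intro e s u hsu
    have hsu' : (s : ℝ) ≤ u := hsu
    have hs := s.2.1
    have hu := u.2.2
    have h2 : (0 : ℝ) < 2 ^ n := by positivity
    refine ⟨_, fun r => Realization.pt _ _ e (Set.projIcc 0 1 zero_le_one (s + 2 ^ n * r)),
      1 / 2 ^ n * (u - s), ⟨by nlinarith, ?_⟩, ?_, ?_, rfl⟩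
    · have hmem : ∀ r ∈ Set.Icc (0 : ℝ) (1 / 2 ^ n * (u - s)),
          (s : ℝ) + 2 ^ n * r ∈ Set.Icc (0 : ℝ) 1 := by
        rintro r ⟨h0, h1⟩
        have : 2 ^ n * r ≤ 2 ^ n * (1 / 2 ^ n * ((u : ℝ) - s)) :=
          mul_le_mul_of_nonneg_left h1 h2.le
        rw [← mul_assoc, mul_one_div_cancel h2.ne', one_mul] at this
        exact ⟨by positivity, by linarith⟩
      intro r hr r' hr'
      rw [BSTree.dist_pt, Set.projIcc_of_mem _ (hmem r hr), Set.projIcc_of_mem _ (hmem r' hr')]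
      simp only [add_sub_add_left_eq_sub]
      rw [← mul_sub, abs_mul, abs_of_pos h2, ← mul_assoc, one_div_mul_cancel h2.ne', one_mul]
    · simp
    · have : (s : ℝ) + 2 ^ n * (1 / 2 ^ n * (u - s)) = u := by field_simp; ring
      beta_reduce
      rw [this, Set.projIcc_val]
  refine ⟨?_, ?_, ?_⟩
  · rintro x y ⟨e, s, u, rfl, rfl⟩
    exact ⟨e, u, s, rfl, rfl⟩
  · rintro x c y ⟨e, s, u, rfl, rfl⟩ hc
    have hd : dist (Realization.pt _ _ e s : BSTree G n) c ≤ 1 / 2 ^ n * |(s : ℝ) - u| := by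
      rw [← BSTree.dist_pt e s u]
      have h : dist (Realization.pt _ _ e s : BSTree G n) c + dist c _ = dist _ _ := hc
      have := dist_nonneg (x := c) (y := (Realization.pt _ _ e u : BSTree G n))
      linarith
    set r := 2 ^ n * dist (Realization.pt _ _ e s : BSTree G n) c with hr
    have hr0 : 0 ≤ r := by positivity
    have hrd : 1 / 2 ^ n * r = dist (Realization.pt _ _ e s : BSTree G n) c := by
      rw [hr]; field_simp
    have hr1 : r ≤ |(s : ℝ) - u| := by
      rw [← hrd] at hd
      exact le_of_mul_le_mul_left hd hpos
    have s0 := s.2.1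
    have s1 := s.2.2
    have u0 := u.2.1
    have u1 := u.2.2
    -- The point of the edge at the same distance from `s` as `c`; by uniqueness of points on a
    -- segment it equals `c`.
    obtain ⟨v, hv1, hv2⟩ : ∃ v : unitInterval, |(s : ℝ) - v| = r ∧
        |(v : ℝ) - u| = |(s : ℝ) - u| - r := by
      rcases le_total (s : ℝ) u with h | h
      · rw [abs_of_nonpos (by linarith)] at hr1
        refine ⟨⟨s + r, by linarith, by linarith⟩, ?_, ?_⟩
        · simp [abs_of_nonneg hr0]
        · rw [abs_of_nonpos (by simp; linarith), abs_of_nonpos (by linarith)]; simp; ring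
      · rw [abs_of_nonneg (by linarith)] at hr1
        refine ⟨⟨s - r, by linarith, by linarith⟩, ?_, ?_⟩
        · simp [abs_of_nonneg hr0]
        · rw [abs_of_nonneg (by simp; linarith), abs_of_nonneg (by linarith)]; simp; ring
    refine ⟨e, s, v, rfl, (BSTree.fourPoint G n).eq_of_btw hc ?_ ?_⟩
    · unfold Btw
      rw [BSTree.dist_pt, BSTree.dist_pt, BSTree.dist_pt, hv1, hv2]; ring
    · rw [BSTree.dist_pt, hv1, hrd]
  · rintro x y ⟨e, s, u, rfl, rfl⟩
    rcases le_total s u with h | h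
    · exact hseg e s u h
    · obtain ⟨A, hA⟩ := hseg e u s h
      exact hA.symm

theorem BSTree.chain (x y : BSTree G n) : Chain OnEdge x y := by
  obtain ⟨r, h⟩ := BSTree.connected G n x y
  induction h with
  | nil x => exact .nil x
  | cons e s u y r _ ih =>
    exact Chain.trans_piece (BSTree.fourPoint G n) isPiece_onEdge ⟨e, s, u, rfl, rfl⟩ ih

theorem BSTree.isRTree : IsRTree (BSTree G n) :=
  (BSTree.fourPoint G n).isRTree fun x y => (BSTree.chain x y).segment isPiece_onEdge

variable (G n)

/-- The vertex `g M`. -/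
noncomputable def vA (g : Amalgam G n) : BSTree G n := Realization.pt _ _ (g : Amalgam G n ⧸ _) 0

/-- The vertex `g M'`, where `M'` is the second copy of `M`. -/
noncomputable def vB (g : Amalgam G n) : BSTree G n := Realization.pt _ _ (g : Amalgam G n ⧸ _) 1

variable {G n}

theorem smul_vA (g h : Amalgam G n) : g • vA G n h = vA G n (g * h) := rfl

theorem smul_vB (g h : Amalgam G n) : g • vB G n h = vB G n (g * h) := rfl

theorem vA_eq_iff {g g' : Amalgam G n} : vA G n g = vA G n g' ↔ g⁻¹ * g' ∈ (inM G n).range := by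
  constructor
  · intro h
    exact QuotientGroup.eq.1 ((Quotient.exact h).2.1 rfl)
  · intro h
    exact Quotient.sound ⟨rfl, fun _ => QuotientGroup.eq.2 h, fun h => absurd h (by simp),
      fun h => absurd rfl h⟩

theorem vB_eq_iff {g g' : Amalgam G n} : vB G n g = vB G n g' ↔ g⁻¹ * g' ∈ (inM' G n).range := by
  constructor
  · intro h
    exact QuotientGroup.eq.1 ((Quotient.exact h).2.2.1 rfl)
  · intro h
    exact Quotient.sound ⟨rfl, fun h => absurd h (by simp), fun _ => QuotientGroup.eq.2 h,
      fun _ h => absurd rfl h⟩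

theorem vA_mul_inM (g : Amalgam G n) (m : M) : vA G n (g * inM G n m) = vA G n g :=
  (vA_eq_iff.2 ⟨m, by simp⟩).symm

theorem vB_mul_inM' (g : Amalgam G n) (m : M) : vB G n (g * inM' G n m) = vB G n g :=
  (vB_eq_iff.2 ⟨m, by simp⟩).symm

theorem dist_vA_vB (g : Amalgam G n) : dist (vA G n g) (vB G n g) = 1 / 2 ^ n := by
  rw [vA, vB, BSTree.dist_pt]; simp

theorem vA_ne_vB (g : Amalgam G n) : vA G n g ≠ vB G n g := by
  rw [← dist_pos, dist_vA_vB]; positivity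

/-- Because `x` is not amalgamated, the two outer vertices differ, so they are at least two edges
apart and the path through the middle vertex does not backtrack. -/
theorem btw_vA_vB_vA (g : Amalgam G n) {x : M} (hx : x ∉ G n) :
    Btw (vA G n g) (vB G n g) (vA G n (g * inM' G n x)) := by
  have h1 := dist_vA_vB g
  have h2 := dist_vA_vB (g * inM' G n x)
  rw [vB_mul_inM', dist_comm] at h2
  have h3 : 2 * (1 / 2 ^ n : ℝ) ≤ dist (vA G n g) (vA G n (g * inM' G n x)) := by
    rw [BSTree.dist_def, mul_comm]
    refine mul_le_mul_of_nonneg_left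
      (two_le_simplicialDist_zero (BSTree.connected G n) fun h => ?_) (by positivity)
    have : g⁻¹ * (g * inM' G n x) ∈ (inM G n).range := QuotientGroup.eq.1 h
    rw [inv_mul_cancel_left, inM'_mem_range_inM] at this
    exact hx this
  have := dist_triangle (vA G n g) (vB G n g) (vA G n (g * inM' G n x))
  unfold Btw
  linarith

theorem btw_vB_vA_vB (g : Amalgam G n) {x : M} (hx : x ∉ G n) :
    Btw (vB G n g) (vA G n g) (vB G n (g * inM G n x)) := by
  have h1 := dist_vA_vB g
  have h2 := dist_vA_vB (g * inM G n x)
  rw [dist_comm] at h1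
  rw [vA_mul_inM] at h2
  have h3 : 2 * (1 / 2 ^ n : ℝ) ≤ dist (vB G n g) (vB G n (g * inM G n x)) := by
    rw [BSTree.dist_def, mul_comm]
    refine mul_le_mul_of_nonneg_left
      (two_le_simplicialDist_one (BSTree.connected G n) fun h => ?_) (by positivity)
    have : g⁻¹ * (g * inM G n x) ∈ (inM' G n).range := QuotientGroup.eq.1 h
    rw [inv_mul_cancel_left, inM_mem_range_inM'] at this
    exact hx this
  have := dist_triangle (vB G n g) (vA G n g) (vB G n (g * inM G n x))
  unfold Btw
  linarith

theorem Btw.smul {x y z : BSTree G n} (h : Btw x y z) (g : Amalgam G n) :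
    Btw (g • x) (g • y) (g • z) := by
  unfold Btw at *
  rwa [BSTree.dist_smul, BSTree.dist_smul, BSTree.dist_smul]

/-! ### Words -/

variable (G n) in
/-- The product of the elements `y * β(x)` for the pairs `(y, x)` in a list. -/
noncomputable def wordProd (l : List (M × M)) : Amalgam G n :=
  (l.map fun p => inM G n p.1 * inM' G n p.2).prod

theorem wordProd_cons (p : M × M) (l : List (M × M)) :
    wordProd G n (p :: l) = inM G n p.1 * inM' G n p.2 * wordProd G n l := by
  simp [wordProd]

theorem wordProd_append (l l' : List (M × M)) :
    wordProd G n (l ++ l') = wordProd G n l * wordProd G n l' := by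
  simp [wordProd]

/-- The word traces an edge path without backtracking, and `FourPoint.btw_trans` turns this local
condition into a global one. The first conjunct records the initial edge, as needed to attach the
next one. The first `M`-letter is unrestricted because it fixes the base vertex. -/
theorem btw_and_dist_wordProd (l : List (M × M)) (hl₁ : ∀ p ∈ l.tail, p.1 ∉ G n)
    (hl₂ : ∀ p ∈ l, p.2 ∉ G n) :
    (∀ p l', l = p :: l' → Btw (vA G n 1) (vB G n (inM G n p.1)) (vA G n (wordProd G n l))) ∧
      dist (vA G n 1) (vA G n (wordProd G n l)) = 2 * l.length / 2 ^ n := by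
  induction l with
  | nil => simp [wordProd]
  | cons p l ih =>
    obtain ⟨ih1, ih2⟩ := ih (fun q hq => hl₁ q (List.mem_of_mem_tail hq))
      fun q hq => hl₂ q (List.mem_cons_of_mem _ hq)
    obtain ⟨y, x⟩ := p
    have hx : x ∉ G n := hl₂ _ List.mem_cons_self
    set g := inM G n y * inM' G n x with hg
    have e1 : vA G n 1 = vA G n (inM G n y) := by
      rw [← vA_mul_inM 1 y, one_mul]
    have e2 : vB G n (inM G n y) = vB G n g := (vB_mul_inM' _ _).symm
    have hloc : Btw (vA G n 1) (vB G n (inM G n y)) (vA G n g) := by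
      rw [e1]; exact btw_vA_vB_vA (inM G n y) hx
    have hnext : Btw (vB G n (inM G n y)) (vA G n g) (vA G n (g * wordProd G n l)) := by
      cases l with
      | nil => simpa [wordProd] using btw_right _ _
      | cons q l' =>
        have h1 := (ih1 q l' rfl).smul g
        rw [smul_vA, smul_vA, smul_vB, mul_one] at h1
        have h2 : Btw (vB G n g) (vA G n g) (vB G n (g * inM G n q.1)) :=
          btw_vB_vA_vB g (hl₁ q (by simp))
        -- The two geodesics overlap in a whole edge, so the concatenation lemma applies.
        have h3 : vA G n g ≠ vB G n (g * inM G n q.1) := by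
          rw [← vA_mul_inM g q.1]; exact vA_ne_vB _
        rw [e2]
        exact ((BSTree.fourPoint G n).btw_trans h2 h1 h3).trans_left h2
    have hmain : Btw (vA G n 1) (vA G n g) (vA G n (g * wordProd G n l)) :=
      (BSTree.fourPoint G n).btw_trans hloc hnext (by rw [e2]; exact (vA_ne_vB g).symm)
    rw [wordProd_cons]
    refine ⟨?_, ?_⟩
    · rintro p l' ⟨⟩
      exact hmain.trans_left hloc
    · have d1 : dist (vA G n g) (vA G n (g * wordProd G n l)) = 2 * l.length / 2 ^ n := by
        rw [← ih2, ← BSTree.dist_smul g (vA G n 1), smul_vA, smul_vA, mul_one]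
      have d2 : dist (vA G n 1) (vB G n (inM G n y)) = 1 / 2 ^ n := by
        rw [e1]; exact dist_vA_vB _
      have d3 : dist (vB G n (inM G n y)) (vA G n g) = 1 / 2 ^ n := by
        rw [e2, dist_comm]; exact dist_vA_vB _
      have h1 : dist _ _ + dist _ _ = dist _ _ := hloc
      have h2 : dist _ _ + dist _ _ = dist _ _ := hmain
      rw [← h2, ← h1, d1, d2, d3]
      simp only [List.length_cons]
      push_cast
      ring

theorem dist_wordProd {l : List (M × M)} (hl₁ : ∀ p ∈ l.tail, p.1 ∉ G n)
    (hl₂ : ∀ p ∈ l, p.2 ∉ G n) :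
    dist (vA G n 1) (vA G n (wordProd G n l)) = 2 * l.length / 2 ^ n :=
  (btw_and_dist_wordProd l hl₁ hl₂).2

theorem exists_wordProd (g : Amalgam G n) :
    ∃ (l : List (M × M)) (m : M), g = wordProd G n l * inM G n m := by
  induction g using Monoid.PushoutI.induction_on with
  | of i g =>
    cases i
    · exact ⟨[], g, by simp [wordProd]; rfl⟩
    · exact ⟨[(1, g)], 1, by simp [wordProd]; rfl⟩
  | base g =>
    refine ⟨[], g, ?_⟩
    simp only [wordProd, List.map_nil, List.prod_nil, one_mul]
    exact (Monoid.PushoutI.of_apply_eq_base (G := fun _ => M) (fun _ : Bool => (G n).subtype)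
      false g).symm
  | mul x y hx hy =>
    obtain ⟨l, m, rfl⟩ := hx
    obtain ⟨l', m', rfl⟩ := hy
    cases l' with
    | nil => exact ⟨l, m * m', by simp [wordProd, mul_assoc]⟩
    | cons p l' =>
      refine ⟨l ++ (m * p.1, p.2) :: l', m', ?_⟩
      simp only [wordProd_append, wordProd_cons, map_mul, mul_assoc]

end BSMetric

/-! ### Sequences of spaces -/

section Seq

theorem seqMap_succ_left {X : ℕ → Type*} (f : ∀ n, X n → X (n + 1)) {l j : ℕ} (h : l + 1 ≤ j)
    (x : X l) : seqMap f h (f l x) = seqMap f ((Nat.le_succ l).trans h) x :=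
  Nat.leRecOn_succ_left x ((Nat.le_succ l).trans h) h

theorem seqMap_trans {X : ℕ → Type*} (f : ∀ n, X n → X (n + 1)) {l k j : ℕ} (h : l ≤ k)
    (h' : k ≤ j) (x : X l) : seqMap f h' (seqMap f h x) = seqMap f (h.trans h') x :=
  (Nat.leRecOn_trans h h' x).symm

theorem seqMap_surjective {X : ℕ → Type*} {f : ∀ n, X n → X (n + 1)}
    (hs : ∀ n, Function.Surjective (f n)) {l j : ℕ} (h : l ≤ j) :
    Function.Surjective (seqMap f h) := by
  induction j, h using Nat.le_induction with
  | base => exact fun x => ⟨x, seqMap_self f x⟩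
  | succ j h ih =>
    intro x
    obtain ⟨y, rfl⟩ := hs j x
    obtain ⟨z, rfl⟩ := ih y
    exact ⟨z, seqMap_succ f h z⟩

variable {X : ℕ → Type*} [∀ n, MetricSpace (X n)] (f : ∀ n, X n → X (n + 1))

/-- All maps of the sequence preserve the distance of the images of `x` and `y`. -/
def PermIso {l : ℕ} (x y : X l) : Prop :=
  ∀ (j : ℕ) (h : l ≤ j), dist (seqMap f h x) (seqMap f h y) = dist x y

/-- From the index `k` on, the distance of the images of `x` and `y` is constant. -/
def StableFrom {l : ℕ} (k : ℕ) (x y : X l) : Prop :=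
  ∃ hk : l ≤ k, ∀ (j : ℕ) (h : k ≤ j), dist (seqMap f (hk.trans h) x) (seqMap f (hk.trans h) y)
    = dist (seqMap f hk x) (seqMap f hk y)

/-- The distance of the images of `x` and `y` is eventually constant. -/
def EvStable {l : ℕ} (x y : X l) : Prop := ∃ k, StableFrom f k x y

variable {f}

theorem PermIso.symm {l : ℕ} {x y : X l} (h : PermIso f x y) : PermIso f y x := by
  intro j hj
  rw [dist_comm, h j hj, dist_comm]

theorem PermIso.evStable {l : ℕ} {x y : X l} (h : PermIso f x y) : EvStable f x y :=
  ⟨l, le_rfl, fun j hj => by rw [h j _, h l _]⟩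

theorem StableFrom.symm {l k : ℕ} {x y : X l} (h : StableFrom f k x y) : StableFrom f k y x := by
  obtain ⟨hk, h⟩ := h
  refine ⟨hk, fun j hj => ?_⟩
  rw [dist_comm, h j hj, dist_comm]

theorem StableFrom.mono {l k k' : ℕ} {x y : X l} (h : StableFrom f k x y) (hk' : k ≤ k') :
    StableFrom f k' x y := by
  obtain ⟨hk, h⟩ := h
  refine ⟨hk.trans hk', fun j hj => ?_⟩
  rw [h j (hk'.trans hj), h k' hk']

theorem EvStable.symm {l : ℕ} {x y : X l} (h : EvStable f x y) : EvStable f y x :=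
  h.imp fun _ h => h.symm

theorem EvStable.of_seqMap {l m : ℕ} (hm : l ≤ m) {x y : X l}
    (h : EvStable f (seqMap f hm x) (seqMap f hm y)) : EvStable f x y := by
  obtain ⟨k, hk, h⟩ := h
  refine ⟨k, hm.trans hk, fun j hj => ?_⟩
  have := h j hj
  simpa only [seqMap_trans] using this

theorem EvStable.of_map {l : ℕ} {x y : X l} (h : EvStable f (f l x) (f l y)) : EvStable f x y := by
  refine EvStable.of_seqMap (Nat.le_succ l) ?_
  have e : ∀ z : X l, seqMap f (Nat.le_succ l) z = f l z := fun z => by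
    rw [← seqMap_succ_left f le_rfl, seqMap_self]
  rwa [e, e]

theorem PermIso.of_map {l : ℕ} {x y : X l} (h : PermIso f (f l x) (f l y))
    (h' : dist (f l x) (f l y) = dist x y) : PermIso f x y := by
  intro j hj
  rcases hj.eq_or_lt with rfl | hj
  · simp only [seqMap_self]
  · rw [← seqMap_succ_left f hj, ← seqMap_succ_left f hj, h j hj, h']

theorem lipschitz_seqMap (hf : ∀ n, LipschitzWith 1 (f n)) {l j : ℕ} (h : l ≤ j) (x y : X l) :
    dist (seqMap f h x) (seqMap f h y) ≤ dist x y := by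
  induction j, h using Nat.le_induction with
  | base => simp only [seqMap_self, le_refl]
  | succ j h ih =>
    rw [seqMap_succ f h, seqMap_succ f h]
    have := (hf j).dist_le_mul (seqMap f h x) (seqMap f h y)
    rw [NNReal.coe_one, one_mul] at this
    exact this.trans ih

/-- Neither part of the segment can grow under the maps, while their sum must stay at least the
preserved distance `dist x z`; so neither can shrink. -/
theorem PermIso.btw (hf : ∀ n, LipschitzWith 1 (f n)) {l : ℕ} {x y z : X l} (h : PermIso f x z)
    (hb : Btw x y z) : PermIso f x y ∧ PermIso f y z ∧
      ∀ (j : ℕ) (hj : l ≤ j), Btw (seqMap f hj x) (seqMap f hj y) (seqMap f hj z) := by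
  have key : ∀ (j : ℕ) (hj : l ≤ j), dist (seqMap f hj x) (seqMap f hj y) = dist x y ∧
      dist (seqMap f hj y) (seqMap f hj z) = dist y z := by
    intro j hj
    have h1 := lipschitz_seqMap hf hj x y
    have h2 := lipschitz_seqMap hf hj y z
    have h3 := dist_triangle (seqMap f hj x) (seqMap f hj y) (seqMap f hj z)
    have h4 : dist x y + dist y z = dist x z := hb
    rw [h j hj] at h3
    constructor <;> linarith
  refine ⟨fun j hj => (key j hj).1, fun j hj => (key j hj).2, fun j hj => ?_⟩
  unfold Btw
  rw [(key j hj).1, (key j hj).2, h j hj]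
  exact hb

/-- The formula `FourPoint.dist_eq_max` reduces stability at interior points of a permanently
embedded segment to stability at its endpoints. -/
theorem StableFrom.btw (hX : ∀ n, FourPoint (X n)) (hf : ∀ n, LipschitzWith 1 (f n)) {l k : ℕ}
    {v t v' : X l} (s : X l) (h : PermIso f v v') (hb : Btw v t v') (h1 : StableFrom f k s v)
    (h2 : StableFrom f k s v') : StableFrom f k s t := by
  obtain ⟨hk, h1⟩ := h1
  obtain ⟨_, h2⟩ := h2
  obtain ⟨p1, p2, p3⟩ := h.btw hf hb
  refine ⟨hk, fun j hj => ?_⟩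
  rw [(hX j).dist_eq_max _ (p3 j (hk.trans hj)), (hX k).dist_eq_max _ (p3 k hk), h1 j hj, h2 j hj,
    p1 j _, p2 j _, p1 k _, p2 k _]

theorem EvStable.btw (hX : ∀ n, FourPoint (X n)) (hf : ∀ n, LipschitzWith 1 (f n)) {l : ℕ}
    {v t v' : X l} (s : X l) (h : PermIso f v v') (hb : Btw v t v') (h1 : EvStable f s v)
    (h2 : EvStable f s v') : EvStable f s t := by
  obtain ⟨k, h1⟩ := h1
  obtain ⟨k', h2⟩ := h2
  exact ⟨max k k', StableFrom.btw hX hf s h hb (h1.mono (le_max_left _ _))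
    (h2.mono (le_max_right _ _))⟩

theorem exists_stableFrom_list {l : ℕ} (h : ∀ x y : X l, EvStable f x y)
    (F : List (X l × X l)) : ∃ k, ∀ p ∈ F, StableFrom f k p.1 p.2 := by
  induction F with
  | nil => exact ⟨0, by simp⟩
  | cons p F ih =>
    obtain ⟨k, hk⟩ := ih
    obtain ⟨k', hk'⟩ := h p.1 p.2
    refine ⟨max k k', ?_⟩
    rintro q (_ | ⟨_, hq⟩)
    · exact hk'.mono (le_max_right _ _)
    · exact (hk q hq).mono (le_max_left _ _)

/-- A sequence of trees converges strongly if the distances of the images of any two points are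
eventually constant and segments are composed of pieces that are embedded isometrically. -/
theorem convergesStrongly_of_evStable (hX : ∀ n, FourPoint (X n))
    (hf : ∀ n, LipschitzWith 1 (f n)) (hs : ∀ (l : ℕ) (x y : X l), EvStable f x y)
    (hc : ∀ (l : ℕ) (x y : X l), Chain (PermIso f) x y) : ConvergesStrongly f := by
  intro l x y
  obtain ⟨F, hF, hcov⟩ := (hc l x y).exists_finite_cover (hX l)
  -- The degenerate pair covers the endpoint `y`, in particular when the chain is empty.
  let F' : List (X l × X l) := (y, y) :: F
  have hF' : ∀ p ∈ F', PermIso f p.1 p.2 := by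
    intro p hp
    rcases List.mem_cons.1 hp with rfl | hp
    · intro j hj; simp
    · exact hF p hp
  have hcov' : ∀ w, Btw x w y → ∃ p ∈ F', Btw p.1 w p.2 := by
    intro w hw
    rcases hcov w hw with rfl | ⟨p, hp, h⟩
    · exact ⟨(w, w), by simp [F'], btw_left _ _⟩
    · exact ⟨p, by simp [F', hp], h⟩
  let P : List (X l) := F'.map Prod.fst ++ F'.map Prod.snd
  have hP : ∀ p ∈ F', p.1 ∈ P ∧ p.2 ∈ P := fun p hp =>
    ⟨List.mem_append_left _ (List.mem_map_of_mem hp),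
      List.mem_append_right _ (List.mem_map_of_mem hp)⟩
  -- One index stabilizes all distances between the finitely many endpoints of pieces; it then works
  -- for every pair of points of the segment, the two points being treated one after the other.
  obtain ⟨k, hk⟩ := exists_stableFrom_list (hs l) (P ×ˢ P)
  have hk' : ∀ u ∈ P, ∀ v ∈ P, StableFrom f k u v := fun u hu v hv =>
    hk (u, v) (List.mem_product.2 ⟨hu, hv⟩)
  have hy : y ∈ P := (hP (y, y) (by simp [F'])).1
  refine ⟨k, (hk' y hy y hy).1, fun A hA s hsA t htA j hj => ?_⟩
  rw [(hX l).isSegment_eq hA] at hsA htA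
  obtain ⟨p, hp, hsp⟩ := hcov' s hsA
  obtain ⟨q, hq, htq⟩ := hcov' t htA
  have key : ∀ u ∈ P, StableFrom f k u s := fun u hu =>
    StableFrom.btw hX hf u (hF' p hp) hsp (hk' u hu _ (hP p hp).1) (hk' u hu _ (hP p hp).2)
  obtain ⟨_, h⟩ := StableFrom.btw hX hf s (hF' q hq) htq (key _ (hP q hq).1).symm
    (key _ (hP q hq).2).symm
  exact h j hj

/-! ### The limit space -/

theorem dist_toLimit (hf : ∀ n, LipschitzWith 1 (f n)) (x y : X 0) :
    dist (toLimit f hf x) (toLimit f hf y) = limDist f x y := rfl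

theorem toLimit_surjective (hf : ∀ n, LipschitzWith 1 (f n)) :
    Function.Surjective (toLimit f hf) :=
  SeparationQuotient.surjective_mk (X := LimitPre f hf)

theorem fourPoint_limit (hX : ∀ n, FourPoint (X n)) (hf : ∀ n, LipschitzWith 1 (f n)) :
    FourPoint (LimitSpace f hf) := by
  intro x y z w
  obtain ⟨x, rfl⟩ := toLimit_surjective hf x
  obtain ⟨y, rfl⟩ := toLimit_surjective hf y
  obtain ⟨z, rfl⟩ := toLimit_surjective hf z
  obtain ⟨w, rfl⟩ := toLimit_surjective hf w
  simp only [dist_toLimit]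
  exact le_of_tendsto_of_tendsto' ((tendsto_limDist f hf x y).add (tendsto_limDist f hf z w))
    (((tendsto_limDist f hf x z).add (tendsto_limDist f hf y w)).max
      ((tendsto_limDist f hf x w).add (tendsto_limDist f hf y z)))
    fun n => hX n _ _ _ _

theorem StableFrom.dist_toLimit (hf : ∀ n, LipschitzWith 1 (f n)) {x y : X 0} {k : ℕ}
    (h : StableFrom f k x y) : dist (toLimit f hf x) (toLimit f hf y)
      = dist (seqMap f (Nat.zero_le k) x) (seqMap f (Nat.zero_le k) y) := by
  refine tendsto_nhds_unique (tendsto_limDist f hf x y) ?_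
  obtain ⟨_, h⟩ := h
  exact tendsto_atTop_of_eventually_const (i₀ := k) fun j hj => h j hj

/-- If the distance of `x` and `y` is stable from the index `k` on, then the segment between their
images at this index embeds isometrically into the limit. -/
theorem StableFrom.exists_segment (hf : ∀ n, LipschitzWith 1 (f n))
    (hs : ∀ n, Function.Surjective (f n)) {x y : X 0} {k : ℕ} (h : StableFrom f k x y)
    (hg : ∃ A, IsSegment A (seqMap f (Nat.zero_le k) x) (seqMap f (Nat.zero_le k) y)) :
    ∃ A, IsSegment A (toLimit f hf x) (toLimit f hf y) := by
  obtain ⟨_, γ, ℓ, hγ, h0, h1, -⟩ := hg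
  obtain ⟨hk, h⟩ := h
  have hperm : PermIso f (γ 0) (γ ℓ) := by
    intro j hj
    rw [h0, h1, seqMap_trans, seqMap_trans]
    exact h j hj
  have hperm' : ∀ s ∈ Set.Icc 0 ℓ, ∀ t ∈ Set.Icc 0 ℓ, s ≤ t → PermIso f (γ s) (γ t) := by
    intro s hs t ht hst
    refine ((hperm.btw hf (hγ.btw ht)).1.btw hf ?_).2.1
    exact (hγ.mono ht.1 ht.2).btw ⟨hs.1, hst⟩
  -- A pointwise lift of the geodesic to the first space; no continuity is needed. The ends are
  -- prescribed so that the image runs from the class of `x` to that of `y`.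
  let δ : ℝ → X 0 := fun t =>
    if t = 0 then x else if t = ℓ then y else Function.surjInv (seqMap_surjective hs hk) (γ t)
  have hδ : ∀ t, seqMap f hk (δ t) = γ t := by
    intro t
    simp only [δ]
    split_ifs with a b
    · rw [a, h0]
    · rw [b, h1]
    · exact Function.surjInv_eq _ _
  have hdist : ∀ s ∈ Set.Icc 0 ℓ, ∀ t ∈ Set.Icc 0 ℓ, s ≤ t →
      dist (toLimit f hf (δ s)) (toLimit f hf (δ t)) = |s - t| := by
    intro s hs' t ht hst
    have : StableFrom f k (δ s) (δ t) := by
      refine ⟨hk, fun j hj => ?_⟩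
      rw [← seqMap_trans f hk hj, ← seqMap_trans f hk hj, hδ, hδ, hperm' s hs' t ht hst j hj]
    rw [this.dist_toLimit hf, hδ, hδ, hγ.2 s hs' t ht]
  have hlim : toLimit f hf (δ ℓ) = toLimit f hf y := by
    simp only [δ]
    split_ifs with a
    · have : dist (toLimit f hf x) (toLimit f hf y) = 0 := by
        rw [StableFrom.dist_toLimit hf ⟨hk, h⟩, dist_eq_zero]
        exact h0.symm.trans ((congrArg γ a.symm).trans h1)
      exact dist_eq_zero.1 this
    · rfl
  refine ⟨_, fun t => toLimit f hf (δ t), ℓ, ⟨hγ.1, fun s hs' t ht => ?_⟩, by simp [δ], hlim, rfl⟩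
  rcases le_total s t with hst | hst
  · exact hdist s hs' t ht hst
  · rw [dist_comm, hdist t ht s hs' hst, abs_sub_comm]

end Seq

/-! ### Bad letters and the effect of the folding maps on words. -/

section Fold

variable {M : Type*} [Group M] {G : ℕ → Subgroup M} {a : ℕ → M}

/-! ### Consequences of the conditions -/

/-- The element `m` lies in the union of the subgroups `G k`. -/
def Bad (G : ℕ → Subgroup M) (m : M) : Prop := ∃ k, m ∈ G k

theorem ne_top_of_strictMono (hG : StrictMono G) (k : ℕ) : G k ≠ ⊤ := fun h =>
  absurd (hG (Nat.lt_succ_self k)) (by rw [h]; exact not_top_lt)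

/-- Otherwise one `G k` would contain both generating subgroups in (P2) and be all of `M`. -/
theorem not_bad_of_condP2 (hG : StrictMono G) (h2 : CondP2 G a) (i : ℕ) : ¬ Bad G (a (i + 1)) := by
  rintro ⟨k, hk⟩
  refine ne_top_of_strictMono hG (max k (i + 1)) (top_le_iff.1 ?_)
  rw [← h2 i]
  have hi : G (i + 1) ≤ G (max k (i + 1)) := hG.monotone (le_max_right _ _)
  have ha : a (i + 1) ∈ G (max k (i + 1)) := hG.monotone (le_max_left _ _) hk
  refine sup_le hi ?_
  rintro _ ⟨g, hg, rfl⟩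
  exact mul_mem (mul_mem ha (hi hg)) (inv_mem ha)

theorem bad_inv {m : M} : Bad G m⁻¹ ↔ Bad G m := by simp [Bad]

/-- If the conjugate of `c` lay in some `G k`, the subgroup in (P4) would lie in a member of the
chain. Only the trivial conjugator in (P4) is used. -/
theorem not_bad_of_condP4 (hG : Monotone G) (h4 : CondP4 G a) {i : ℕ} {c : M}
    (hc : c ∈ G (i + 1)) (hc' : c ∉ G i) :
    ¬ Bad G (a (i + 1) * c * (a (i + 1))⁻¹) ∧ ¬ Bad G ((a (i + 1))⁻¹ * c * a (i + 1)) := by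
  have key : ∀ x : M, Bad G x →
      ∃ n, G (i + 1) ⊔ conjSubgroup x (G (i + 1)) ≤ conjSubgroup 1 (G n) := by
    rintro x ⟨k, hk⟩
    refine ⟨max k (i + 1), ?_⟩
    have hi : G (i + 1) ≤ G (max k (i + 1)) := hG (le_max_right _ _)
    have ha : x ∈ G (max k (i + 1)) := hG (le_max_left _ _) hk
    have e : conjSubgroup 1 (G (max k (i + 1))) = G (max k (i + 1)) := by
      ext y; simp [conjSubgroup]
    rw [e]
    refine sup_le hi ?_
    rintro _ ⟨g, hg, rfl⟩
    exact mul_mem (mul_mem ha (hi hg)) (inv_mem ha)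
  constructor
  · intro h
    obtain ⟨n, hn⟩ := key _ h
    exact (h4 i c hc hc' n 1).1 hn
  · intro h
    obtain ⟨n, hn⟩ := key _ h
    exact (h4 i c hc hc' n 1).2 hn

/-! ### The folding maps -/

variable (hG : Monotone G) (h1 : CondP1 G a)

/-- The first factor is hit directly. By (P2) the second is generated by `β(G (n + 1))`, which lies
in the first factor, and by its conjugate by `β(a)`, which is the image of the second copy of `G (n
+ 1)`. -/
theorem phi_surjective (h2 : CondP2 G a) (n : ℕ) : Function.Surjective (phi G a hG h1 n) := by
  rw [← MonoidHom.range_eq_top, ← top_le_iff, ← range_sup_range G (n + 1)]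
  have hM : (inM G (n + 1)).range ≤ (phi G a hG h1 n).range := by
    rintro _ ⟨m, rfl⟩
    exact ⟨inM G n m, phi_inM G a hG h1 n m⟩
  refine sup_le hM ?_
  rw [MonoidHom.range_eq_map, Subgroup.map_le_iff_le_comap, ← h2 n]
  refine sup_le ?_ ?_
  · intro g hg
    rw [Subgroup.mem_comap, ← inM_eq_inM' G (n + 1) hg]
    exact hM ⟨g, rfl⟩
  · rintro _ ⟨g, hg, rfl⟩
    refine ⟨inM' G n g, ?_⟩
    rw [phi_inM', inM_eq_inM' G (n + 1) hg]
    simp [map_mul]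

theorem foldMap_smul (n : ℕ) (g : Amalgam G n) (x : BSTree G n) :
    foldMap G a hG h1 n (g • x) = phi G a hG h1 n g • foldMap G a hG h1 n x := by
  obtain ⟨⟨e, s⟩, rfl⟩ := Quotient.exists_rep x
  obtain ⟨k, rfl⟩ := QuotientGroup.mk_surjective e
  change foldEdge G a hG h1 n ((g * k : Amalgam G n) : Amalgam G n ⧸ edgeGroup G n) s
    = _ • foldEdge G a hG h1 n (k : Amalgam G n ⧸ edgeGroup G n) s
  have e1 : firstHalf G a hG h1 n ((g * k : Amalgam G n) : Amalgam G n ⧸ edgeGroup G n)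
      = phi G a hG h1 n g • firstHalf G a hG h1 n (k : Amalgam G n ⧸ edgeGroup G n) :=
    congrArg QuotientGroup.mk (map_mul (phi G a hG h1 n) g k)
  have e2 : secondHalf G a hG h1 n ((g * k : Amalgam G n) : Amalgam G n ⧸ edgeGroup G n)
      = phi G a hG h1 n g • secondHalf G a hG h1 n (k : Amalgam G n ⧸ edgeGroup G n) := by
    refine congrArg QuotientGroup.mk ?_
    beta_reduce
    rw [map_mul, mul_assoc]
    rfl
  unfold foldEdge
  rw [e1, e2]
  split_ifs <;> rfl

theorem foldMap_surjective (h2 : CondP2 G a) (n : ℕ) :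
    Function.Surjective (foldMap G a hG h1 n) := by
  intro x
  obtain ⟨⟨e, s⟩, rfl⟩ := Quotient.exists_rep x
  obtain ⟨k, rfl⟩ := QuotientGroup.mk_surjective e
  obtain ⟨g, rfl⟩ := phi_surjective hG h1 h2 n k
  have s0 := s.2.1
  have s1 := s.2.2
  refine ⟨Realization.pt _ _ (g : Amalgam G n ⧸ edgeGroup G n)
    ⟨(s : ℝ) / 2, by linarith, by linarith⟩, ?_⟩
  rw [foldMap_pt, foldEdge, if_pos (by simp; linarith)]
  have : (2 * ((s : ℝ) / 2)) = s := by ring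
  simp only [this, Set.projIcc_val]
  rfl

theorem foldMap_vA (n : ℕ) (g : Amalgam G n) :
    foldMap G a hG h1 n (vA G n g) = vA G (n + 1) (phi G a hG h1 n g) := by
  rw [vA, foldMap_pt, foldEdge, if_pos (by simp)]
  simp only [Set.Icc.coe_zero, mul_zero, Set.projIcc_left]
  rfl

theorem foldMap_vB (n : ℕ) (g : Amalgam G n) : foldMap G a hG h1 n (vB G n g)
    = vA G (n + 1) (phi G a hG h1 n g * inM' G (n + 1) (a (n + 1))) := by
  rw [vB, foldMap_pt, foldEdge, if_neg (by norm_num)]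
  simp only [Set.Icc.coe_one, mul_one, sub_self, Set.projIcc_left]
  rfl

theorem seqMap_smul {l j : ℕ} (h : l ≤ j) (g : Amalgam G l) (x : BSTree G l) :
    seqMap (foldMap G a hG h1) h (g • x)
      = phiLE G a hG h1 l j h g • seqMap (foldMap G a hG h1) h x := by
  induction j, h using Nat.le_induction with
  | base =>
    rw [seqMap_self, seqMap_self]
    exact congrArg (· • x) (seqMap_self (fun n => phi G a hG h1 n) g).symm
  | succ j h ih =>
    rw [seqMap_succ _ h, seqMap_succ _ h, ih, foldMap_smul]
    exact congrArg (· • _) (seqMap_succ (fun n => phi G a hG h1 n) h g).symm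

theorem phiLE_succ {l j : ℕ} (h : l ≤ j) (g : Amalgam G l) :
    phiLE G a hG h1 l (j + 1) (Nat.le_succ_of_le h) g = phi G a hG h1 j (phiLE G a hG h1 l j h g) :=
  seqMap_succ (fun n => phi G a hG h1 n) h g

theorem phiLE_self {l : ℕ} (g : Amalgam G l) : phiLE G a hG h1 l l le_rfl g = g :=
  seqMap_self (fun n => phi G a hG h1 n) g

theorem phiLE_succ_left {l j : ℕ} (h : l + 1 ≤ j) (g : Amalgam G l) :
    phiLE G a hG h1 (l + 1) j h (phi G a hG h1 l g)
      = phiLE G a hG h1 l j ((Nat.le_succ l).trans h) g :=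
  seqMap_succ_left (fun n => phi G a hG h1 n) h g

theorem phiLE_inM {l j : ℕ} (h : l ≤ j) (m : M) :
    phiLE G a hG h1 l j h (inM G l m) = inM G j m := by
  induction j, h using Nat.le_induction with
  | base => exact phiLE_self hG h1 _
  | succ j h ih => rw [phiLE_succ hG h1 h, ih, phi_inM]

theorem seqMap_vA {l j : ℕ} (h : l ≤ j) (g : Amalgam G l) :
    seqMap (foldMap G a hG h1) h (vA G l g) = vA G j (phiLE G a hG h1 l j h g) := by
  induction j, h using Nat.le_induction with
  | base => rw [seqMap_self, phiLE_self]
  | succ j h ih => rw [seqMap_succ _ h, ih, foldMap_vA, phiLE_succ]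

/-! ### Images of words -/

/-- The word obtained by subdividing: `y β(x)` is mapped to `y β(a) x β(a⁻¹)`. -/
def subdivide (b : M) (l : List (M × M)) : List (M × M) := l.flatMap fun p => [(p.1, b), (p.2, b⁻¹)]

theorem subdivide_cons (b : M) (p : M × M) (l : List (M × M)) :
    subdivide b (p :: l) = (p.1, b) :: (p.2, b⁻¹) :: subdivide b l := rfl

theorem subdivide_append (b : M) (l l' : List (M × M)) :
    subdivide b (l ++ l') = subdivide b l ++ subdivide b l' := List.flatMap_append

theorem length_subdivide (b : M) (l : List (M × M)) : (subdivide b l).length = 2 * l.length := by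
  induction l with
  | nil => rfl
  | cons p l ih => rw [subdivide_cons]; simp only [List.length_cons, ih]; ring

theorem phi_wordProd (n : ℕ) (l : List (M × M)) : phi G a hG h1 n (wordProd G n l)
    = wordProd G (n + 1) (subdivide (a (n + 1)) l) := by
  induction l with
  | nil => simp [wordProd, subdivide]
  | cons p l ih =>
    rw [subdivide_cons, wordProd_cons, wordProd_cons, wordProd_cons, map_mul, map_mul, phi_inM,
      phi_inM', ih, map_inv]
    simp only [mul_assoc]

open Classical in
/-- The number of letters of a word that lie in the union of the subgroups `G k`. -/
noncomputable def badCount (G : ℕ → Subgroup M) (l : List (M × M)) : ℕ :=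
  (l.map fun p => (if Bad G p.1 then 1 else 0) + if Bad G p.2 then 1 else 0).sum

theorem badCount_append (l l' : List (M × M)) :
    badCount G (l ++ l') = badCount G l + badCount G l' := by simp [badCount]

open Classical in
theorem badCount_cons (p : M × M) (l : List (M × M)) :
    badCount G (p :: l) = (if Bad G p.1 then 1 else 0) + (if Bad G p.2 then 1 else 0)
      + badCount G l := by simp [badCount]

theorem badCount_eq_zero {l : List (M × M)} :
    badCount G l = 0 ↔ ∀ p ∈ l, ¬ Bad G p.1 ∧ ¬ Bad G p.2 := by
  induction l with
  | nil => simp [badCount]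
  | cons p l ih =>
    rw [badCount_cons, Nat.add_eq_zero_iff, ih]
    simp

theorem badCount_subdivide {b : M} (hb : ¬ Bad G b) (l : List (M × M)) :
    badCount G (subdivide b l) = badCount G l := by
  induction l with
  | nil => rfl
  | cons p l ih =>
    rw [subdivide_cons, badCount_cons, badCount_cons, badCount_cons, ih, if_neg hb,
      if_neg (mt bad_inv.1 hb)]
    ring

/-- A letter that is not bad is amalgamated at no level. Subdivision creates no bad letters, so the
word stays reduced forever, and the doubling of its length compensates the halving of the edges. -/
theorem permIso_wordProd (ha : ∀ i, ¬ Bad G (a (i + 1))) (n : ℕ) (l : List (M × M))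
    (hl : badCount G l = 0) :
    PermIso (foldMap G a hG h1) (vA G n 1) (vA G n (wordProd G n l)) := by
  have hd : ∀ (j : ℕ) (l : List (M × M)), badCount G l = 0 →
      dist (vA G j 1) (vA G j (wordProd G j l)) = 2 * l.length / 2 ^ j := fun j l hl =>
    dist_wordProd
      (fun p hp h => (badCount_eq_zero.1 hl p (List.mem_of_mem_tail hp)).1 ⟨j, h⟩)
      fun p hp h => (badCount_eq_zero.1 hl p hp).2 ⟨j, h⟩
  intro j hj
  rw [seqMap_vA, seqMap_vA, map_one, hd n l hl]
  have : ∃ l', badCount G l' = 0 ∧ phiLE G a hG h1 n j hj (wordProd G n l) = wordProd G j l' ∧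
      (l'.length : ℝ) / 2 ^ j = l.length / 2 ^ n := by
    induction j, hj using Nat.le_induction with
    | base => exact ⟨l, hl, phiLE_self hG h1 _, rfl⟩
    | succ j hj ih =>
      obtain ⟨l', h0, hp, hlen⟩ := ih
      refine ⟨subdivide (a (j + 1)) l', by rw [badCount_subdivide (ha j), h0], ?_, ?_⟩
      · rw [phiLE_succ hG h1 hj, hp, phi_wordProd]
      · rw [length_subdivide, ← hlen, pow_succ]; push_cast; field_simp
  obtain ⟨l', h0, hp, hlen⟩ := this
  rw [hp, hd j l' h0, mul_div_assoc, hlen, mul_div_assoc]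

theorem PermIso.smul {n : ℕ} {x y : BSTree G n} (h : PermIso (foldMap G a hG h1) x y)
    (g : Amalgam G n) : PermIso (foldMap G a hG h1) (g • x) (g • y) := by
  intro j hj
  rw [seqMap_smul, seqMap_smul, BSTree.dist_smul, BSTree.dist_smul, h j hj]

theorem EvStable.smul {n : ℕ} {x y : BSTree G n} (h : EvStable (foldMap G a hG h1) x y)
    (g : Amalgam G n) : EvStable (foldMap G a hG h1) (g • x) (g • y) := by
  obtain ⟨k, hk, h⟩ := h
  refine ⟨k, hk, fun j hj => ?_⟩
  simpa only [seqMap_smul, BSTree.dist_smul] using h j hj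

theorem vA_inM {n : ℕ} (m : M) : vA G n (inM G n m) = vA G n 1 := by
  rw [← vA_mul_inM 1 m, one_mul]

theorem evStable_inM_mul {n : ℕ} {m : M} {g : Amalgam G n}
    (h : EvStable (foldMap G a hG h1) (vA G n 1) (vA G n g)) :
    EvStable (foldMap G a hG h1) (vA G n 1) (vA G n (inM G n m * g)) := by
  simpa only [smul_vA, mul_one, vA_inM] using h.smul hG h1 (inM G n m)

/-- A word in which a letter becomes trivial at the index `k + 1` can be shortened there so that
the number of bad letters decreases. -/
theorem evStable_of_letter (ha : ∀ i, ¬ Bad G (a (i + 1)))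
    (hc : ∀ i c, c ∈ G (i + 1) → c ∉ G i →
      ¬ Bad G (a (i + 1) * c * (a (i + 1))⁻¹) ∧ ¬ Bad G ((a (i + 1))⁻¹ * c * a (i + 1)))
    (b : ℕ) (ih : ∀ b' < b, ∀ (n : ℕ) (l : List (M × M)), badCount G l = b' →
      EvStable (foldMap G a hG h1) (vA G n 1) (vA G n (wordProd G n l)))
    (q : ℕ) : ∀ (n : ℕ) (l : List (M × M)), badCount G l = b →
      (∃ (l₁ l₂ : List (M × M)) (y c : M), l = l₁ ++ (y, c) :: l₂ ∧ c ∈ G (n + q + 1) ∧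
          c ∉ G (n + q)) ∨
        (∃ (l₁ l₂ : List (M × M)) (y x c z : M), l = l₁ ++ (y, x) :: (c, z) :: l₂ ∧
          c ∈ G (n + q + 1) ∧ c ∉ G (n + q)) →
      EvStable (foldMap G a hG h1) (vA G n 1) (vA G n (wordProd G n l)) := by
  induction q with
  | zero =>
    rintro n l hb (⟨l₁, l₂, y, c, rfl, hc1, hc0⟩ | ⟨l₁, l₂, y, x, c, z, rfl, hc1, hc0⟩)
    · have hcb : Bad G c := ⟨_, hc1⟩
      refine EvStable.of_map ?_
      rw [foldMap_vA, foldMap_vA, map_one, phi_wordProd]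
      set α := a (n + 1) with hα
      -- At level `n + 1` the letter `c` is amalgamated, so it can be read in the second factor,
      -- where it fuses with `α` and `α⁻¹`.
      have hw : wordProd G (n + 1) (subdivide α (l₁ ++ (y, c) :: l₂))
          = wordProd G (n + 1) (subdivide α l₁ ++ (y, α * c * α⁻¹) :: subdivide α l₂) := by
        rw [subdivide_append, subdivide_cons, wordProd_append, wordProd_append, wordProd_cons,
          wordProd_cons, wordProd_cons]
        simp only [inM_eq_inM' G (n + 1) hc1, map_mul, mul_assoc]
      rw [hw]
      refine ih _ ?_ _ _ rfl
      rw [← hb, badCount_append, badCount_append, badCount_cons, badCount_cons,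
        badCount_subdivide (ha n), badCount_subdivide (ha n), if_pos hcb,
        if_neg (hc n c hc1 hc0).1]
      dsimp only
      omega
    · have hcb : Bad G c := ⟨_, hc1⟩
      refine EvStable.of_map ?_
      rw [foldMap_vA, foldMap_vA, map_one, phi_wordProd]
      set α := a (n + 1) with hα
      -- An interior `M`-letter is preceded by the `α⁻¹` of the previous pair and followed by its
      -- own `α`, hence the opposite conjugate.
      have hw : wordProd G (n + 1) (subdivide α (l₁ ++ (y, x) :: (c, z) :: l₂))
          = wordProd G (n + 1)
            (subdivide α l₁ ++ (y, α) :: (x, α⁻¹ * c * α) :: (z, α⁻¹) :: subdivide α l₂) := by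
        rw [subdivide_append, subdivide_cons, subdivide_cons, wordProd_append, wordProd_append]
        simp only [wordProd_cons, inM_eq_inM' G (n + 1) hc1, map_mul, mul_assoc]
      rw [hw]
      refine ih _ ?_ _ _ rfl
      rw [← hb, badCount_append, badCount_append]
      simp only [badCount_cons]
      rw [badCount_subdivide (ha n), badCount_subdivide (ha n), if_pos hcb,
        if_neg (hc n c hc1 hc0).2, if_neg (ha n), if_neg (mt bad_inv.1 (ha n))]
      omega
  | succ q ihq =>
    intro n l hb hl
    refine EvStable.of_map ?_
    rw [foldMap_vA, foldMap_vA, map_one, phi_wordProd]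
    refine ihq (n + 1) _ (by rw [badCount_subdivide (ha n), hb]) ?_
    have e1 : n + 1 + q = n + (q + 1) := by ring
    rw [e1]
    -- After a subdivision the letter is an interior `M`-letter, whichever factor it came from.
    rcases hl with ⟨l₁, l₂, y, c, rfl, hc⟩ | ⟨l₁, l₂, y, x, c, z, rfl, hc⟩
    · right
      exact ⟨subdivide (a (n + 1)) l₁, subdivide (a (n + 1)) l₂, y, a (n + 1), c, (a (n + 1))⁻¹,
        by rw [subdivide_append, subdivide_cons], hc⟩
    · right
      refine ⟨subdivide (a (n + 1)) l₁ ++ [(y, a (n + 1))], (z, (a (n + 1))⁻¹) ::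
        subdivide (a (n + 1)) l₂, x, (a (n + 1))⁻¹, c, a (n + 1), ?_, hc⟩
      rw [subdivide_append, subdivide_cons, subdivide_cons]
      simp

theorem exists_first_index {n : ℕ} {c : M} (hG : Monotone G) (hb : Bad G c) (hn : c ∉ G n) :
    ∃ q, c ∈ G (n + q + 1) ∧ c ∉ G (n + q) := by
  classical
  have hpos : Nat.find hb ≠ 0 ∧ n < Nat.find hb := by
    have : n < Nat.find hb := by
      by_contra h
      exact hn (hG (not_lt.1 h) (Nat.find_spec hb))
    exact ⟨by omega, this⟩
  refine ⟨Nat.find hb - 1 - n, ?_, ?_⟩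
  · have : n + (Nat.find hb - 1 - n) + 1 = Nat.find hb := by omega
    rw [this]; exact Nat.find_spec hb
  · have : n + (Nat.find hb - 1 - n) = Nat.find hb - 1 := by omega
    rw [this]; exact Nat.find_min hb (by omega)

/-- The product may be bad even if `y` and `z` are not, but the bad letter `x` that disappears pays
for it. -/
theorem badCount_merge_le {y x z w : M} (hx : Bad G x) (l : List (M × M)) :
    badCount G ((y * x * z, w) :: l) ≤ badCount G ((y, x) :: (z, w) :: l) := by
  classical
  simp only [badCount_cons, if_pos hx]
  split_ifs <;> omega

theorem badCount_merge_le' {y x z w : M} (hz : Bad G z) (l : List (M × M)) :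
    badCount G ((y, x * z * w) :: l) ≤ badCount G ((y, x) :: (z, w) :: l) := by
  classical
  simp only [badCount_cons, if_pos hz]
  split_ifs <;> omega

/-- A word with an interior letter in the amalgamated subgroup can be shortened without increasing
the number of bad letters. -/
theorem exists_shorter_word {n : ℕ} (l : List (M × M))
    (h : (∃ p ∈ l, p.2 ∈ G n) ∨ ∃ l₁ l₂ p, l = l₁ ++ p :: l₂ ∧ l₁ ≠ [] ∧ p.1 ∈ G n) :
    ∃ l', l'.length < l.length ∧ badCount G l' ≤ badCount G l ∧
      vA G n (wordProd G n l') = vA G n (wordProd G n l) := by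
  rcases h with ⟨⟨y, x⟩, hp, hx⟩ | ⟨l₁, l₂, ⟨z, w⟩, rfl, hne, hz⟩
  · dsimp only at hx
    obtain ⟨l₁, l₂, rfl⟩ := List.append_of_mem hp
    cases l₂ with
    | nil =>
      refine ⟨l₁, by simp, by rw [badCount_append]; omega, ?_⟩
      rw [wordProd_append, wordProd_cons, ← inM_eq_inM' G n hx, ← map_mul]
      simp only [wordProd, List.map_nil, List.prod_nil, mul_one]
      rw [vA_mul_inM]
    | cons q l₂ =>
      obtain ⟨z, w⟩ := q
      refine ⟨l₁ ++ (y * x * z, w) :: l₂, by simp, ?_, ?_⟩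
      · rw [badCount_append, badCount_append]
        exact Nat.add_le_add_left (badCount_merge_le ⟨n, hx⟩ l₂) _
      · simp only [wordProd_append, wordProd_cons, ← inM_eq_inM' G n hx, map_mul, mul_assoc]
  · dsimp only at hz
    obtain ⟨l₀, ⟨y, x⟩, rfl⟩ : ∃ l₀ q, l₁ = l₀ ++ [q] :=
      ⟨l₁.dropLast, l₁.getLast hne, (List.dropLast_append_getLast hne).symm⟩
    refine ⟨l₀ ++ (y, x * z * w) :: l₂, by simp, ?_, ?_⟩
    · rw [List.append_assoc, List.singleton_append, badCount_append, badCount_append]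
      exact Nat.add_le_add_left (badCount_merge_le' ⟨n, hz⟩ l₂) _
    · rw [List.append_assoc, List.singleton_append]
      simp only [wordProd_append, wordProd_cons, inM_eq_inM' G n hz, map_mul, mul_assoc]

/-- Induction on the number of bad letters, and for a fixed number on the length. The level is not
bounded in the induction, since a bad letter is eliminated only at the level where it is
amalgamated. -/
theorem evStable_wordProd (ha : ∀ i, ¬ Bad G (a (i + 1)))
    (hc : ∀ i c, c ∈ G (i + 1) → c ∉ G i →
      ¬ Bad G (a (i + 1) * c * (a (i + 1))⁻¹) ∧ ¬ Bad G ((a (i + 1))⁻¹ * c * a (i + 1)))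
    (b : ℕ) : ∀ (n : ℕ) (l : List (M × M)), badCount G l = b →
      EvStable (foldMap G a hG h1) (vA G n 1) (vA G n (wordProd G n l)) := by
  induction b using Nat.strong_induction_on with
  | _ b ihb =>
    intro n l
    induction hlen : l.length using Nat.strong_induction_on generalizing l with
    | _ len ihlen =>
      intro hb
      by_cases hred : (∃ p ∈ l, p.2 ∈ G n) ∨
          ∃ l₁ l₂ p, l = l₁ ++ p :: l₂ ∧ l₁ ≠ [] ∧ p.1 ∈ G n
      · obtain ⟨l', hl, hb', hv⟩ := exists_shorter_word l hred
        rw [← hv]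
        rcases hb'.eq_or_lt with h | h
        · exact ihlen _ (hlen ▸ hl) l' rfl (h.trans hb)
        · exact ihb _ (hb ▸ h) n l' rfl
      push Not at hred
      obtain ⟨hred2, hred1⟩ := hred
      by_cases hb0 : badCount G l = 0
      · exact (permIso_wordProd hG h1 ha n l hb0).evStable
      cases l with
      | nil => exact absurd rfl hb0
      | cons p l =>
        by_cases hp : Bad G p.1
        -- The first letter can be changed at will, because `M` fixes the base vertex; `a 1` is
        -- merely a letter known not to be bad.
        · have e : wordProd G n (p :: l) = inM G n (p.1 * (a 1)⁻¹)
              * wordProd G n ((a 1, p.2) :: l) := by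
            rw [wordProd_cons, wordProd_cons, map_mul, map_inv]
            group
          rw [e]
          refine evStable_inM_mul hG h1 (ihb _ ?_ n _ rfl)
          rw [← hb, badCount_cons, badCount_cons, if_pos hp, if_neg (ha 0)]
          dsimp only
          omega
        · have hex : ∃ r ∈ p :: l, Bad G r.1 ∨ Bad G r.2 := by
            by_contra! h
            exact hb0 (badCount_eq_zero.2 h)
          obtain ⟨⟨y, x⟩, hr, hbad⟩ := hex
          obtain ⟨l₁, l₂, hl⟩ := List.append_of_mem hr
          by_cases hx : Bad G x
          -- The word being reduced at level `n`, the bad letter is not yet in `G n` and enters the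
          -- chain at a later index.
          · obtain ⟨q, hq1, hq2⟩ := exists_first_index hG hx (hred2 _ hr)
            exact evStable_of_letter hG h1 ha hc b ihb q n _ hb
              (.inl ⟨l₁, l₂, y, x, hl, hq1, hq2⟩)
          · have hy : Bad G y := hbad.resolve_right hx
            have hne : l₁ ≠ [] := by
              rintro rfl
              rw [List.nil_append, List.cons.injEq] at hl
              exact hp (hl.1 ▸ hy)
            obtain ⟨q, hq1, hq2⟩ := exists_first_index hG hy (hred1 l₁ l₂ (y, x) hl hne)
            obtain ⟨l₀, ⟨y', x'⟩, rfl⟩ : ∃ l₀ q, l₁ = l₀ ++ [q] :=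
              ⟨l₁.dropLast, l₁.getLast hne, (List.dropLast_append_getLast hne).symm⟩
            rw [List.append_assoc, List.singleton_append] at hl
            exact evStable_of_letter hG h1 ha hc b ihb q n _ hb
              (.inr ⟨l₀, l₂, y', x', y, x, hl, hq1, hq2⟩)

end Fold

/-! ### Eventually constant distances, fixed edges, and edges inside segments. -/

section Stability

variable {M : Type*} [Group M] {G : ℕ → Subgroup M} {a : ℕ → M}
variable (hG : Monotone G) (h1 : CondP1 G a)

/-! ### Stability of distances -/

/-- After one fold the edge becomes a path of two edges between translates of `M`, encoded up to
translation by the single letter `β(a)`. The dummy first letter `a 1` replaces `1`, which would be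
bad. -/
theorem permIso_edge (ha : ∀ i, ¬ Bad G (a (i + 1))) (n : ℕ) (g : Amalgam G n) :
    PermIso (foldMap G a hG h1) (vA G n g) (vB G n g) := by
  have h0 : badCount G [((a 1), a (n + 1))] = 0 := by
    rw [badCount_eq_zero]
    simpa using ⟨ha 0, ha n⟩
  have hw : phi G a hG h1 n g • (inM G (n + 1) (a 1))⁻¹ •
      vA G (n + 1) (wordProd G (n + 1) [(a 1, a (n + 1))])
        = vA G (n + 1) (phi G a hG h1 n g * inM' G (n + 1) (a (n + 1))) := by
    rw [smul_vA, smul_vA]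
    simp [wordProd]
  have hw' : phi G a hG h1 n g • (inM G (n + 1) (a 1))⁻¹ • vA G (n + 1) 1
        = vA G (n + 1) (phi G a hG h1 n g) := by
    rw [smul_vA, smul_vA, mul_one, ← map_inv, vA_mul_inM]
  refine PermIso.of_map ?_ ?_ <;> rw [foldMap_vA, foldMap_vB, ← hw, ← hw']
  · exact ((permIso_wordProd hG h1 ha (n + 1) _ h0).smul hG h1 _).smul hG h1 _
  · rw [BSTree.dist_smul, BSTree.dist_smul, dist_vA_vB, dist_wordProd]
    · simp [pow_succ]; ring
    · simp
    · simpa using fun h => ha n ⟨n + 1, h⟩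

theorem btw_pt {n : ℕ} (e : Amalgam G n ⧸ edgeGroup G n) {s u v : unitInterval} (h : s ≤ u)
    (h' : u ≤ v) : Btw (Realization.pt _ _ e s : BSTree G n) (Realization.pt _ _ e u)
      (Realization.pt _ _ e v) := by
  have h : (s : ℝ) ≤ u := h
  have h' : (u : ℝ) ≤ v := h'
  unfold Btw
  rw [BSTree.dist_pt, BSTree.dist_pt, BSTree.dist_pt, abs_of_nonpos (by linarith),
    abs_of_nonpos (by linarith), abs_of_nonpos (by linarith)]
  ring

theorem btw_vA_pt_vB {n : ℕ} (g : Amalgam G n) (s : unitInterval) :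
    Btw (vA G n g) (Realization.pt _ _ (g : Amalgam G n ⧸ edgeGroup G n) s) (vB G n g) :=
  btw_pt _ unitInterval.nonneg' unitInterval.le_one'

theorem OnEdge.permIso (ha : ∀ i, ¬ Bad G (a (i + 1))) {n : ℕ} {x y : BSTree G n}
    (h : OnEdge x y) : PermIso (foldMap G a hG h1) x y := by
  have key : ∀ (g : Amalgam G n) (s u : unitInterval), s ≤ u → PermIso (foldMap G a hG h1)
      (Realization.pt _ _ (g : Amalgam G n ⧸ edgeGroup G n) s)
      (Realization.pt _ _ (g : Amalgam G n ⧸ edgeGroup G n) u) := by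
    intro g s u hsu
    have p1 := ((permIso_edge hG h1 ha n g).btw (foldMap_lipschitz G a hG h1)
      (btw_vA_pt_vB g u)).1
    exact (p1.btw (foldMap_lipschitz G a hG h1) (btw_pt _ unitInterval.nonneg' hsu)).2.1
  obtain ⟨e, s, u, rfl, rfl⟩ := h
  obtain ⟨g, rfl⟩ := QuotientGroup.mk_surjective e
  rcases le_total s u with h | h
  · exact key g s u h
  · exact (key g u s h).symm

theorem Chain.mono {X : Type*} [MetricSpace X] {R R' : X → X → Prop} (hR : ∀ x y, R x y → R' x y)
    {x y : X} (h : Chain R x y) : Chain R' x y := by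
  induction h with
  | nil x => exact .nil x
  | cons x y z hxy hb _ ih => exact .cons x y z (hR _ _ hxy) hb ih

theorem isTreeMorphism_foldMap (ha : ∀ i, ¬ Bad G (a (i + 1))) (n : ℕ) :
    IsTreeMorphism (foldMap G a hG h1 n) := by
  refine isTreeMorphism_of_chain (BSTree.fourPoint G n) isPiece_onEdge BSTree.chain _ ?_
  intro x y h
  have := h.permIso hG h1 ha (n + 1) (Nat.le_succ n)
  rw [← seqMap_succ_left _ le_rfl, ← seqMap_succ_left _ le_rfl, seqMap_self, seqMap_self] at this
  exact this

theorem evStable_vA (ha : ∀ i, ¬ Bad G (a (i + 1)))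
    (hc : ∀ i c, c ∈ G (i + 1) → c ∉ G i →
      ¬ Bad G (a (i + 1) * c * (a (i + 1))⁻¹) ∧ ¬ Bad G ((a (i + 1))⁻¹ * c * a (i + 1)))
    (n : ℕ) (g g' : Amalgam G n) :
    EvStable (foldMap G a hG h1) (vA G n g) (vA G n g') := by
  obtain ⟨l, m, h⟩ := exists_wordProd (g⁻¹ * g')
  rw [inv_mul_eq_iff_eq_mul] at h
  have := (evStable_wordProd hG h1 ha hc _ n l rfl).smul hG h1 g
  rwa [smul_vA, smul_vA, mul_one, ← vA_mul_inM (g * _) m, mul_assoc, ← h] at this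

/-- One fold sends vertices of the second kind to vertices of the first kind, where words apply.
Other points lie on permanently embedded edges, so stability passes to them from the endpoints. -/
theorem evStable (ha : ∀ i, ¬ Bad G (a (i + 1)))
    (hc : ∀ i c, c ∈ G (i + 1) → c ∉ G i →
      ¬ Bad G (a (i + 1) * c * (a (i + 1))⁻¹) ∧ ¬ Bad G ((a (i + 1))⁻¹ * c * a (i + 1)))
    (n : ℕ) (x y : BSTree G n) : EvStable (foldMap G a hG h1) x y := by
  have hAB : ∀ g g' : Amalgam G n, EvStable (foldMap G a hG h1) (vA G n g) (vB G n g') := by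
    intro g g'
    refine EvStable.of_map ?_
    rw [foldMap_vA, foldMap_vB]
    exact evStable_vA hG h1 ha hc _ _ _
  have hBB : ∀ g g' : Amalgam G n, EvStable (foldMap G a hG h1) (vB G n g) (vB G n g') := by
    intro g g'
    refine EvStable.of_map ?_
    rw [foldMap_vB, foldMap_vB]
    exact evStable_vA hG h1 ha hc _ _ _
  have hf := foldMap_lipschitz G a hG h1
  obtain ⟨⟨e, s⟩, rfl⟩ := Quotient.exists_rep x
  obtain ⟨g, rfl⟩ := QuotientGroup.mk_surjective e
  obtain ⟨⟨e', u⟩, rfl⟩ := Quotient.exists_rep y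
  obtain ⟨g', rfl⟩ := QuotientGroup.mk_surjective e'
  have key : ∀ z, EvStable (foldMap G a hG h1) z (vA G n g) →
      EvStable (foldMap G a hG h1) z (vB G n g) →
      EvStable (foldMap G a hG h1) z
        (Realization.pt _ _ (g : Amalgam G n ⧸ edgeGroup G n) s) := fun z hz hz' =>
    EvStable.btw (BSTree.fourPoint G) hf z (permIso_edge hG h1 ha n g) (btw_vA_pt_vB g s) hz hz'
  exact EvStable.btw (BSTree.fourPoint G) hf _ (permIso_edge hG h1 ha n g') (btw_vA_pt_vB g' u)
    (key _ (evStable_vA hG h1 ha hc _ _ _) (hAB _ _)).symm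
    (key _ (hAB _ _).symm (hBB _ _)).symm

/-! ### Stabilizers of edges -/

/-- One step carries the second factor to a conjugate of the first, on which all later maps are
injective. -/
theorem phiLE_inM'_injective {l j : ℕ} (h : l ≤ j) {x y : M}
    (hxy : phiLE G a hG h1 l j h (inM' G l x) = phiLE G a hG h1 l j h (inM' G l y)) : x = y := by
  rcases h.eq_or_lt with rfl | h
  · rw [phiLE_self, phiLE_self] at hxy
    exact inM'_injective G l hxy
  · have h' : l + 1 ≤ j := h
    rw [← phiLE_succ_left hG h1 h', ← phiLE_succ_left hG h1 h', phi_inM', phi_inM'] at hxy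
    simp only [map_mul, map_inv, mul_left_inj, mul_right_inj, phiLE_inM] at hxy
    exact inM_injective G j hxy

theorem foldMap_midpoint (n : ℕ) (g : Amalgam G n) :
    foldMap G a hG h1 n (Realization.pt _ _ (g : Amalgam G n ⧸ edgeGroup G n)
      ⟨1 / 2, by norm_num, by norm_num⟩) = vB G (n + 1) (phi G a hG h1 n g) := by
  rw [foldMap_pt, foldEdge, if_pos le_rfl]
  have : (2 * (1 / 2) : ℝ) = 1 := by norm_num
  simp only [this, Set.projIcc_right]
  rfl

/-- Induction on `q = j - m`. The two halves of the edge are edges at level `m + 1`, so `h` comes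
from `c₁` and from `c₂` in `G (m + 1)` through the two halves, and the conjugation relation between
these brings `c₁` down to `G m`. -/
theorem mem_of_fixes_edge (ha : ∀ i, ¬ Bad G (a (i + 1)))
    (hc : ∀ i c, c ∈ G (i + 1) → c ∉ G i → ¬ Bad G ((a (i + 1))⁻¹ * c * a (i + 1)))
    (q : ℕ) : ∀ (m j : ℕ) (hj : m ≤ j), j = m + q → ∀ (g : Amalgam G m) (h : Amalgam G j),
      h • seqMap (foldMap G a hG h1) hj (vA G m g) = seqMap (foldMap G a hG h1) hj (vA G m g) →
      h • seqMap (foldMap G a hG h1) hj (vB G m g) = seqMap (foldMap G a hG h1) hj (vB G m g) →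
      ∃ c ∈ G m, h = phiLE G a hG h1 m j hj (g * inM G m c * g⁻¹) := by
  induction q with
  | zero =>
    intro m j hj hjm g h hA hB
    obtain rfl : j = m := by omega
    rw [seqMap_self] at hA hB
    rw [smul_vA, eq_comm, vA_eq_iff] at hA
    rw [smul_vB, eq_comm, vB_eq_iff] at hB
    obtain ⟨c, hc, hcg⟩ := (range_inf_range G j).le ⟨hA, hB⟩
    refine ⟨c, hc, ?_⟩
    rw [hcg, phiLE_self]
    group
  | succ q ih =>
    intro m j hj hjm g h hA hB
    have hmj : m + 1 ≤ j := by omega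
    set p : BSTree G m := Realization.pt _ _ (g : Amalgam G m ⧸ edgeGroup G m)
      ⟨1 / 2, by norm_num, by norm_num⟩ with hp
    have hpb := ((permIso_edge hG h1 ha m g).btw (foldMap_lipschitz G a hG h1)
      (btw_vA_pt_vB g ⟨1 / 2, by norm_num, by norm_num⟩)).2.2 j hj
    -- The image of the edge is still a geodesic, so fixing its endpoints means fixing its midpoint.
    have hP : h • seqMap (foldMap G a hG h1) hj p = seqMap (foldMap G a hG h1) hj p := by
      have hpb' := hpb.smul h
      rw [hA, hB] at hpb'
      refine (BSTree.fourPoint G j).eq_of_btw hpb' hpb ?_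
      have := BSTree.dist_smul h (seqMap (foldMap G a hG h1) hj (vA G m g))
        (seqMap (foldMap G a hG h1) hj p)
      rwa [hA] at this
    have hmid : foldMap G a hG h1 m p = vB G (m + 1) (phi G a hG h1 m g) :=
      foldMap_midpoint hG h1 m g
    have eA := seqMap_succ_left (foldMap G a hG h1) hmj (vA G m g)
    have eB := seqMap_succ_left (foldMap G a hG h1) hmj (vB G m g)
    have eP := seqMap_succ_left (foldMap G a hG h1) hmj p
    rw [foldMap_vA] at eA
    rw [foldMap_vB] at eB
    rw [hmid] at eP
    obtain ⟨c₁, hc₁, e₁⟩ := ih (m + 1) j hmj (by omega) (phi G a hG h1 m g) h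
      (by rw [eA]; exact hA) (by rw [eP]; exact hP)
    obtain ⟨c₂, hc₂, e₂⟩ := ih (m + 1) j hmj (by omega)
      (phi G a hG h1 m g * inM' G (m + 1) (a (m + 1))) h
      (by rw [eB]; exact hB) (by rw [vB_mul_inM', eP]; exact hP)
    have e : c₁ = a (m + 1) * c₂ * (a (m + 1))⁻¹ := by
      refine phiLE_inM'_injective hG h1 hmj ?_
      have := e₁.symm.trans e₂
      rw [inM_eq_inM' G (m + 1) hc₁, inM_eq_inM' G (m + 1) hc₂] at this
      simp only [map_mul, map_inv, mul_inv_rev, mul_assoc, mul_right_inj] at this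
      simp only [← mul_assoc, mul_left_inj] at this
      simpa only [map_mul, map_inv] using this
    -- Otherwise (P4) makes `a⁻¹ c₁ a = c₂` not bad, although it lies in `G (m + 1)`.
    have hc₁' : c₁ ∈ G m := by
      by_contra hcon
      refine hc m c₁ hc₁ hcon ⟨m + 1, ?_⟩
      rw [e]
      convert hc₂ using 1
      group
    refine ⟨c₁, hc₁', ?_⟩
    rw [e₁, ← phiLE_succ_left hG h1 hmj]
    simp only [map_mul, map_inv, phi_inM]

/-! ### Edges inside segments -/

theorem FourPoint.btw_of_dist_le {X : Type*} [MetricSpace X] (hX : FourPoint X) {v w v' x : X}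
    (h : Btw v w v') (hx : dist v x ≤ dist v w) : Btw x w v' := by
  unfold Btw at *
  have c1 := dist_comm x v
  have c2 := dist_comm w v
  have h0 := dist_nonneg (x := x) (y := w)
  rcases le_max_iff.1 (hX x w v v') with h' | h'
  · have : x = w := dist_eq_zero.1 (by linarith)
    simp [this]
  · exact le_antisymm (by linarith) (dist_triangle _ _ _)

theorem exists_reduced_word {n : ℕ} (g : Amalgam G n) : ∃ l : List (M × M),
    (∀ p ∈ l.tail, p.1 ∉ G n) ∧ (∀ p ∈ l, p.2 ∉ G n) ∧ vA G n (wordProd G n l) = vA G n g := by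
  classical
  have hex : ∃ k, ∃ l : List (M × M), l.length = k ∧ vA G n (wordProd G n l) = vA G n g := by
    obtain ⟨l, m, h⟩ := exists_wordProd g
    exact ⟨_, l, rfl, by rw [h, vA_mul_inM]⟩
  obtain ⟨l, hl, hv⟩ := Nat.find_spec hex
  have hmin : ¬ ((∃ p ∈ l, p.2 ∈ G n) ∨
      ∃ l₁ l₂ p, l = l₁ ++ p :: l₂ ∧ l₁ ≠ [] ∧ p.1 ∈ G n) := by
    intro h
    obtain ⟨l', hlt, -, hv'⟩ := exists_shorter_word l h
    exact Nat.find_min hex (hl ▸ hlt) ⟨l', rfl, hv'.trans hv⟩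
  push Not at hmin
  refine ⟨l, fun p hp => ?_, hmin.1, hv⟩
  cases l with
  | nil => simp at hp
  | cons q l =>
    obtain ⟨l₁, l₂, rfl⟩ := List.append_of_mem (show p ∈ l from hp)
    exact hmin.2 (q :: l₁) l₂ p rfl (by simp)

/-- A segment of length at least five edges contains an edge. -/
theorem exists_edge_btw {n : ℕ} (x y : BSTree G n) (h : 5 / 2 ^ n ≤ dist x y) :
    ∃ g, Btw x (vA G n g) y ∧ Btw x (vB G n g) y := by
  have hX := BSTree.fourPoint G n
  have near : ∀ z : BSTree G n, ∃ g, dist (vA G n g) z ≤ 1 / 2 ^ n := by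
    intro z
    obtain ⟨⟨e, s⟩, rfl⟩ := Quotient.exists_rep z
    obtain ⟨g, rfl⟩ := QuotientGroup.mk_surjective e
    refine ⟨g, ?_⟩
    have hb : dist (vA G n g) (Realization.pt _ _ (g : Amalgam G n ⧸ edgeGroup G n) s)
      + dist _ _ = dist _ _ := btw_vA_pt_vB g s
    rw [dist_vA_vB] at hb
    have := dist_nonneg (x := (Realization.pt _ _ (g : Amalgam G n ⧸ edgeGroup G n) s
      : BSTree G n)) (y := vB G n g)
    exact le_of_add_le_of_nonneg_left hb.le this
  obtain ⟨k, hk⟩ := near x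
  obtain ⟨k', hk'⟩ := near y
  obtain ⟨l, hl₁, hl₂, hv⟩ := exists_reduced_word (k⁻¹ * k')
  have hε : (0 : ℝ) < 1 / 2 ^ n := by positivity
  set ε : ℝ := 1 / 2 ^ n with hεd
  have hv' : k • vA G n (wordProd G n l) = vA G n k' := by
    rw [hv, smul_vA, mul_inv_cancel_left]
  have hone : k • vA G n 1 = vA G n k := by rw [smul_vA, mul_one]
  have dl : ∀ t : ℝ, 2 * t / 2 ^ n = 2 * t * ε := fun t => by rw [hεd]; ring
  have dtot := dist_wordProd hl₁ hl₂
  rw [dl] at dtot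
  -- Moving both ends to vertices costs at most two of the five edges, and the distance `2 *
  -- l.length` edges is even, so it is at least four.
  have hlen : 2 ≤ l.length := by
    have t1 := dist_triangle x (vA G n k) y
    have t2 := dist_triangle (vA G n k) (vA G n k') y
    rw [dist_comm x (vA G n k)] at t1
    rw [← hone, ← hv', BSTree.dist_smul, dtot, hone, hv'] at t2
    have h5 : 5 * ε ≤ dist x y := by rw [hεd]; calc _ = 5 / 2 ^ n := by ring
      _ ≤ _ := h
    have : 3 * ε ≤ 2 * l.length * ε := by linarith
    have h3 : (3 : ℝ) ≤ 2 * l.length := le_of_mul_le_mul_right this hε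
    by_contra hcon
    have : (l.length : ℝ) ≤ 1 := by exact_mod_cast (by omega : l.length ≤ 1)
    linarith
  obtain ⟨p, q, l', rfl⟩ : ∃ p q l', l = p :: q :: l' := by
    match l, hlen with
    | p :: q :: l', _ => exact ⟨p, q, l', rfl⟩
  set g₁ := inM G n p.1 * inM' G n p.2 with hg₁
  obtain ⟨b1, d1⟩ := btw_and_dist_wordProd (n := n) (q :: l')
    (fun r hr => hl₁ r (List.mem_of_mem_tail hr)) fun r hr => hl₂ r (List.mem_cons_of_mem _ hr)
  have b1 := (b1 q l' rfl).smul g₁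
  have d2 := dist_wordProd (G := G) (n := n) (l := [p]) (by simp)
    (by simpa using hl₂ p (by simp))
  have e1 : wordProd G n [p] = g₁ := by simp [wordProd, hg₁]
  have e2 : wordProd G n (p :: q :: l') = g₁ * wordProd G n (q :: l') := wordProd_cons _ _
  rw [e1, dl] at d2
  rw [dl, ← BSTree.dist_smul g₁, smul_vA, smul_vA, mul_one, ← e2] at d1
  rw [smul_vA, smul_vA, smul_vB, mul_one, ← e2] at b1
  simp only [List.length_cons, List.length_nil] at dtot d1 d2
  push_cast at dtot d1 d2
  set L : ℝ := (l'.length : ℝ) with hL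
  have hL0 : 0 ≤ L := by positivity
  have hLε : 0 ≤ L * ε := by positivity
  have bA : Btw (vA G n 1) (vA G n g₁) (vA G n (wordProd G n (p :: q :: l'))) := by
    unfold Btw; rw [d1, d2, dtot]; ring
  have bB : Btw (vA G n 1) (vB G n (g₁ * inM G n q.1)) (vA G n (wordProd G n (p :: q :: l'))) :=
    (bA.symm.trans_left b1.symm).symm
  have dB : dist (vA G n g₁) (vB G n (g₁ * inM G n q.1)) = ε := by
    rw [← vA_mul_inM g₁ q.1, dist_vA_vB]
  -- A point of the segment between the two chosen vertices that is at least one edge away from both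
  -- also lies between `x` and `y`. The third edge of the path qualifies.
  have far : ∀ w : BSTree G n, Btw (vA G n 1) w (vA G n (wordProd G n (p :: q :: l'))) →
      ε ≤ dist (vA G n 1) w → ε ≤ dist w (vA G n (wordProd G n (p :: q :: l'))) →
      Btw x (k • w) y := by
    intro w hw h1 h2
    have hw' := hw.smul k
    rw [hone, hv'] at hw'
    rw [← BSTree.dist_smul k, hone] at h1
    rw [← BSTree.dist_smul k, hv', dist_comm] at h2
    have s1 := hX.btw_of_dist_le hw' (hk.trans h1)
    exact (hX.btw_of_dist_le s1.symm (hk'.trans h2)).symm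
  refine ⟨k * (g₁ * inM G n q.1), ?_, ?_⟩
  · rw [← smul_vA, vA_mul_inM]
    refine far _ bA ?_ ?_
    · rw [d2]; linarith
    · rw [d1]; linarith
  · rw [← smul_vB]
    have b1' : dist _ _ + dist _ _ = dist _ _ := b1
    have bB' : dist _ _ + dist _ _ = dist _ _ := bB
    rw [dB, d1] at b1'
    rw [dtot] at bB'
    exact far _ bB (by linarith) (by linarith)

end Stability

/-! ### The limit group acting on the limit tree: fixed points and arc stabilizers. -/

section LimitAction

variable {M : Type*} [Group M] {G : ℕ → Subgroup M} {a : ℕ → M}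
variable (hG : Monotone G) (h1 : CondP1 G a)

/-! ### The limit group and its action -/

/-- The natural homomorphism from the `m`-th group of the sequence to the limit group. -/
noncomputable def psiHom (m : ℕ) : Amalgam G m →* LimitGroup G a hG h1 where
  toFun g := Quotient.mk _ ⟨m, g⟩
  map_one' := (DirectLimit.one_def m).symm
  map_mul' x y := (DirectLimit.mul_def m x y).symm

theorem psiHom_phiLE {l j : ℕ} (h : l ≤ j) (g : Amalgam G l) :
    psiHom hG h1 j (phiLE G a hG h1 l j h g) = psiHom hG h1 l g :=
  (DirectLimit.eq_of_le (f := fun l j h => phiLE G a hG h1 l j h) ⟨l, g⟩ j h).symm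

theorem psiHom_eq_one {m : ℕ} {g : Amalgam G m} (h : psiHom hG h1 m g = 1) :
    ∃ (k : ℕ) (hk : m ≤ k), phiLE G a hG h1 m k hk g = 1 :=
  (DirectLimit.exists_eq_one (f := fun l j h => phiLE G a hG h1 l j h) ⟨m, g⟩).1 h

theorem phiLE_surjective (h2 : CondP2 G a) {l j : ℕ} (h : l ≤ j) :
    Function.Surjective (phiLE G a hG h1 l j h) :=
  seqMap_surjective (f := fun n => phi G a hG h1 n) (phi_surjective hG h1 h2) h

theorem psiHom_surjective (h2 : CondP2 G a) : Function.Surjective (psiHom hG h1 0) := by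
  intro x
  obtain ⟨⟨m, g⟩, rfl⟩ := Quotient.exists_rep x
  obtain ⟨g', rfl⟩ := phiLE_surjective hG h1 h2 (Nat.zero_le m) g
  exact ⟨g', (psiHom_phiLE hG h1 _ g').symm⟩

theorem psiHom_inM_injective (m : ℕ) :
    Function.Injective fun c : M => psiHom hG h1 m (inM G m c) := by
  intro c c' h
  have h' : psiHom hG h1 m (inM G m (c⁻¹ * c')) = 1 := by
    rw [map_mul, map_mul, map_inv, map_inv, inv_mul_eq_one]
    exact h
  obtain ⟨k, hk, e⟩ := psiHom_eq_one hG h1 h'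
  rw [phiLE_inM, ← map_one (inM G k)] at e
  exact inv_mul_eq_one.1 (inM_injective G k e)

theorem theta_eq_of_seqMap_eq {x y : BSTree G 0} {k : ℕ}
    (h : seqMap (foldMap G a hG h1) (Nat.zero_le k) x
      = seqMap (foldMap G a hG h1) (Nat.zero_le k) y) :
    theta G a hG h1 x = theta G a hG h1 y := by
  have hs : StableFrom (foldMap G a hG h1) k x y := by
    refine ⟨Nat.zero_le k, fun j hj => ?_⟩
    rw [← seqMap_trans _ (Nat.zero_le k) hj, ← seqMap_trans _ (Nat.zero_le k) hj, h, dist_self,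
      dist_self]
  have := hs.dist_toLimit (foldMap_lipschitz G a hG h1)
  rw [h, dist_self] at this
  exact dist_eq_zero.1 this

/-- Limit distance zero is attained at a finite level because distances are eventually constant.
This transfers fixed points from the limit back to the Bass–Serre trees. -/
theorem seqMap_eq_of_theta_eq (hs : ∀ (l : ℕ) (x y : BSTree G l), EvStable (foldMap G a hG h1) x y)
    {x y : BSTree G 0} (h : theta G a hG h1 x = theta G a hG h1 y) :
    ∃ k, ∀ j, k ≤ j → seqMap (foldMap G a hG h1) (Nat.zero_le j) x
      = seqMap (foldMap G a hG h1) (Nat.zero_le j) y := by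
  obtain ⟨k, hk⟩ := hs 0 x y
  refine ⟨k, fun j hj => ?_⟩
  have := (hk.mono hj).dist_toLimit (foldMap_lipschitz G a hG h1)
  rw [show toLimit (foldMap G a hG h1) (foldMap_lipschitz G a hG h1) x = toLimit _ _ y from h,
    dist_self] at this
  exact dist_eq_zero.1 this.symm

theorem theta_surjective : Function.Surjective (theta G a hG h1) :=
  toLimit_surjective (foldMap_lipschitz G a hG h1)

theorem dist_theta_smul (g : Amalgam G 0) (x y : BSTree G 0) :
    dist (theta G a hG h1 (g • x)) (theta G a hG h1 (g • y))
      = dist (theta G a hG h1 x) (theta G a hG h1 y) := by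
  change limDist _ _ _ = limDist _ _ _
  unfold limDist
  simp only [seqMap_smul, BSTree.dist_smul]

/-- The action of the first group of the sequence on the limit tree. -/
noncomputable def limitSMul (g : Amalgam G 0) (x : LimitTree G a hG h1) : LimitTree G a hG h1 :=
  theta G a hG h1 (g • Function.surjInv (theta_surjective hG h1) x)

theorem limitSMul_theta (g : Amalgam G 0) (x : BSTree G 0) :
    limitSMul hG h1 g (theta G a hG h1 x) = theta G a hG h1 (g • x) := by
  refine dist_eq_zero.1 ?_
  rw [limitSMul, dist_theta_smul, Function.surjInv_eq (theta_surjective hG h1), dist_self]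

/-- The isometric action of the first group of the sequence on the limit tree. -/
noncomputable def limitAction : Amalgam G 0 →* (LimitTree G a hG h1 ≃ᵢ LimitTree G a hG h1) where
  toFun g :=
    { toFun := limitSMul hG h1 g
      invFun := limitSMul hG h1 g⁻¹
      left_inv := fun x => by
        obtain ⟨x, rfl⟩ := theta_surjective hG h1 x
        rw [limitSMul_theta, limitSMul_theta, inv_smul_smul]
      right_inv := fun x => by
        obtain ⟨x, rfl⟩ := theta_surjective hG h1 x
        rw [limitSMul_theta, limitSMul_theta, smul_inv_smul]
      isometry_toFun := Isometry.of_dist_eq fun x y => by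
        obtain ⟨x, rfl⟩ := theta_surjective hG h1 x
        obtain ⟨y, rfl⟩ := theta_surjective hG h1 y
        rw [limitSMul_theta, limitSMul_theta, dist_theta_smul] }
  map_one' := by
    ext x
    obtain ⟨x, rfl⟩ := theta_surjective hG h1 x
    exact (limitSMul_theta hG h1 1 x).trans (by rw [one_smul]; rfl)
  map_mul' g g' := by
    ext x
    obtain ⟨x, rfl⟩ := theta_surjective hG h1 x
    change limitSMul hG h1 (g * g') _ = limitSMul hG h1 g (limitSMul hG h1 g' _)
    rw [limitSMul_theta, limitSMul_theta, limitSMul_theta, mul_smul]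

theorem limitAction_theta (g : Amalgam G 0) (x : BSTree G 0) :
    limitAction hG h1 g (theta G a hG h1 x) = theta G a hG h1 (g • x) :=
  limitSMul_theta hG h1 g x

/-- An element trivial in the limit group is already trivial at some level, where it moves nothing.
Hence the action descends along the surjection onto the limit group. -/
theorem ker_psiHom_le : (psiHom hG h1 0).ker ≤ (limitAction hG h1).ker := by
  intro g hg
  obtain ⟨k, hk, e⟩ := psiHom_eq_one hG h1 (MonoidHom.mem_ker.1 hg)
  rw [MonoidHom.mem_ker]
  ext x
  obtain ⟨x, rfl⟩ := theta_surjective hG h1 x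
  rw [limitAction_theta]
  refine theta_eq_of_seqMap_eq hG h1 (k := k) ?_
  rw [seqMap_smul, e, one_smul]

theorem exists_limit_action (h2 : CondP2 G a) :
    ∃ ρ : LimitGroup G a hG h1 →* (LimitTree G a hG h1 ≃ᵢ LimitTree G a hG h1),
      ∀ (g : Amalgam G 0) (x : BSTree G 0), ρ (psiHom hG h1 0 g) (theta G a hG h1 x)
        = theta G a hG h1 (g • x) := by
  refine ⟨(psiHom hG h1 0).liftOfSurjective (psiHom_surjective hG h1 h2)
    ⟨limitAction hG h1, ker_psiHom_le hG h1⟩, fun g x => ?_⟩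
  rw [← limitAction_theta]
  exact DFunLike.congr_fun (MonoidHom.liftOfRightInverse_comp_apply _ _ _
    ⟨limitAction hG h1, ker_psiHom_le hG h1⟩ g) _

/-! ### Absence of fixed points -/

/-- A fixed point would put a conjugate of one factor into a vertex stabilizer of the other kind;
the factors meet only in the amalgamated subgroup, which would then be all of `M`. -/
theorem no_fixed_point {n : ℕ} (hn : G n ≠ ⊤) (z : BSTree G n) : ∃ h : Amalgam G n, h • z ≠ z := by
  by_contra! hfix
  refine hn (top_le_iff.1 fun x _ => ?_)
  obtain ⟨⟨e, s⟩, rfl⟩ := Quotient.exists_rep z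
  obtain ⟨g, rfl⟩ := QuotientGroup.mk_surjective e
  by_cases hs : s = 1
  · have h := (Quotient.exact (hfix (g * inM G n x * g⁻¹)).symm).2.2.1 hs
    have h' : g⁻¹ * (g * inM G n x * g⁻¹ * g) ∈ (inM' G n).range := QuotientGroup.eq.1 h
    rw [inv_mul_cancel_right, inv_mul_cancel_left] at h'
    exact (inM_mem_range_inM' G).1 h'
  · have h : g⁻¹ * (g * inM' G n x * g⁻¹ * g) ∈ (inM G n).range := by
      obtain ⟨-, h0, -, h2⟩ := Quotient.exact (hfix (g * inM' G n x * g⁻¹)).symm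
      by_cases hs0 : s = 0
      · exact QuotientGroup.eq.1 (h0 hs0)
      · exact edgeGroup_le G n (QuotientGroup.eq.1 (h2 hs0 hs))
    rw [inv_mul_cancel_right, inv_mul_cancel_left] at h
    exact (inM'_mem_range_inM G).1 h

theorem amalgam_fg [Group.FG M] (n : ℕ) : (⊤ : Subgroup (Amalgam G n)).FG := by
  rw [← range_sup_range G n]
  refine Subgroup.FG.sup ?_ ?_
  · exact (Group.fg_iff_subgroup_fg _).1 (Group.fg_range (inM G n))
  · exact (Group.fg_iff_subgroup_fg _).1 (Group.fg_range (inM' G n))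

theorem no_global_fixed_point [Group.FG M] (h2 : CondP2 G a) (hne : ∀ n, G n ≠ ⊤)
    (hs : ∀ (l : ℕ) (x y : BSTree G l), EvStable (foldMap G a hG h1) x y) (x : BSTree G 0) :
    ∃ g : Amalgam G 0, theta G a hG h1 (g • x) ≠ theta G a hG h1 x := by
  by_contra! hfix
  obtain ⟨S, hS⟩ := amalgam_fg (G := G) 0
  -- Finite generation enters here: each generator fixes the image of `x` from some level on, and a
  -- finite set of generators has a common level.
  have hk : ∃ k, ∀ g ∈ S, phiLE G a hG h1 0 k (Nat.zero_le k) g •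
      seqMap (foldMap G a hG h1) (Nat.zero_le k) x
        = seqMap (foldMap G a hG h1) (Nat.zero_le k) x := by
    choose k hk using fun g => seqMap_eq_of_theta_eq hG h1 hs (hfix g)
    refine ⟨S.sup k, fun g hg => ?_⟩
    rw [← seqMap_smul]
    exact hk g _ (Finset.le_sup hg)
  obtain ⟨k, hk⟩ := hk
  obtain ⟨h, hh⟩ := no_fixed_point (hne k) (seqMap (foldMap G a hG h1) (Nat.zero_le k) x)
  obtain ⟨g, rfl⟩ := phiLE_surjective hG h1 h2 (Nat.zero_le k) h
  have hle : Subgroup.closure (S : Set (Amalgam G 0)) ≤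
      (MulAction.stabilizer (Amalgam G k) (seqMap (foldMap G a hG h1) (Nat.zero_le k) x)).comap
        (phiLE G a hG h1 0 k (Nat.zero_le k)) :=
    (Subgroup.closure_le _).2 fun g hg => hk g hg
  rw [hS] at hle
  exact hh (hle (Subgroup.mem_top g))

/-! ### Arc stabilizers -/

theorem exists_conj_of_arc (h2 : CondP2 G a) (ha : ∀ i, ¬ Bad G (a (i + 1)))
    (hc : ∀ i c, c ∈ G (i + 1) → c ∉ G i →
      ¬ Bad G (a (i + 1) * c * (a (i + 1))⁻¹) ∧ ¬ Bad G ((a (i + 1))⁻¹ * c * a (i + 1)))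
    (x y : LimitTree G a hG h1) (hxy : x ≠ y) :
    ∃ (m : ℕ) (g : Amalgam G m) (u v : BSTree G 0), Btw x (theta G a hG h1 u) y ∧
      Btw x (theta G a hG h1 v) y ∧
      ∀ h : Amalgam G 0, theta G a hG h1 (h • u) = theta G a hG h1 u →
        theta G a hG h1 (h • v) = theta G a hG h1 v →
        ∃ c ∈ G m, psiHom hG h1 0 h = psiHom hG h1 m (g * inM G m c * g⁻¹) := by
  have hs := evStable hG h1 ha hc
  have hf := foldMap_lipschitz G a hG h1
  obtain ⟨p, rfl⟩ := theta_surjective hG h1 x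
  obtain ⟨q, rfl⟩ := theta_surjective hG h1 y
  obtain ⟨k, hk⟩ := hs 0 p q
  have hpos : 0 < dist (theta G a hG h1 p) (theta G a hG h1 q) := dist_pos.2 hxy
  -- The level must be late enough for the distance to be stable and for five edges to fit into the
  -- segment.
  obtain ⟨m, hkm, hm⟩ : ∃ m, k ≤ m ∧
      5 / 2 ^ m ≤ dist (theta G a hG h1 p) (theta G a hG h1 q) := by
    obtain ⟨N, hN⟩ := exists_nat_gt (5 / dist (theta G a hG h1 p) (theta G a hG h1 q))
    refine ⟨max k N, le_max_left _ _, ?_⟩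
    have h' : (N : ℝ) ≤ 2 ^ max k N := by
      calc (N : ℝ) ≤ 2 ^ N := by exact_mod_cast Nat.lt_two_pow_self.le
        _ ≤ 2 ^ max k N := pow_le_pow_right₀ (by norm_num) (le_max_right _ _)
    rw [div_le_iff₀ (by positivity)]
    rw [div_lt_iff₀ hpos] at hN
    nlinarith
  have hkm' := hk.mono hkm
  have hdist := hkm'.dist_toLimit hf
  obtain ⟨g, hgA, hgB⟩ := exists_edge_btw _ _ (hm.trans hdist.le)
  obtain ⟨u, hu⟩ := seqMap_surjective (foldMap_surjective hG h1 h2) (Nat.zero_le m) (vA G m g)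
  obtain ⟨v, hv⟩ := seqMap_surjective (foldMap_surjective hG h1 h2) (Nat.zero_le m) (vB G m g)
  have hperm : PermIso (foldMap G a hG h1) (seqMap (foldMap G a hG h1) (Nat.zero_le m) p)
      (seqMap (foldMap G a hG h1) (Nat.zero_le m) q) := by
    intro j hj
    obtain ⟨_, h⟩ := hkm'
    rw [seqMap_trans, seqMap_trans]
    exact h j hj
  have hbtw : ∀ w : BSTree G 0, Btw (seqMap (foldMap G a hG h1) (Nat.zero_le m) p)
      (seqMap (foldMap G a hG h1) (Nat.zero_le m) w)
      (seqMap (foldMap G a hG h1) (Nat.zero_le m) q) →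
      Btw (theta G a hG h1 p) (theta G a hG h1 w) (theta G a hG h1 q) := by
    intro w hw
    obtain ⟨p1, p2, -⟩ := hperm.btw hf hw
    have st : ∀ r t : BSTree G 0, PermIso (foldMap G a hG h1)
        (seqMap (foldMap G a hG h1) (Nat.zero_le m) r)
        (seqMap (foldMap G a hG h1) (Nat.zero_le m) t) →
        dist (theta G a hG h1 r) (theta G a hG h1 t)
          = dist (seqMap (foldMap G a hG h1) (Nat.zero_le m) r)
            (seqMap (foldMap G a hG h1) (Nat.zero_le m) t) := by
      intro r t h
      refine StableFrom.dist_toLimit hf ⟨Nat.zero_le m, fun j hj => ?_⟩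
      have := h j hj
      rwa [seqMap_trans, seqMap_trans] at this
    unfold Btw
    rw [st _ _ p1, st _ _ p2, st _ _ hperm]
    exact hw
  refine ⟨m, g, u, v, hbtw u (hu ▸ hgA), hbtw v (hv ▸ hgB), fun h hhu hhv => ?_⟩
  obtain ⟨k₁, hk₁⟩ := seqMap_eq_of_theta_eq hG h1 hs hhu
  obtain ⟨k₂, hk₂⟩ := seqMap_eq_of_theta_eq hG h1 hs hhv
  -- At this level `h` fixes the images of both ends of the edge chosen at level `m`.
  set j := max m (max k₁ k₂) with hj
  have hmj : m ≤ j := le_max_left _ _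
  have e₁ := hk₁ j ((le_max_left _ _).trans (le_max_right _ _))
  have e₂ := hk₂ j ((le_max_right _ _).trans (le_max_right _ _))
  rw [seqMap_smul, ← seqMap_trans _ (Nat.zero_le m) hmj, hu] at e₁
  rw [seqMap_smul, ← seqMap_trans _ (Nat.zero_le m) hmj, hv] at e₂
  obtain ⟨c, hcm, e⟩ := mem_of_fixes_edge hG h1 ha (fun i c a b => (hc i c a b).2) (j - m) m j hmj
    (by omega) g _ e₁ e₂
  refine ⟨c, hcm, ?_⟩
  rw [← psiHom_phiLE hG h1 (Nat.zero_le j), e, psiHom_phiLE]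

end LimitAction

end StrongLimit

/-! ### Strong convergence and the action on the limit tree. -/

theorem mainTheorem3 {M : Type*} [Group M] [Group.FG M] (G : ℕ → Subgroup M) (hG : StrictMono G)
    (a : ℕ → M) (h1 : CondP1 G a) (h2 : CondP2 G a) (h4 : CondP4 G a) :
    -- `T n` is an `ℝ`-tree with an isometric action of `L n`, and the maps `T n → T (n + 1)` are
    -- surjective equivariant morphisms of `ℝ`-trees
    (∀ n : ℕ, IsRTree (BSTree G n) ∧
      (∀ g : Amalgam G n, Isometry fun x : BSTree G n => g • x) ∧
      IsTreeMorphism (foldMap G a hG.monotone h1 n) ∧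
      Function.Surjective (phi G a hG.monotone h1 n) ∧
      Function.Surjective (foldMap G a hG.monotone h1 n) ∧
      ∀ (g : Amalgam G n) (x : BSTree G n), foldMap G a hG.monotone h1 n (g • x) =
        phi G a hG.monotone h1 n g • foldMap G a hG.monotone h1 n x) ∧
    -- the sequence of trees converges strongly, and its limit is an `ℝ`-tree
    ConvergesStrongly (foldMap G a hG.monotone h1) ∧
    IsRTree (LimitTree G a hG.monotone h1) ∧
    -- the actions of the `L n` induce an isometric action of the limit group on the limit tree
    ∃ ρ : LimitGroup G a hG.monotone h1 →*
        (LimitTree G a hG.monotone h1 ≃ᵢ LimitTree G a hG.monotone h1),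
      (∀ (g : Amalgam G 0) (x : BSTree G 0), ρ (psi G a hG.monotone h1 g)
        (theta G a hG.monotone h1 x) = theta G a hG.monotone h1 (g • x)) ∧
      -- without a global fixed point
      (¬ ∃ x : LimitTree G a hG.monotone h1, ∀ g : LimitGroup G a hG.monotone h1, ρ g x = x) ∧
      -- and such that arc stabilizers are isomorphic to subgroups of the groups `G m`
      ∀ (x y : LimitTree G a hG.monotone h1) (A : Set (LimitTree G a hG.monotone h1)),
        x ≠ y → IsSegment A x y →
          ∃ (m : ℕ) (K : Subgroup (G m)), Nonempty (pointwiseStabilizer ρ A ≃* K) := by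
  have ha := not_bad_of_condP2 hG h2
  have hc : ∀ i c, c ∈ G (i + 1) → c ∉ G i → ¬ Bad G (a (i + 1) * c * (a (i + 1))⁻¹) ∧
      ¬ Bad G ((a (i + 1))⁻¹ * c * a (i + 1)) := fun i c hc hc' =>
    not_bad_of_condP4 hG.monotone h4 hc hc'
  have hs := evStable hG.monotone h1 ha hc
  have hf := foldMap_lipschitz G a hG.monotone h1
  have hX := BSTree.fourPoint G
  have hsurj := foldMap_surjective hG.monotone h1 h2
  have hlim : FourPoint (LimitTree G a hG.monotone h1) := fourPoint_limit hX hf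
  refine ⟨fun n => ⟨BSTree.isRTree, BSTree.isometry_smul, isTreeMorphism_foldMap hG.monotone h1 ha n,
    phi_surjective hG.monotone h1 h2 n, hsurj n, foldMap_smul hG.monotone h1 n⟩,
    convergesStrongly_of_evStable hX hf hs fun l x y =>
      (BSTree.chain x y).mono fun _ _ h => h.permIso hG.monotone h1 ha,
    hlim.isRTree fun x y => ?_, ?_⟩
  · obtain ⟨p, rfl⟩ := theta_surjective hG.monotone h1 x
    obtain ⟨q, rfl⟩ := theta_surjective hG.monotone h1 y
    obtain ⟨k, hk⟩ := hs 0 p q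
    exact hk.exists_segment hf hsurj ((BSTree.chain _ _).segment isPiece_onEdge)
  · obtain ⟨ρ, hρ⟩ := exists_limit_action hG.monotone h1 h2
    refine ⟨ρ, hρ, ?_, fun x y A hxy hA => ?_⟩
    · rintro ⟨x, hx⟩
      obtain ⟨x, rfl⟩ := theta_surjective hG.monotone h1 x
      obtain ⟨g, hg⟩ := no_global_fixed_point hG.monotone h1 h2 (ne_top_of_strictMono hG) hs x
      exact hg ((hρ g x).symm.trans (hx _))
    · obtain ⟨m, g, u, v, hu, hv, hfix⟩ := exists_conj_of_arc hG.monotone h1 h2 ha hc x y hxy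
      rw [hlim.isSegment_eq hA]
      -- An embedding of `G m` onto the conjugate that contains the arc stabilizer; its injectivity
      -- holds because `M` embeds in every amalgam and hence in the limit group.
      let κ : G m →* LimitGroup G a hG.monotone h1 :=
        (MulAut.conj (psiHom hG.monotone h1 m g)).toMonoidHom.comp
          ((psiHom hG.monotone h1 m).comp ((inM G m).comp (G m).subtype))
      have hκ : ∀ c : G m, κ c = psiHom hG.monotone h1 m (g * inM G m c * g⁻¹) := fun c => by
        simp [κ, map_mul]
      have hinj : Function.Injective κ := (MulAut.conj (psiHom hG.monotone h1 m g)).injective.comp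
        ((psiHom_inM_injective hG.monotone h1 m).comp Subtype.val_injective)
      have hle : pointwiseStabilizer ρ {z | Btw x z y} ≤ κ.range := by
        intro h hh
        obtain ⟨h, rfl⟩ := psiHom_surjective hG.monotone h1 h2 h
        obtain ⟨c, hcm, e⟩ := hfix h ((hρ h u).symm.trans (hh _ hu)) ((hρ h v).symm.trans (hh _ hv))
        exact ⟨⟨c, hcm⟩, by rw [hκ, e]⟩
      refine ⟨m, (pointwiseStabilizer ρ {z | Btw x z y}).comap κ, ⟨?_⟩⟩
      exact (MulEquiv.subgroupCongr (Subgroup.map_comap_eq_self hle).symm).trans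
        (Subgroup.equivMapOfInjective _ κ hinj).symm
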